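/- All rational functions have complex coefficients, and $\deg F$ is the maximum of the degrees of the numerator and the denominator of the reduced fraction. A rational function $F$ is \emph{indecomposable} if $F=F_1\circ F_2$ with rational functions $F_1,F_2$ implies that $\deg F_1=1$ or $\deg F_2=1$. A \emph{decomposition} of $F$ is a representation $F=F_1\circ F_2\circ\dots\circ F_r$, $r\ge 1$, with rational functions $F_i$; it is \emph{maximal} if every $F_i$ is indecomposable of degree greater than one. Two decompositions $F=U_1\circ\dots\circ U_k$ and $F=V_1\circ\dots\circ V_m$ are \emph{equivalent} if $k=m$ and there exist rational functions $\mu_0,\mu_1,\dots,\mu_k$ of degree one, with $\mu_0=\mu_k=z$, such that $U_i=\mu_{i-1}^{-1}\circ V_i\circ\mu_i$ for $1\le i\le k$. Two maximal decompositions $\mathcal D,\mathcal E$ of $F$ are \emph{weakly equivalent} if there is a chain $\mathcal F_1,\dots,\mathcal F_s$ of maximal decompositions of $F$ such that $\mathcal F_1=\mathcal D$, $\mathcal F_s$ is equivalent to $\mathcal E$, and, for $1\le i<s$, $\mathcal F_{i+1}$ is obtained from $\mathcal F_i$ by replacing two successive functions by two functions with the same composition. A point $z_0\in\mathbb{CP}^1$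 is a \emph{non-critical value} of $F$ if it has exactly $\deg F$ distinct preimages under $F:\mathbb{CP}^1\to\mathbb{CP}^1$. The \emph{monodromy group} of $F$ is the group of permutations of the fibre $F^{-1}(z_0)$ over a non-critical value $z_0$ that are induced by lifting loops based at $z_0$ in the set of non-critical values of $F$. \textbf{Corollary.} Let $F$ be a rational function whose monodromy group contains a cyclic subgroup with at most two orbits on $F^{-1}(z_0)$. Then any two maximal decompositions of $F$ are weakly equivalent. Furthermore, if $F=F_1\circ\dots\circ F_k$ and $F=R_1\circ\dots\circ R_m$ are two maximal decompositions of $F$, then the multiset of the degrees of $F_1,\dots,F_k$ coincides with the multiset of the degrees of $R_1,\dots,R_m$ (in particular $k=m$). -/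

import Mathlib

namespace RatDecomp

noncomputable section

/-- The composition `F₁(F₂(z))` of rational functions (meaningful for nonconstant `F₂`; for
constant `F₂` the result is again constant). -/
def comp (F₁ F₂ : RatFunc ℂ) : RatFunc ℂ :=
  F₁.eval RatFunc.C F₂

/-- The degree of a rational function: the maximum of the degrees of the numerator and the
denominator of its reduced fraction. -/
def degree (F : RatFunc ℂ) : ℕ :=
  max F.num.natDegree F.denom.natDegree

/-- In any representation `F = F₁ ∘ F₂` one of `F₁`, `F₂` has degree one. -/
def Indecomposable (F : RatFunc ℂ) : Prop :=
  ∀ F₁ F₂ : RatFunc ℂ, F = comp F₁ F₂ → degree F₁ = 1 ∨ degree F₂ = 1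

/-- `F₁ ∘ F₂ ∘ ⋯ ∘ F_r` for the list `[F₁, F₂, …, F_r]`. -/
def compList (D : List (RatFunc ℂ)) : RatFunc ℂ :=
  D.foldr comp RatFunc.X

/-- The list `D = [F₁, …, F_r]`, `r ≥ 1`, is a decomposition of `F`. -/
def IsDecomposition (F : RatFunc ℂ) (D : List (RatFunc ℂ)) : Prop :=
  D ≠ [] ∧ compList D = F

/-- A decomposition into indecomposable functions of degree greater than one. -/
def IsMaximalDecomposition (F : RatFunc ℂ) (D : List (RatFunc ℂ)) : Prop :=
  IsDecomposition F D ∧ ∀ f ∈ D, Indecomposable f ∧ 1 < degree f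

/-- Equivalence of decompositions: `U = [U₁, …, U_k]` and `V = [V₁, …, V_k]` have the same length
and `U_i = μ_{i-1}⁻¹ ∘ V_i ∘ μ_i` (written as `μ_{i-1} ∘ U_i = V_i ∘ μ_i`) with all `μ_i` of degree
one and `μ_0`, `μ_k` the identity. List indices start at zero. -/
def Equivalent (U V : List (RatFunc ℂ)) : Prop :=
  U.length = V.length ∧
    ∃ μ : ℕ → RatFunc ℂ, (∀ i, degree (μ i) = 1) ∧ μ 0 = RatFunc.X ∧ μ U.length = RatFunc.X ∧
      ∀ (i : ℕ) (hU : i < U.length) (hV : i < V.length),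
        comp (μ i) U[i] = comp V[i] (μ (i + 1))

/-- Both lists are maximal decompositions of `F`, and the second one arises from the first one by
replacing two successive functions by two functions with the same composition. -/
def Step (F : RatFunc ℂ) (D E : List (RatFunc ℂ)) : Prop :=
  IsMaximalDecomposition F D ∧ IsMaximalDecomposition F E ∧
    ∃ (A B : List (RatFunc ℂ)) (f g f' g' : RatFunc ℂ),
      D = A ++ f :: g :: B ∧ E = A ++ f' :: g' :: B ∧ comp f g = comp f' g'

/-- Weak equivalence of maximal decompositions of `F`: a finite chain of replacements as above
leads from `D` to a decomposition equivalent to `E`. -/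
def WeaklyEquivalent (F : RatFunc ℂ) (D E : List (RatFunc ℂ)) : Prop :=
  ∃ D' : List (RatFunc ℂ), Relation.ReflTransGen (Step F) D D' ∧ Equivalent D' E

/-- The self-map of the Riemann sphere `ℂ ∪ {∞}` given by a rational function. The value at `∞` is
the limit: with `d = degree F`, it is the quotient of the coefficients of `z ^ d` in the numerator
and the denominator. -/
def sphereMap (F : RatFunc ℂ) : OnePoint ℂ → OnePoint ℂ
  | OnePoint.some z =>
      if F.denom.eval z = 0 then OnePoint.infty
      else OnePoint.some (F.num.eval z / F.denom.eval z)
  | OnePoint.infty =>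
      if F.denom.coeff (degree F) = 0 then OnePoint.infty
      else OnePoint.some (F.num.coeff (degree F) / F.denom.coeff (degree F))

/-- The non-critical values of `F`: the points of the sphere with exactly `degree F` distinct
preimages. -/
def noncriticalValues (F : RatFunc ℂ) : Set (OnePoint ℂ) :=
  {y | (sphereMap F ⁻¹' {y}).encard = degree F}

/-- The fibre of `F` over a point of the sphere. -/
abbrev Fiber (F : RatFunc ℂ) (y : OnePoint ℂ) : Type :=
  {x : OnePoint ℂ // sphereMap F x = y}

/-- The monodromy group of `F`, realized on the fibre over the non-critical value `z₀`: the
permutations `σ` for which there is a loop `γ` at `z₀` in the set of non-critical values such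
that for every `x` in the fibre a lift of `γ` leads from `x` to `σ x`. -/
def monodromyGroup (F : RatFunc ℂ) (z₀ : noncriticalValues F) :
    Subgroup (Equiv.Perm (Fiber F z₀)) where
  carrier := {σ | ∃ γ : Path z₀ z₀, ∀ x : Fiber F z₀,
    ∃ δ : Path (x : OnePoint ℂ) (σ x : OnePoint ℂ), ∀ t, sphereMap F (δ t) = γ t}
  one_mem' := ⟨Path.refl z₀, fun x => ⟨Path.refl x.1, fun _ => x.2⟩⟩
  mul_mem' := by
    rintro σ τ ⟨γ, hγ⟩ ⟨γ', hγ'⟩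
    refine ⟨γ'.trans γ, fun x => ?_⟩
    obtain ⟨δ', hδ'⟩ := hγ' x
    obtain ⟨δ, hδ⟩ := hγ (τ x)
    have h : ∀ t, sphereMap F ((δ'.trans δ) t) = ((γ'.trans γ) t : noncriticalValues F) := by
      intro t
      rw [Path.trans_apply, Path.trans_apply]
      split_ifs
      · exact hδ' _
      · exact hδ _
    exact ⟨δ'.trans δ, h⟩
  inv_mem' := by
    rintro σ ⟨γ, hγ⟩
    refine ⟨γ.symm, fun x => ?_⟩
    obtain ⟨δ, hδ⟩ := hγ (σ⁻¹ x)
    refine ⟨(δ.cast rfl (by simp)).symm, fun t => ?_⟩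
    simpa using hδ (unitInterval.symm t)

end

end RatDecomp

/-! Attach to `F₁ ∘ ⋯ ∘ F_k` the fields generated by its tails. This is a chain from ℂ(F) to ℂ(X) in
which ℂ(f ∘ h) has degree `deg f` below ℂ(h). By Lüroth's theorem every intermediate field arises
this way, so a decomposition is maximal exactly when each step of the chain is a covering
(`indecomposable_iff_covBy`). The corollary becomes a Jordan–Hölder statement for the fields between
ℂ(F) and ℂ(X). `ExchangeProperty.reflTransGen_step` derives it, by induction on the degree, from an
exchange property: two different fields covering E are both covered by their join, and the four
degrees either match crosswise or the two lower ones are equal.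

In a Galois extension N of ℂ(F) containing ℂ(X), the fields turn into subgroups containing the
stabilizer of X, with the order reversed. The exchange property is then the group statement
`TwoOrbits.exchange`: A and B are different maximal subgroups of J, S = A ∩ B, and ⟨c⟩ has at most
two orbits on J/S, those of S and gS. A subgroup M ⊇ S is described by the period of c at M and by
the exponents i with c^i g ∈ M. If S meets ⟨c⟩g, or exactly one of A and B does, the periods force J
= AB; the same holds for intermediate subgroups, and Dedekind's law gives maximality of S. It cannot
happen that neither meets it. If both do but S does not, let d be the gcd of the two periods. For d
= 2 again J = AB. For d ≠ 2 the setwise stabilizer of AB shows that the periods divide each other,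
so [J : A] = [J : B].

It remains to find a Galois automorphism permuting the conjugates of X as a given monodromy
permutation σ permutes the fibre (`exists_equiv_of_mem_monodromyGroup`). Call a numbering of a fibre
by the conjugates admissible if it satisfies all polynomial relations over ℂ that hold between the
conjugates and the parameter v. Admissible numberings exist over every noncritical value other than
F(∞), by specializing v. On one fibre they differ by Galois permutations, because a Galois-invariant
polynomial in the conjugates is a rational function of v. They are closed under limits, so the
Galois coset of a numbering is constant along lifts of a path. After going around a loop, σ is
therefore a Galois permutation up to renumbering. -/

namespace RatDecomp

/-! ### Cyclic groups with two orbits: periods, and subgroups with product J -/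

section GroupTheory

variable {G : Type*} [Group G]

/-- Both indices count an orbit of the trivial coset in G/A; the hypothesis says that B already
reaches the whole J-orbit. -/
theorem Subgroup.relIndex_eq_of_forall_exists {A B J : Subgroup G} (hBJ : B ≤ J)
    (h : ∀ j ∈ J, ∃ b ∈ B, b⁻¹ * j ∈ A) : A.relIndex J = A.relIndex B := by
  have key : ∀ M : Subgroup G,
      A.relIndex M = Nat.card (MulAction.orbit M ((1 : G) : G ⧸ A)) := by
    intro M
    rw [Nat.card_coe_set_eq, ← MulAction.index_stabilizer]
    unfold Subgroup.relIndex
    congr 1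
    ext ⟨m, hm⟩
    rw [MulAction.mem_stabilizer_iff, Subgroup.mem_subgroupOf]
    change m ∈ A ↔ ((m * 1 : G) : G ⧸ A) = _
    rw [QuotientGroup.eq, mul_one, mul_one, inv_mem_iff]
  rw [key, key]
  congr 2
  apply Set.Subset.antisymm
  · rintro _ ⟨⟨j, hj⟩, rfl⟩
    obtain ⟨b, hb, hbj⟩ := h j hj
    refine ⟨⟨b, hb⟩, ?_⟩
    change ((b * 1 : G) : G ⧸ A) = ((j * 1 : G) : G ⧸ A)
    rw [QuotientGroup.eq]
    simpa using hbj
  · rintro _ ⟨⟨b, hb⟩, rfl⟩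
    exact ⟨⟨b, hBJ hb⟩, rfl⟩

/-- The exponents i with u^i ∈ A form a subgroup of ℤ, nonzero since u has finite order. Its
generator is the length of the ⟨u⟩-orbit of the trivial coset in G/A. -/
theorem exists_period [Finite G] (A : Subgroup G) (u : G) :
    ∃ p : ℤ, 0 < p ∧ (∀ i : ℤ, u ^ i ∈ A ↔ p ∣ i) ∧
      (A.relIndex (Subgroup.zpowers u) : ℤ) = p := by
  let f : Multiplicative ℤ →* G := zpowersHom G u
  have hf : f.range = Subgroup.zpowers u := by
    ext x
    simp [f, Subgroup.mem_zpowers_iff]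
  obtain ⟨a, ha⟩ := Int.subgroup_cyclic (Subgroup.toAddSubgroup' (A.comap f))
  have hmem : ∀ i : ℤ, u ^ i ∈ A ↔ a ∣ i := by
    intro i
    have : i ∈ Subgroup.toAddSubgroup' (A.comap f) ↔ u ^ i ∈ A := by
      change f (Multiplicative.ofAdd i) ∈ A ↔ _
      simp [f]
    rw [← this, ha, ← AddSubgroup.zmultiples_eq_closure, Int.mem_zmultiples_iff]
  have hidx : A.relIndex (Subgroup.zpowers u) = a.natAbs := by
    rw [← hf, ← Subgroup.index_comap, ← Int.index_zmultiples, AddSubgroup.zmultiples_eq_closure,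
      ← ha]
    rfl
  have ha0 : a ≠ 0 := by
    rintro rfl
    have h1 := (hmem (orderOf u : ℤ)).1 (by simp)
    have h2 : (orderOf u : ℤ) = 0 := by simpa using h1
    have := orderOf_pos u
    omega
  refine ⟨a.natAbs, by positivity, fun i => ?_, by rw [hidx]⟩
  rw [hmem, Int.natAbs_dvd]

theorem Int.exists_eq_add_of_gcd_dvd {p q i : ℤ} (h : (Int.gcd p q : ℤ) ∣ i) :
    ∃ u v, i = p * u + q * v := by
  obtain ⟨k, rfl⟩ := h
  refine ⟨Int.gcdA p q * k, Int.gcdB p q * k, ?_⟩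
  rw [Int.gcd_eq_gcd_ab]
  ring

/-- Every element of `J` lies in `⟨c⟩ S` or in `⟨c⟩ g S`. -/
structure TwoOrbits (c g : G) (S J : Subgroup G) : Prop where
  c_mem : c ∈ J
  g_mem : g ∈ J
  le : S ≤ J
  cover : ∀ x ∈ J, ∃ i : ℤ, ∃ s ∈ S, x = c ^ i * s ∨ x = c ^ i * g * s

/-- The sets `A B` and `J` coincide (for subgroups `A`, `B` of `J`). -/
def Covers (A B J : Subgroup G) : Prop :=
  ∀ j ∈ J, ∃ a ∈ A, ∃ b ∈ B, j = a * b

theorem Covers.symm {A B J : Subgroup G} (h : Covers A B J) : Covers B A J := by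
  intro j hj
  obtain ⟨a, ha, b, hb, hab⟩ := h j⁻¹ (inv_mem hj)
  refine ⟨b⁻¹, inv_mem hb, a⁻¹, inv_mem ha, ?_⟩
  rw [← mul_inv_rev, ← hab, inv_inv]

theorem Covers.relIndex_eq {A B J : Subgroup G} (h : Covers A B J) (hBJ : B ≤ J) :
    A.relIndex J = (A ⊓ B).relIndex B := by
  rw [Subgroup.inf_relIndex_right]
  refine Subgroup.relIndex_eq_of_forall_exists hBJ fun j hj => ?_
  obtain ⟨b, hb, a, ha, rfl⟩ := h.symm j hj
  exact ⟨b, hb, by simpa using ha⟩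

/-- Dedekind's law. -/
theorem Covers.eq_of_le {A B T J : Subgroup G} (h : Covers T B J) (hAJ : A ≤ J) (hTA : T ≤ A)
    (hS : A ⊓ B ≤ T) : T = A := by
  refine le_antisymm hTA fun a ha => ?_
  obtain ⟨t, ht, b, hb, rfl⟩ := h a (hAJ ha)
  have : b ∈ A := by simpa using mul_mem (inv_mem (hTA ht)) ha
  exact mul_mem ht (hS ⟨this, hb⟩)

variable {c g : G} {S A B T J : Subgroup G}

/-- A subset of `J` containing `1` and closed under right multiplication by `A` and `B`
is all of `A ⊔ B`. -/
theorem mem_of_mem_sup {Y : Set G} (h1 : (1 : G) ∈ Y) (hA : ∀ y ∈ Y, ∀ a ∈ A, y * a ∈ Y)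
    (hB : ∀ y ∈ Y, ∀ b ∈ B, y * b ∈ Y) {x : G} (hx : x ∈ A ⊔ B) : x ∈ Y := by
  rw [← Subgroup.closure_eq A, ← Subgroup.closure_eq B, ← Subgroup.closure_union] at hx
  induction hx using Subgroup.closure_induction_right with
  | one => exact h1
  | mul_right x _ y hy ih =>
    rcases hy with hy | hy
    · exact hA x ih y hy
    · exact hB x ih y hy
  | mul_inv_cancel x _ y hy ih =>
    rcases hy with hy | hy
    · exact hA x ih _ (inv_mem hy)
    · exact hB x ih _ (inv_mem hy)

section Transitive

variable {p k : ℤ}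

theorem zpow_mul_mem_iff (hp : ∀ i : ℤ, c ^ i ∈ A ↔ p ∣ i) (hk : c ^ k * g ∈ A) (i : ℤ) :
    c ^ i * g ∈ A ↔ p ∣ i - k := by
  rw [← hp, ← Subgroup.mul_mem_cancel_right A (x := c ^ k * g) (y := c ^ (i - k)) hk, ← mul_assoc,
    ← zpow_add, sub_add_cancel]

theorem inv_mul_zpow_mem_iff (hp : ∀ i : ℤ, c ^ i ∈ A ↔ p ∣ i) (hk : c ^ k * g ∈ A) (i : ℤ) :
    g⁻¹ * c ^ i ∈ A ↔ p ∣ i + k := by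
  rw [← inv_mem_iff, mul_inv_rev, inv_inv, ← zpow_neg, zpow_mul_mem_iff hp hk, ← dvd_neg]
  congr! 1
  ring

/-- Since c^k g ∈ A, the coset gA equals c^{-k}A. It lies on the ⟨c⟩-orbit of A and has the same
period there. -/
theorem conj_zpow_mem_iff (hp : ∀ i : ℤ, c ^ i ∈ A ↔ p ∣ i) (hk : c ^ k * g ∈ A) (i : ℤ) :
    g⁻¹ * c ^ i * g ∈ A ↔ p ∣ i := by
  rw [← hp, ← Subgroup.mul_mem_cancel_left A hk]
  have : c ^ k * g * (g⁻¹ * c ^ i * g) = c ^ i * (c ^ k * g) := by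
    simp only [mul_assoc, mul_inv_cancel_left]
    rw [← mul_assoc, ← mul_assoc, ← zpow_add, ← zpow_add, add_comm]
  rw [this, Subgroup.mul_mem_cancel_right A hk]

end Transitive

theorem TwoOrbits.mono (h : TwoOrbits c g S J) (hST : S ≤ T) (hTJ : T ≤ J) :
    TwoOrbits c g T J where
  c_mem := h.c_mem
  g_mem := h.g_mem
  le := hTJ
  cover x hx := by
    obtain ⟨i, s, hs, h⟩ := h.cover x hx
    exact ⟨i, s, hST hs, h⟩

/-- The equivalence relation "same residue modulo `d`" bounds the join of `A` and `B`. -/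
theorem TwoOrbits.dvd_one (h : TwoOrbits c g S J) (hSA : S ≤ A) (hSB : S ≤ B)
    (hJ : A ⊔ B = J) {d k : ℤ}
    (hA1 : ∀ i : ℤ, c ^ i ∈ A → d ∣ i) (hA2 : ∀ i : ℤ, c ^ i * g ∈ A → d ∣ i - k)
    (hA3 : ∀ i : ℤ, g⁻¹ * c ^ i * g ∈ A → d ∣ i)
    (hB1 : ∀ i : ℤ, c ^ i ∈ B → d ∣ i) (hB2 : ∀ i : ℤ, c ^ i * g ∈ B → d ∣ i - k)
    (hB3 : ∀ i : ℤ, g⁻¹ * c ^ i * g ∈ B → d ∣ i) : d ∣ 1 := by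
  -- Give c^i s the residue i and c^i g s the residue i - k. Right multiplication by elements of A
  -- or B does not change residues modulo d, so the elements of residue 0 exhaust J. But c ∈ J has
  -- residue 1.
  let Y : Set G := {x | ∃ i : ℤ, ∃ s ∈ S, (x = c ^ i * s ∧ d ∣ i) ∨ (x = c ^ i * g * s ∧ d ∣ i - k)}
  have key : ∀ M : Subgroup G, S ≤ M → M ≤ J → (∀ i : ℤ, c ^ i ∈ M → d ∣ i) →
      (∀ i : ℤ, c ^ i * g ∈ M → d ∣ i - k) → (∀ i : ℤ, g⁻¹ * c ^ i * g ∈ M → d ∣ i) →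
      ∀ y ∈ Y, ∀ m ∈ M, y * m ∈ Y := by
    rintro M hSM hMJ h1 h2 h3 _ ⟨i, s, hs, ⟨rfl, hi⟩ | ⟨rfl, hi⟩⟩ m hm
    · have hsm : s * m ∈ M := mul_mem (hSM hs) hm
      obtain ⟨j, t, ht, e | e⟩ := h.cover _ (hMJ hsm)
      · refine ⟨i + j, t, ht, Or.inl ⟨?_, dvd_add hi (h1 j ?_)⟩⟩
        · rw [mul_assoc, e, zpow_add, mul_assoc]
        · rwa [e, Subgroup.mul_mem_cancel_right _ (hSM ht)] at hsm
      · refine ⟨i + j, t, ht, Or.inr ⟨?_, ?_⟩⟩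
        · rw [mul_assoc, e, zpow_add]; simp only [mul_assoc]
        · rw [e, Subgroup.mul_mem_cancel_right _ (hSM ht)] at hsm
          have := dvd_add hi (h2 j hsm)
          rwa [← add_sub_assoc] at this
    · have hsm : s * m ∈ M := mul_mem (hSM hs) hm
      obtain ⟨j, t, ht, e | e⟩ := h.cover _ (mul_mem h.g_mem (hMJ hsm))
      · have e' : s * m = g⁻¹ * c ^ j * t := by rw [mul_assoc, ← e, inv_mul_cancel_left]
        refine ⟨i + j, t, ht, Or.inl ⟨?_, ?_⟩⟩
        · rw [mul_assoc, mul_assoc, e, zpow_add, mul_assoc]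
        · rw [e', Subgroup.mul_mem_cancel_right _ (hSM ht), ← inv_mem_iff, mul_inv_rev, inv_inv,
            ← zpow_neg] at hsm
          have := dvd_sub hi (h2 _ hsm)
          rwa [show i - k - (-j - k) = i + j by ring] at this
      · have e' : s * m = g⁻¹ * c ^ j * g * t := by
          rw [mul_assoc, mul_assoc, ← mul_assoc (c ^ j), ← e, inv_mul_cancel_left]
        refine ⟨i + j, t, ht, Or.inr ⟨?_, ?_⟩⟩
        · rw [mul_assoc, mul_assoc, e, zpow_add]; simp only [mul_assoc]
        · rw [e', Subgroup.mul_mem_cancel_right _ (hSM ht)] at hsm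
          have := dvd_add hi (h3 _ hsm)
          rwa [show i - k + j = i + j - k by ring] at this
  have hAJ : A ≤ J := hJ ▸ le_sup_left
  have hBJ : B ≤ J := hJ ▸ le_sup_right
  have hc : c ∈ Y := by
    refine mem_of_mem_sup (Y := Y) ⟨0, 1, one_mem _, Or.inl ⟨by simp, by simp⟩⟩
      (key A hSA hAJ hA1 hA2 hA3) (key B hSB hBJ hB1 hB2 hB3) (hJ ▸ h.c_mem)
  obtain ⟨i, s, hs, ⟨e, hi⟩ | ⟨e, hi⟩⟩ := hc
  · have : c ^ (1 - i) ∈ A := by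
      rw [sub_eq_neg_add, zpow_add, zpow_one, zpow_neg]
      nth_rw 2 [e]
      simpa using hSA hs
    simpa using dvd_add (hA1 _ this) hi
  · have : c ^ (i - 1) * g ∈ A := by
      have : c ^ (i - 1) * g = s⁻¹ := by
        rw [sub_eq_neg_add, zpow_add, eq_inv_iff_mul_eq_one, mul_assoc, mul_assoc,
          ← mul_assoc (c ^ i), ← e]
        simp
      rw [this]
      exact inv_mem (hSA hs)
    have := dvd_sub hi (hA2 _ this)
    rwa [show i - k - (i - 1 - k) = 1 by ring] at this

/-- If neither subgroup meets `⟨c⟩ g`, neither does the join. -/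
theorem TwoOrbits.sup_ne (h : TwoOrbits c g S J) (hSA : S ≤ A) (hSB : S ≤ B)
    (hA : ∀ i : ℤ, c ^ i * g ∉ A) (hB : ∀ i : ℤ, c ^ i * g ∉ B) : A ⊔ B ≠ J := by
  intro hJ
  let Y : Set G := {x | ∃ i : ℤ, ∃ s ∈ S, x = c ^ i * s}
  have key : ∀ M : Subgroup G, S ≤ M → M ≤ J → (∀ i : ℤ, c ^ i * g ∉ M) →
      ∀ y ∈ Y, ∀ m ∈ M, y * m ∈ Y := by
    rintro M hSM hMJ h1 _ ⟨i, s, hs, rfl⟩ m hm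
    have hsm : s * m ∈ M := mul_mem (hSM hs) hm
    obtain ⟨j, t, ht, e | e⟩ := h.cover _ (hMJ hsm)
    · exact ⟨i + j, t, ht, by rw [mul_assoc, e, zpow_add, mul_assoc]⟩
    · rw [e, Subgroup.mul_mem_cancel_right _ (hSM ht)] at hsm
      exact absurd hsm (h1 j)
  have hg : g ∈ Y := by
    refine mem_of_mem_sup (Y := Y) ⟨0, 1, one_mem _, by simp⟩
      (key A hSA (hJ ▸ le_sup_left) hA) (key B hSB (hJ ▸ le_sup_right) hB) (hJ ▸ h.g_mem)
  obtain ⟨i, s, hs, e⟩ := hg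
  refine hA (-i) ?_
  rw [e]
  simpa using hSA hs

/-- The case of a transitive cyclic group. -/
theorem TwoOrbits.covers_of_transitive [Finite G] (h : TwoOrbits c g S J) (hSA : S ≤ A)
    (hSB : S ≤ B) (hJ : A ⊔ B = J) {k : ℤ} (hk : c ^ k * g ∈ S) : Covers A B J := by
  obtain ⟨p, -, hp, -⟩ := exists_period A c
  obtain ⟨q, -, hq, -⟩ := exists_period B c
  have hpd : (Int.gcd p q : ℤ) ∣ p := Int.gcd_dvd_left ..
  have hqd : (Int.gcd p q : ℤ) ∣ q := Int.gcd_dvd_right ..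
  have hd : (Int.gcd p q : ℤ) ∣ 1 := h.dvd_one hSA hSB hJ (k := k)
    (fun i hi => hpd.trans ((hp i).1 hi))
    (fun i hi => hpd.trans ((zpow_mul_mem_iff hp (hSA hk) i).1 hi))
    (fun i hi => hpd.trans ((conj_zpow_mem_iff hp (hSA hk) i).1 hi))
    (fun i hi => hqd.trans ((hq i).1 hi))
    (fun i hi => hqd.trans ((zpow_mul_mem_iff hq (hSB hk) i).1 hi))
    (fun i hi => hqd.trans ((conj_zpow_mem_iff hq (hSB hk) i).1 hi))
  have key : ∀ (i : ℤ), ∀ s ∈ S, ∃ a ∈ A, ∃ b ∈ B, c ^ i * s = a * b := by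
    intro i s hs
    obtain ⟨u, v, rfl⟩ := Int.exists_eq_add_of_gcd_dvd (hd.trans (one_dvd i))
    exact ⟨c ^ (p * u), (hp _).2 (dvd_mul_right _ _), c ^ (q * v) * s,
      mul_mem ((hq _).2 (dvd_mul_right _ _)) (hSB hs), by rw [zpow_add, mul_assoc]⟩
  intro x hx
  obtain ⟨i, s, hs, rfl | rfl⟩ := h.cover x hx
  · exact key i s hs
  · have : c ^ i * g * s = c ^ (i - k) * (c ^ k * g * s) := by
      simp only [← mul_assoc, ← zpow_add, sub_add_cancel]
    rw [this]
    exact key _ _ (mul_mem hk hs)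

end GroupTheory

/-! ### One or both subgroups meet ⟨c⟩g -/

section GroupTheory

variable {G : Type*} [Group G] {c g : G} {S A B T J : Subgroup G}

theorem zpow_conj (c g : G) (i : ℤ) : (g⁻¹ * c * g) ^ i = g⁻¹ * c ^ i * g := by
  have := conj_zpow (a := g⁻¹) (b := c) (i := i)
  rwa [inv_inv] at this

/-- The condition p ∣ qj depends on q only through gcd(p, q), so u is p / gcd(p, q). In the
application this turns equality of two indices into equality of two gcds. -/
theorem Int.mul_gcd_eq_of_forall_dvd_iff {p q u : ℤ} (hp : 0 < p) (hu : 0 < u)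
    (h : ∀ j : ℤ, u ∣ j ↔ p ∣ q * j) : u * Int.gcd p q = p := by
  have hg0 : (0 : ℤ) < Int.gcd p q := by
    exact_mod_cast Int.gcd_pos_of_ne_zero_left _ hp.ne'
  have hd : ∀ j : ℤ, u ∣ j ↔ p ∣ Int.gcd p q * j := fun j => by
    rw [h, Int.dvd_gcd_mul_iff_dvd_mul]
  obtain ⟨p₁, hp₁⟩ := Int.gcd_dvd_left p q
  generalize (Int.gcd p q : ℤ) = d at *
  subst hp₁
  have hp₁0 : 0 < p₁ := pos_of_mul_pos_right hp hg0.le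
  have hu' : ∀ j, u ∣ j ↔ p₁ ∣ j := fun j => by rw [hd, mul_dvd_mul_iff_left hg0.ne']
  rw [Int.dvd_antisymm hu.le hp₁0.le ((hu' _).2 dvd_rfl) ((hu' _).1 dvd_rfl), mul_comm]

/-- One subgroup meets `⟨c⟩ g` and the other does not. -/
theorem TwoOrbits.covers_of_mixed [Finite G] (h : TwoOrbits c g S J) (hS : A ⊓ B = S)
    (hJ : A ⊔ B = J) {k : ℤ} (hk : c ^ k * g ∈ A) (hB : ∀ i : ℤ, c ^ i * g ∉ B) :
    Covers A B J := by
  have hSA : S ≤ A := hS ▸ inf_le_left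
  have hSB : S ≤ B := hS ▸ inf_le_right
  have hBJ : B ≤ J := hJ ▸ le_sup_right
  obtain ⟨p, hp0, hp, -⟩ := exists_period A c
  obtain ⟨q, hq0, hq, -⟩ := exists_period B c
  obtain ⟨q', hq0', hq', -⟩ := exists_period B (g⁻¹ * c * g)
  simp only [zpow_conj] at hq'
  have hp' := conj_zpow_mem_iff hp hk
  have hB' : ∀ i : ℤ, g⁻¹ * c ^ i ∉ B := by
    intro i hi
    apply hB (-i)
    rw [← inv_mem_iff]
    simpa using hi
  -- both orbits see the same index `[B : S]`
  obtain ⟨m, hm0, hm, hmi⟩ := exists_period S (c ^ q)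
  obtain ⟨m', hm0', hm', hmi'⟩ := exists_period S ((g⁻¹ * c * g) ^ q')
  have hmm : m = m' := by
    rw [← hmi, ← hmi']
    congr 1
    trans S.relIndex B
    · symm
      refine Subgroup.relIndex_eq_of_forall_exists ?_ fun b hb => ?_
      · rw [Subgroup.zpowers_le]
        exact (hq _).2 dvd_rfl
      obtain ⟨j, s, hs, e | e⟩ := h.cover _ (hBJ hb)
      · rw [e, Subgroup.mul_mem_cancel_right B (hSB hs)] at hb
        obtain ⟨v, rfl⟩ := (hq _).1 hb
        refine ⟨_, Subgroup.zpow_mem_zpowers _ v, ?_⟩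
        rw [← zpow_mul, e]
        simpa using hs
      · rw [e, Subgroup.mul_mem_cancel_right B (hSB hs)] at hb
        exact absurd hb (hB j)
    · refine Subgroup.relIndex_eq_of_forall_exists ?_ fun b hb => ?_
      · rw [Subgroup.zpowers_le, zpow_conj]
        exact (hq' _).2 dvd_rfl
      obtain ⟨j, s, hs, e | e⟩ := h.cover _ (mul_mem h.g_mem (hBJ hb))
      · exfalso
        apply hB' j
        rw [← Subgroup.mul_mem_cancel_right B (hSB hs), mul_assoc, ← e]
        simpa using hb
      · have e' : b = g⁻¹ * c ^ j * g * s := by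
          rw [mul_assoc, mul_assoc, ← mul_assoc (c ^ j), ← e, inv_mul_cancel_left]
        rw [e', Subgroup.mul_mem_cancel_right B (hSB hs)] at hb
        obtain ⟨v, rfl⟩ := (hq' _).1 hb
        refine ⟨_, Subgroup.zpow_mem_zpowers _ v, ?_⟩
        rw [← zpow_mul, zpow_conj, e']
        simpa [mul_assoc] using hs
  -- On the orbit of S, c^{qj} ∈ A ∩ B means p ∣ qj. On the orbit of gS the same holds with q' for
  -- q. As m = m', both orbits give the same gcd, so one modulus serves both in `dvd_one`.
  have e1 := Int.mul_gcd_eq_of_forall_dvd_iff (q := q) hp0 hm0 (fun j => by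
    rw [← hm, ← zpow_mul, ← hS, Subgroup.mem_inf, hp, hq]
    exact ⟨fun h => h.1, fun h => ⟨h, dvd_mul_right _ _⟩⟩)
  have e2 := Int.mul_gcd_eq_of_forall_dvd_iff (q := q') hp0 hm0' (fun j => by
    rw [← hm', ← zpow_mul, zpow_conj, ← hS, Subgroup.mem_inf, hp', hq']
    exact ⟨fun h => h.1, fun h => ⟨h, dvd_mul_right _ _⟩⟩)
  have hgg : (Int.gcd p q : ℤ) = Int.gcd p q' := by
    rw [← hmm] at e2
    exact mul_left_cancel₀ hm0.ne' (e1.trans e2.symm)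
  have hpd : (Int.gcd p q : ℤ) ∣ p := Int.gcd_dvd_left ..
  have hqd : (Int.gcd p q : ℤ) ∣ q := Int.gcd_dvd_right ..
  have hqd' : (Int.gcd p q : ℤ) ∣ q' := hgg ▸ Int.gcd_dvd_right ..
  have hd : (Int.gcd p q : ℤ) ∣ 1 := h.dvd_one hSA hSB hJ (k := k)
    (fun i hi => hpd.trans ((hp i).1 hi))
    (fun i hi => hpd.trans ((zpow_mul_mem_iff hp hk i).1 hi))
    (fun i hi => hpd.trans ((hp' i).1 hi))
    (fun i hi => hqd.trans ((hq i).1 hi))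
    (fun i hi => absurd hi (hB i))
    (fun i hi => hqd'.trans ((hq' i).1 hi))
  intro x hx
  obtain ⟨i, s, hs, rfl | rfl⟩ := h.cover x hx
  · obtain ⟨u, v, rfl⟩ := Int.exists_eq_add_of_gcd_dvd (hd.trans (one_dvd i))
    exact ⟨c ^ (p * u), (hp _).2 (dvd_mul_right _ _), c ^ (q * v) * s,
      mul_mem ((hq _).2 (dvd_mul_right _ _)) (hSB hs), by rw [zpow_add, mul_assoc]⟩
  · rw [hgg] at hd
    obtain ⟨u, v, huv⟩ := Int.exists_eq_add_of_gcd_dvd (hd.trans (one_dvd (i - k)))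
    refine ⟨c ^ (k + p * u) * g, (zpow_mul_mem_iff hp hk _).2 (by simp),
      g⁻¹ * c ^ (q' * v) * g * s, mul_mem ((hq' _).2 (dvd_mul_right _ _)) (hSB hs), ?_⟩
    have : i = (k + p * u) + q' * v := by linarith
    rw [this, zpow_add]
    simp only [mul_assoc, mul_inv_cancel_left]

/-- Both subgroups meet `⟨c⟩ g` but their intersection does not: arithmetic of the periods. -/
theorem TwoOrbits.gcd_arith (h : TwoOrbits c g S J) (hS : A ⊓ B = S) (hJ : A ⊔ B = J)
    (hSg : ∀ i : ℤ, c ^ i * g ∉ S) {p q k l : ℤ}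
    (hp : ∀ i : ℤ, c ^ i ∈ A ↔ p ∣ i) (hq : ∀ i : ℤ, c ^ i ∈ B ↔ q ∣ i)
    (hk : c ^ k * g ∈ A) (hl : c ^ l * g ∈ B) :
    ¬ (Int.gcd p q : ℤ) ∣ k - l ∧ IsCoprime (Int.gcd p q : ℤ) (k - l) := by
  have hSA : S ≤ A := hS ▸ inf_le_left
  have hSB : S ≤ B := hS ▸ inf_le_right
  have hpd : (Int.gcd p q : ℤ) ∣ p := Int.gcd_dvd_left ..
  have hqd : (Int.gcd p q : ℤ) ∣ q := Int.gcd_dvd_right ..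
  constructor
  · intro hd
    obtain ⟨u, v, huv⟩ := Int.exists_eq_add_of_gcd_dvd hd
    refine hSg (k - p * u) ?_
    rw [← hS, Subgroup.mem_inf, zpow_mul_mem_iff hp hk, zpow_mul_mem_iff hq hl]
    exact ⟨⟨-u, by ring⟩, ⟨v, by linarith⟩⟩
  · rw [Int.isCoprime_iff_gcd_eq_one]
    set d := Int.gcd (Int.gcd p q : ℤ) (k - l)
    have h1 : (d : ℤ) ∣ Int.gcd p q := Int.gcd_dvd_left ..
    have h2 : (d : ℤ) ∣ k - l := Int.gcd_dvd_right ..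
    have hd : (d : ℤ) ∣ 1 := h.dvd_one hSA hSB hJ (k := k)
      (fun i hi => (h1.trans hpd).trans ((hp i).1 hi))
      (fun i hi => (h1.trans hpd).trans ((zpow_mul_mem_iff hp hk i).1 hi))
      (fun i hi => (h1.trans hpd).trans ((conj_zpow_mem_iff hp hk i).1 hi))
      (fun i hi => (h1.trans hqd).trans ((hq i).1 hi))
      (fun i hi => by
        have h3 := (h1.trans hqd).trans ((zpow_mul_mem_iff hq hl i).1 hi)
        have := dvd_sub h3 h2
        rwa [show i - l - (k - l) = i - k by ring] at this)
      (fun i hi => (h1.trans hqd).trans ((conj_zpow_mem_iff hq hl i).1 hi))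
    exact Nat.dvd_one.1 (by exact_mod_cast hd)

/-- The product AB contains c^i for i ≡ 0 modulo the gcd, and also for i ≡ k - l, through (c^k
g)(c^l g)⁻¹. When the gcd is 2 these two classes are all of ℤ. -/
theorem TwoOrbits.covers_of_gcd_eq_two (h : TwoOrbits c g S J) (hSB : S ≤ B) {p q k l : ℤ}
    (hp : ∀ i : ℤ, c ^ i ∈ A ↔ p ∣ i) (hq : ∀ i : ℤ, c ^ i ∈ B ↔ q ∣ i)
    (hk : c ^ k * g ∈ A) (hl : c ^ l * g ∈ B) (hd : Int.gcd p q = 2)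
    (hkl : ¬ (Int.gcd p q : ℤ) ∣ k - l) : Covers A B J := by
  have key : ∀ i : ℤ, ∃ a ∈ A, ∃ b ∈ B, c ^ i = a * b := by
    intro i
    by_cases hi : (Int.gcd p q : ℤ) ∣ i
    · obtain ⟨u, v, rfl⟩ := Int.exists_eq_add_of_gcd_dvd hi
      exact ⟨c ^ (p * u), (hp _).2 (dvd_mul_right _ _), c ^ (q * v),
        (hq _).2 (dvd_mul_right _ _), by rw [zpow_add]⟩
    · have hi' : (Int.gcd p q : ℤ) ∣ i - (k - l) := by
        rw [hd] at hi hkl ⊢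
        omega
      obtain ⟨u, v, huv⟩ := Int.exists_eq_add_of_gcd_dvd hi'
      refine ⟨c ^ (p * u) * (c ^ k * g), mul_mem ((hp _).2 (dvd_mul_right _ _)) hk,
        (c ^ l * g)⁻¹ * c ^ (q * v), mul_mem (inv_mem hl) ((hq _).2 (dvd_mul_right _ _)), ?_⟩
      have : i = p * u + k + -l + q * v := by linarith
      rw [this]
      simp only [zpow_add, mul_inv_rev, zpow_neg, mul_assoc, mul_inv_cancel_left]
  intro x hx
  obtain ⟨i, s, hs, rfl | rfl⟩ := h.cover x hx
  · obtain ⟨a, ha, b, hb, e⟩ := key i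
    exact ⟨a, ha, b * s, mul_mem hb (hSB hs), by rw [e, mul_assoc]⟩
  · obtain ⟨a, ha, b, hb, e⟩ := key (i - l)
    refine ⟨a, ha, b * (c ^ l * g * s), mul_mem hb (mul_mem hl (hSB hs)), ?_⟩
    rw [← mul_assoc, ← e]
    simp only [← mul_assoc, ← zpow_add, sub_add_cancel]

open Pointwise in
/-- The setwise stabilizer of `A B` forces the period of a maximal `A` to divide that of `B`. -/
theorem TwoOrbits.dvd_of_covBy (h : TwoOrbits c g S J) (hSA : S ≤ A) (hSB : S ≤ B) (hAJ : A ⋖ J)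
    {p q k l : ℤ}
    (hp : ∀ i : ℤ, c ^ i ∈ A ↔ p ∣ i) (hq : ∀ i : ℤ, c ^ i ∈ B ↔ q ∣ i)
    (hk : c ^ k * g ∈ A) (hl : c ^ l * g ∈ B) (hd : Int.gcd p q ≠ 2)
    (hkl : ¬ (Int.gcd p q : ℤ) ∣ k - l) (hcop : IsCoprime (Int.gcd p q : ℤ) (k - l)) : p ∣ q := by
  have hpd : (Int.gcd p q : ℤ) ∣ p := Int.gcd_dvd_left ..
  have hqd : (Int.gcd p q : ℤ) ∣ q := Int.gcd_dvd_right ..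
  -- W contains A and c^{gcd(p, q)}. Maximality leaves W = A, which gives p ∣ gcd(p, q) ∣ q, or W =
  -- J, which makes every power of c an element of AB.
  let W : Subgroup G := MulAction.stabilizer G ((A : Set G) * (B : Set G)) ⊓ J
  have hAW : A ≤ W := by
    refine le_inf (fun a ha => ?_) hAJ.le
    rw [MulAction.mem_stabilizer_iff, ← smul_mul_assoc, smul_coe_set ha]
  have hsub : ∀ i : ℤ, (Int.gcd p q : ℤ) ∣ i →
      c ^ i • ((A : Set G) * (B : Set G)) ⊆ (A : Set G) * (B : Set G) := by
    rintro i hi _ ⟨_, ⟨a, ha, b, hb, rfl⟩, rfl⟩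
    have ha' : a ∈ A := ha
    obtain ⟨u, v, rfl⟩ := Int.exists_eq_add_of_gcd_dvd hi
    obtain ⟨j, s, hs, e | e⟩ := h.cover a (hAJ.le ha)
    · rw [e, Subgroup.mul_mem_cancel_right A (hSA hs)] at ha'
      refine ⟨c ^ (p * u + j), ?_, c ^ (q * v) * (s * b), ?_, ?_⟩
      · rw [zpow_add]
        exact mul_mem ((hp _).2 (dvd_mul_right _ _)) ha'
      · exact mul_mem ((hq _).2 (dvd_mul_right _ _)) (mul_mem (hSB hs) hb)
      · simp only [smul_eq_mul, e, ← mul_assoc, ← zpow_add]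
        congr 3
        ring
    · rw [e, Subgroup.mul_mem_cancel_right A (hSA hs)] at ha'
      refine ⟨c ^ j * g * (g⁻¹ * c ^ (p * u) * g), ?_, g⁻¹ * c ^ (q * v) * g * (s * b), ?_, ?_⟩
      · exact mul_mem ha' ((conj_zpow_mem_iff hp hk _).2 (dvd_mul_right _ _))
      · exact mul_mem ((conj_zpow_mem_iff hq hl _).2 (dvd_mul_right _ _)) (mul_mem (hSB hs) hb)
      · simp only [smul_eq_mul, e, mul_assoc, mul_inv_cancel_left]
        simp only [← mul_assoc, ← zpow_add]
        congr 4
        ring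
  have hcd : c ^ (Int.gcd p q : ℤ) ∈ W := by
    refine Subgroup.mem_inf.2 ⟨?_, zpow_mem h.c_mem _⟩
    rw [MulAction.mem_stabilizer_iff]
    refine Set.Subset.antisymm (hsub _ dvd_rfl) ?_
    rw [Set.subset_smul_set_iff, ← zpow_neg]
    exact hsub _ (dvd_neg.2 dvd_rfl)
  rcases hAJ.eq_or_eq hAW inf_le_right with hW | hW
  · rw [hW, hp] at hcd
    exact hcd.trans hqd
  · exfalso
    have hall : ∀ i : ℤ, (Int.gcd p q : ℤ) ∣ i ∨ (Int.gcd p q : ℤ) ∣ i - (k - l) := by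
      intro i
      have hi : c ^ i ∈ W := hW ▸ zpow_mem h.c_mem i
      have hi' : c ^ i ∈ (A : Set G) * (B : Set G) := by
        rw [← MulAction.mem_stabilizer_iff.1 hi.1]
        exact ⟨1, ⟨1, one_mem _, 1, one_mem _, by simp⟩, by simp⟩
      obtain ⟨a, ha, b, hb, e⟩ := hi'
      have ha' : a ∈ A := ha
      obtain ⟨j, s, hs, e' | e'⟩ := h.cover a (hAJ.le ha)
      · left
        rw [e', Subgroup.mul_mem_cancel_right A (hSA hs), hp] at ha'
        have : c ^ (i - j) ∈ B := by
          rw [sub_eq_neg_add, zpow_add, ← e]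
          simp only [e', zpow_neg, mul_assoc, inv_mul_cancel_left]
          exact mul_mem (hSB hs) hb
        rw [hq] at this
        simpa using dvd_add (hqd.trans this) (hpd.trans ha')
      · right
        rw [e', Subgroup.mul_mem_cancel_right A (hSA hs), zpow_mul_mem_iff hp hk] at ha'
        have : g⁻¹ * c ^ (i - j) ∈ B := by
          rw [sub_eq_neg_add, zpow_add, ← e]
          simp only [e', zpow_neg, mul_assoc, inv_mul_cancel_left]
          exact mul_mem (hSB hs) hb
        rw [inv_mul_zpow_mem_iff hq hl] at this
        have := dvd_add (hqd.trans this) (hpd.trans ha')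
        rwa [show i - j + l + (j - k) = i - (k - l) by ring] at this
    -- Powers of c inside AB have exponents ≡ 0 or k - l. The exponent 2(k - l) would fall in
    -- neither class unless the gcd divides 2.
    have h2 : (Int.gcd p q : ℤ) ∣ 2 := by
      rcases hall (2 * (k - l)) with h1 | h1
      · exact hcop.dvd_of_dvd_mul_right h1
      · rw [show 2 * (k - l) - (k - l) = k - l by ring] at h1
        exact absurd h1 hkl
    have h2' : Int.gcd p q ∣ 2 := by exact_mod_cast h2
    rcases (Nat.dvd_prime Nat.prime_two).1 h2' with h1 | h1
    · rw [h1] at hkl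
      exact hkl (by simp)
    · exact hd h1

end GroupTheory

/-! ### Maximality of the intersection, and the exchange theorem -/

section GroupTheory

variable {G : Type*} [Group G] {c g : G} {S A B T J : Subgroup G}

/-- If `q ∣ r` for the periods `q` of `B` and `r` of `T`, then `J` acts on `J ⧸ B` as on a cycle of
length `q`; an even `q > 2` contradicts the maximality of `B`. -/
theorem TwoOrbits.not_covBy_of_even (h : TwoOrbits c g S J) (hST : S ≤ T) (hSB : S ≤ B)
    (hTJ : T ≤ J) {r q k l : ℤ}
    (hr : ∀ i : ℤ, c ^ i ∈ T ↔ r ∣ i) (hq : ∀ i : ℤ, c ^ i ∈ B ↔ q ∣ i)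
    (hk : c ^ k * g ∈ T) (hl : c ^ l * g ∈ B) (hqr : q ∣ r) (hq2 : 2 ∣ q) (hq2' : ¬ q ∣ 2)
    (hcop : IsCoprime q (k - l)) : ¬ B ⋖ J := by
  intro hBJ
  have hodd : ¬ (2 : ℤ) ∣ k - l := fun h2 => by
    have := hcop.isUnit_of_dvd' hq2 h2
    rw [Int.isUnit_iff] at this
    omega
  -- every element of `B T` lies in `B` or in an odd translate of `B`
  have hBT : ∀ b ∈ B, ∀ t ∈ T, b * t ∈ B ∨ ∃ j : ℤ, ¬ (2 : ℤ) ∣ j ∧ ∃ b' ∈ B, b * t = c ^ j * b' := by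
    intro b hb t ht
    have hb' := hb
    obtain ⟨j, s, hs, e | e⟩ := h.cover b (hBJ.le hb)
    · rw [e, Subgroup.mul_mem_cancel_right B (hSB hs), hq] at hb'
      have hst : s * t ∈ T := mul_mem (hST hs) ht
      have hst' := hst
      obtain ⟨n, s', hs', e' | e'⟩ := h.cover _ (hTJ hst)
      · left
        rw [e', Subgroup.mul_mem_cancel_right T (hST hs'), hr] at hst'
        rw [e, mul_assoc, e']
        exact mul_mem ((hq _).2 hb') (mul_mem ((hq _).2 (hqr.trans hst')) (hSB hs'))
      · right
        rw [e', Subgroup.mul_mem_cancel_right T (hST hs'), zpow_mul_mem_iff hr hk] at hst'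
        refine ⟨j + n - l, ?_, c ^ l * g * s', mul_mem hl (hSB hs'), ?_⟩
        · have h1 := hq2.trans hb'
          have h2 := hq2.trans (hqr.trans hst')
          omega
        · rw [e, mul_assoc, e']
          simp only [← mul_assoc, ← zpow_add, sub_add_cancel]
    · rw [e, Subgroup.mul_mem_cancel_right B (hSB hs), zpow_mul_mem_iff hq hl] at hb'
      have hst : c ^ k * g * (s * t) ∈ T := mul_mem hk (mul_mem (hST hs) ht)
      have hst' := hst
      obtain ⟨n, s', hs', e' | e'⟩ := h.cover _ (hTJ hst)
      · right
        rw [e', Subgroup.mul_mem_cancel_right T (hST hs'), hr] at hst'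
        refine ⟨j - k + n, ?_, s', hSB hs', ?_⟩
        · have h1 := hq2.trans hb'
          have h2 := hq2.trans (hqr.trans hst')
          omega
        · rw [zpow_add, mul_assoc, ← e', e]
          simp only [← mul_assoc, ← zpow_add, sub_add_cancel]
      · left
        rw [e', Subgroup.mul_mem_cancel_right T (hST hs'), zpow_mul_mem_iff hr hk] at hst'
        have : b * t = c ^ (j - k + n) * g * s' := by
          rw [zpow_add, mul_assoc, mul_assoc, ← mul_assoc (c ^ n), ← e', e]
          simp only [← mul_assoc, ← zpow_add, sub_add_cancel]
        rw [this]
        refine mul_mem ((zpow_mul_mem_iff hq hl _).2 ?_) (hSB hs')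
        have := dvd_add hb' (hqr.trans hst')
        rwa [show j - l + (n - k) = j - k + n - l by ring] at this
  -- R defines a symmetric, J-invariant relation on J/B, which c^i B ↦ i identifies with ℤ/q. All
  -- its edges join points of opposite parity.
  let R : Set G := {x | (∃ b ∈ B, ∃ t ∈ T, ∃ b' ∈ B, x = b * t * b') ∧ x ∉ B}
  have hRinv : ∀ x ∈ R, x⁻¹ ∈ R := by
    rintro _ ⟨⟨b, hb, t, ht, b', hb', rfl⟩, hx⟩
    exact ⟨⟨b'⁻¹, inv_mem hb', t⁻¹, inv_mem ht, b⁻¹, inv_mem hb, by group⟩, by rwa [inv_mem_iff]⟩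
  have hRJ : ∀ x ∈ R, x ∈ J := by
    rintro _ ⟨⟨b, hb, t, ht, b', hb', rfl⟩, -⟩
    exact mul_mem (mul_mem (hBJ.le hb) (hTJ ht)) (hBJ.le hb')
  have hstep : ∀ x ∈ R, ∀ b ∈ B, ∃ j : ℤ, ¬ (2 : ℤ) ∣ j ∧ ∃ b' ∈ B, b * x = c ^ j * b' := by
    rintro _ ⟨⟨b₁, hb₁, t, ht, b₂, hb₂, rfl⟩, hx⟩ b hb
    rcases hBT (b * b₁) (mul_mem hb hb₁) t ht with h1 | ⟨j, hj, b', hb', e⟩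
    · exfalso
      apply hx
      rw [Subgroup.mul_mem_cancel_left B (mul_mem hb hb₁)] at h1
      exact mul_mem (mul_mem hb₁ h1) hb₂
    · exact ⟨j, hj, b' * b₂, mul_mem hb' hb₂, by simp only [← mul_assoc, e]⟩
  -- Walks of even length in that graph preserve parity, so W ≠ J and W = B by maximality. As
  -- c^{k-l} ∈ R, this puts c^{2(k-l)} in B, so q ∣ 2.
  let W : Subgroup G := Subgroup.closure {x | x ∈ B ∨ ∃ y ∈ R, ∃ z ∈ R, x = y * z}
  have hBW : B ≤ W := fun b hb => Subgroup.subset_closure (Or.inl hb)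
  have hWJ : W ≤ J := by
    rw [Subgroup.closure_le]
    rintro x (hx | ⟨y, hy, z, hz, rfl⟩)
    · exact hBJ.le hx
    · exact mul_mem (hRJ y hy) (hRJ z hz)
  have hgen : ∀ x : G, (∃ j : ℤ, (2 : ℤ) ∣ j ∧ ∃ b ∈ B, x = c ^ j * b) →
      ∀ y ∈ {x | x ∈ B ∨ ∃ y ∈ R, ∃ z ∈ R, x = y * z},
      ∃ j : ℤ, (2 : ℤ) ∣ j ∧ ∃ b ∈ B, x * y = c ^ j * b := by
    rintro _ ⟨j, hj, b, hb, rfl⟩ y (hy | ⟨y, hy, z, hz, rfl⟩)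
    · exact ⟨j, hj, b * y, mul_mem hb hy, by rw [mul_assoc]⟩
    · obtain ⟨j₁, hj₁, b₁, hb₁, e₁⟩ := hstep y hy b hb
      obtain ⟨j₂, hj₂, b₂, hb₂, e₂⟩ := hstep z hz b₁ hb₁
      refine ⟨j + (j₁ + j₂), by omega, b₂, hb₂, ?_⟩
      rw [zpow_add, zpow_add, mul_assoc, mul_assoc, mul_assoc, ← e₂, ← mul_assoc b, e₁]
      simp only [mul_assoc]
  have hWeven : ∀ x ∈ W, ∃ j : ℤ, (2 : ℤ) ∣ j ∧ ∃ b ∈ B, x = c ^ j * b := by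
    intro x hx
    induction hx using Subgroup.closure_induction_right with
    | one => exact ⟨0, by simp, 1, one_mem _, by simp⟩
    | mul_right x _ y hy ih => exact hgen x ih y hy
    | mul_inv_cancel x _ y hy ih =>
      refine hgen x ih _ ?_
      rcases hy with hy | ⟨y, hy, z, hz, rfl⟩
      · exact Or.inl (inv_mem hy)
      · exact Or.inr ⟨z⁻¹, hRinv z hz, y⁻¹, hRinv y hy, by rw [mul_inv_rev]⟩
  have hWne : W ≠ J := by
    intro hW
    obtain ⟨j, hj, b, hb, e⟩ := hWeven c (hW ▸ h.c_mem)
    have : c ^ (1 - j) ∈ B := by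
      rw [sub_eq_neg_add, zpow_add, zpow_one, zpow_neg]
      nth_rw 2 [e]
      simpa using hb
    rw [hq] at this
    have := hq2.trans this
    omega
  have hWB : W = B := (hBJ.eq_or_eq hBW hWJ).resolve_right hWne
  have hcR : c ^ (k - l) ∈ R := by
    refine ⟨⟨1, one_mem _, c ^ k * g, hk, (c ^ l * g)⁻¹, inv_mem hl, ?_⟩, ?_⟩
    · rw [sub_eq_add_neg, zpow_add, zpow_neg]
      group
    · rw [hq]
      exact fun hd => hodd (hq2.trans hd)
  have hcW : c ^ ((k - l) * 2) ∈ B := by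
    rw [← hWB]
    refine Subgroup.subset_closure (Or.inr ⟨_, hcR, _, hcR, ?_⟩)
    rw [← zpow_add, mul_two]
  rw [hq] at hcW
  exact hq2' (hcop.dvd_of_dvd_mul_left hcW)

/-- A subgroup T strictly between S and A still satisfies T ∩ B = S, and T ⊔ B = J by maximality of
B. Thus TB = J, and Dedekind's law gives T = A. -/
theorem TwoOrbits.covBy_of_forall_covers (hS : A ⊓ B = S) (hAJ : A ⋖ J) (hBJ : B ⋖ J) (hAB : A ≠ B)
    (hT : ∀ T, S ≤ T → T ≤ A → T ⊓ B = S → T ⊔ B = J → Covers T B J) : S ⋖ A := by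
  have hSA : S ≤ A := hS ▸ inf_le_left
  refine ⟨lt_of_le_of_ne hSA fun hne => ?_, fun T hST hTA => ?_⟩
  · rw [← hS, inf_eq_left] at hne
    exact hAB ((hAJ.eq_or_eq hne hBJ.le).resolve_right hBJ.ne).symm
  · have hTB : T ⊓ B = S :=
      le_antisymm (hS ▸ inf_le_inf_right _ hTA.le) (le_inf hST.le (hS ▸ inf_le_right))
    have hTJ : T ⊔ B = J := by
      refine (hBJ.eq_or_eq le_sup_right (sup_le (hTA.le.trans hAJ.le) hBJ.le)).resolve_left ?_
      intro hB
      rw [sup_eq_right] at hB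
      rw [inf_eq_left.2 hB] at hTB
      exact hST.ne hTB.symm
    exact hTA.ne ((hT T hST.le hTA.le hTB hTJ).eq_of_le hAJ.le hTA.le (hS ▸ hST.le))

/-- If both periods coincide then `S` has index two in `A`. -/
theorem TwoOrbits.covBy_of_period_eq (h : TwoOrbits c g S J) (hS : A ⊓ B = S) (hAJ : A ⋖ J)
    (hBJ : B ⋖ J) (hAB : A ≠ B) {p k : ℤ} (hp : ∀ i : ℤ, c ^ i ∈ A ↔ p ∣ i)
    (hq : ∀ i : ℤ, c ^ i ∈ B ↔ p ∣ i) (hk : c ^ k * g ∈ A) : S ⋖ A := by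
  have hSA : S ≤ A := hS ▸ inf_le_left
  have hpS : ∀ i : ℤ, p ∣ i → c ^ i ∈ S := fun i hi => hS ▸ ⟨(hp i).2 hi, (hq i).2 hi⟩
  refine ⟨lt_of_le_of_ne hSA fun hne => ?_, fun T hST hTA => ?_⟩
  · rw [← hS, inf_eq_left] at hne
    exact hAB ((hAJ.eq_or_eq hne hBJ.le).resolve_right hBJ.ne).symm
  · obtain ⟨x, hxT, hxS⟩ := SetLike.exists_of_lt hST
    have hxA := hTA.le hxT
    obtain ⟨i, s, hs, e | e⟩ := h.cover x (hAJ.le hxA)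
    · rw [e, Subgroup.mul_mem_cancel_right A (hSA hs), hp] at hxA
      exact hxS (e ▸ mul_mem (hpS i hxA) hs)
    · rw [e, Subgroup.mul_mem_cancel_right A (hSA hs), zpow_mul_mem_iff hp hk] at hxA
      rw [e, Subgroup.mul_mem_cancel_right T (hST.le hs)] at hxT
      -- The elements of A outside ⟨c⟩S have the form c^j g s' with j ≡ k modulo p. They differ from
      -- the element c^i g of T by factors c^{j-i} and s' from S, so T contains them all.
      refine hTA.not_ge fun a ha => ?_
      have ha' := ha
      obtain ⟨j, s', hs', e' | e'⟩ := h.cover a (hAJ.le ha)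
      · rw [e', Subgroup.mul_mem_cancel_right A (hSA hs'), hp] at ha'
        exact hST.le (e' ▸ mul_mem (hpS j ha') hs')
      · rw [e', Subgroup.mul_mem_cancel_right A (hSA hs'), zpow_mul_mem_iff hp hk] at ha'
        have : a = c ^ (j - i) * (c ^ i * g) * s' := by
          rw [e']
          simp only [← mul_assoc, ← zpow_add, sub_add_cancel]
        rw [this]
        refine mul_mem (mul_mem (hST.le (hpS _ ?_)) hxT) (hST.le hs')
        have := dvd_sub ha' hxA
        rwa [show j - k - (i - k) = j - i by ring] at this

/-- An intermediate T may have a period r whose gcd with q is not 2. Then maximality of B forces q ∣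
r, with q even and larger than 2, which the parity argument of `not_covBy_of_even` excludes. -/
theorem TwoOrbits.covBy_of_gcd_eq_two [Finite G] (h : TwoOrbits c g S J) (hS : A ⊓ B = S)
    (hAJ : A ⋖ J) (hBJ : B ⋖ J) (hAB : A ≠ B) (hSg : ∀ i : ℤ, c ^ i * g ∉ S) {p q l : ℤ}
    (hq0 : 0 < q) (hq : ∀ i : ℤ, c ^ i ∈ B ↔ q ∣ i)
    (hl : c ^ l * g ∈ B) (hd : Int.gcd p q = 2) : S ⋖ A := by
  refine covBy_of_forall_covers hS hAJ hBJ hAB fun T hST hTA hTB hTJ => ?_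
  by_cases hTg : ∃ i : ℤ, c ^ i * g ∈ T
  · obtain ⟨k, hk⟩ := hTg
    obtain ⟨r, hr0, hr, -⟩ := exists_period T c
    obtain ⟨hkl, hcop⟩ := h.gcd_arith hTB hTJ hSg hr hq hk hl
    have hSB : S ≤ B := hS ▸ inf_le_right
    by_cases hd' : Int.gcd r q = 2
    · exact h.covers_of_gcd_eq_two hSB hr hq hk hl hd' hkl
    · exfalso
      have hqr : q ∣ r := by
        refine h.dvd_of_covBy (A := B) (B := T) hSB hST hBJ hq hr hl hk ?_ ?_ ?_
        · rwa [Int.gcd_comm]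
        · rwa [Int.gcd_comm, ← neg_sub k l, dvd_neg]
        · rw [Int.gcd_comm, ← neg_sub k l]
          exact hcop.neg_right
      have hgq : (Int.gcd r q : ℤ) = q := Int.gcd_eq_right hq0.le hqr
      have hq2 : (2 : ℤ) ∣ q := by
        have := Int.gcd_dvd_right p q
        rwa [hd] at this
      refine h.not_covBy_of_even hST hSB (hTA.trans hAJ.le) hr hq hk hl hqr hq2 ?_ ?_ hBJ
      · intro hq2'
        apply hd'
        have := Int.dvd_antisymm hq0.le (by norm_num) hq2' hq2
        rw [this] at hgq ⊢
        exact_mod_cast hgq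
      · rwa [← hgq]
  · push Not at hTg
    exact (h.covers_of_mixed (A := B) (B := T) (by rwa [inf_comm]) (by rwa [sup_comm]) hl hTg).symm

/-- Two maximal subgroups in the interval above `S`: the intersection is maximal in both of them,
and the two chains have the same indices up to order. -/
theorem TwoOrbits.exchange [Finite G] (h : TwoOrbits c g S J) (hS : A ⊓ B = S)
    (hAJ : A ⋖ J) (hBJ : B ⋖ J) (hAB : A ≠ B) :
    S ⋖ A ∧ S ⋖ B ∧ ((A.relIndex J = S.relIndex B ∧ B.relIndex J = S.relIndex A) ∨
      (A.relIndex J = B.relIndex J)) := by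
  have hS' : B ⊓ A = S := by rwa [inf_comm]
  have hSA : S ≤ A := hS ▸ inf_le_left
  have hSB : S ≤ B := hS ▸ inf_le_right
  have hJ : A ⊔ B = J := by
    refine (hAJ.eq_or_eq le_sup_left (sup_le hAJ.le hBJ.le)).resolve_left fun hA => ?_
    exact hAB ((hBJ.eq_or_eq (sup_eq_left.1 hA) hAJ.le).resolve_right hAJ.ne)
  have hJ' : B ⊔ A = J := by rwa [sup_comm]
  have hcov : Covers A B J → A.relIndex J = S.relIndex B ∧ B.relIndex J = S.relIndex A :=
    fun hc => ⟨hS ▸ hc.relIndex_eq hBJ.le, hS' ▸ hc.symm.relIndex_eq hAJ.le⟩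
  by_cases hSg : ∃ i : ℤ, c ^ i * g ∈ S
  · obtain ⟨k, hk⟩ := hSg
    refine ⟨covBy_of_forall_covers hS hAJ hBJ hAB fun T hST _ _ hTJ =>
        h.covers_of_transitive hST hSB hTJ hk,
      covBy_of_forall_covers hS' hBJ hAJ hAB.symm fun T hST _ _ hTJ =>
        h.covers_of_transitive hST hSA hTJ hk,
      Or.inl (hcov (h.covers_of_transitive hSA hSB hJ hk))⟩
  push Not at hSg
  by_cases hAg : ∃ i : ℤ, c ^ i * g ∈ A <;> by_cases hBg : ∃ i : ℤ, c ^ i * g ∈ B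
  · obtain ⟨k, hk⟩ := hAg
    obtain ⟨l, hl⟩ := hBg
    obtain ⟨p, hp0, hp, hpi⟩ := exists_period A c
    obtain ⟨q, hq0, hq, hqi⟩ := exists_period B c
    obtain ⟨hkl, hcop⟩ := h.gcd_arith hS hJ hSg hp hq hk hl
    by_cases hd : Int.gcd p q = 2
    · exact ⟨h.covBy_of_gcd_eq_two hS hAJ hBJ hAB hSg hq0 hq hl hd,
        h.covBy_of_gcd_eq_two hS' hBJ hAJ hAB.symm hSg hp0 hp hk (by rwa [Int.gcd_comm]),
        Or.inl (hcov (h.covers_of_gcd_eq_two hSB hp hq hk hl hd hkl))⟩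
    · have hpq : p ∣ q := h.dvd_of_covBy hSA hSB hAJ hp hq hk hl hd hkl hcop
      have hqp : q ∣ p := by
        refine h.dvd_of_covBy (A := B) (B := A) hSB hSA hBJ hq hp hl hk ?_ ?_ ?_
        · rwa [Int.gcd_comm]
        · rwa [Int.gcd_comm, ← neg_sub k l, dvd_neg]
        · rw [Int.gcd_comm, ← neg_sub k l]
          exact hcop.neg_right
      obtain rfl := Int.dvd_antisymm hp0.le hq0.le hpq hqp
      refine ⟨h.covBy_of_period_eq hS hAJ hBJ hAB hp hq hk,
        h.covBy_of_period_eq hS' hBJ hAJ hAB.symm hq hp hl, Or.inr ?_⟩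
      -- Because M meets ⟨c⟩g, the group ⟨c⟩ is transitive on J/M, and the index of M is its period.
      -- Equal periods therefore mean equal indices.
      have key : ∀ M : Subgroup G, S ≤ M → ∀ k : ℤ, c ^ k * g ∈ M →
          M.relIndex J = M.relIndex (Subgroup.zpowers c) := by
        intro M hSM k hk
        refine Subgroup.relIndex_eq_of_forall_exists (by rw [Subgroup.zpowers_le]; exact h.c_mem)
          fun x hx => ?_
        obtain ⟨i, s, hs, e | e⟩ := h.cover x hx
        · exact ⟨c ^ i, Subgroup.zpow_mem_zpowers _ _, by simpa [e] using hSM hs⟩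
        · refine ⟨c ^ (i - k), Subgroup.zpow_mem_zpowers _ _, ?_⟩
          have : (c ^ (i - k))⁻¹ * x = c ^ k * g * s := by
            rw [e, ← zpow_neg]
            simp only [← mul_assoc, ← zpow_add]
            congr 3
            ring
          rw [this]
          exact mul_mem hk (hSM hs)
      rw [key A hSA k hk, key B hSB l hl]
      exact_mod_cast hpi.trans hqi.symm
  · obtain ⟨k, hk⟩ := hAg
    push Not at hBg
    refine ⟨covBy_of_forall_covers hS hAJ hBJ hAB fun T hST _ hTB hTJ => ?_,
      covBy_of_forall_covers hS' hBJ hAJ hAB.symm fun T hST hTB hTA hTJ => ?_,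
      Or.inl (hcov (h.covers_of_mixed hS hJ hk hBg))⟩
    · by_cases hTg : ∃ i : ℤ, c ^ i * g ∈ T
      · obtain ⟨k', hk'⟩ := hTg
        exact h.covers_of_mixed hTB hTJ hk' hBg
      · push Not at hTg
        exact absurd hTJ (h.sup_ne hST hSB hTg hBg)
    · exact (h.covers_of_mixed (A := A) (B := T) (by rwa [inf_comm]) (by rwa [sup_comm]) hk
        fun i hi => hBg i (hTB hi)).symm
  · obtain ⟨l, hl⟩ := hBg
    push Not at hAg
    refine ⟨covBy_of_forall_covers hS hAJ hBJ hAB fun T hST hTA hTB hTJ => ?_,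
      covBy_of_forall_covers hS' hBJ hAJ hAB.symm fun T hST _ hTA hTJ => ?_,
      Or.inl (hcov (h.covers_of_mixed hS' hJ' hl hAg).symm)⟩
    · exact (h.covers_of_mixed (A := B) (B := T) (by rwa [inf_comm]) (by rwa [sup_comm]) hl
        fun i hi => hAg i (hTA hi)).symm
    · by_cases hTg : ∃ i : ℤ, c ^ i * g ∈ T
      · obtain ⟨k', hk'⟩ := hTg
        exact h.covers_of_mixed hTA hTJ hk' hAg
      · push Not at hTg
        exact absurd hTJ (h.sup_ne hST hSA hTg hAg)
  · push Not at hAg hBg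
    exact absurd hJ (h.sup_ne hSA hSB hAg hBg)

/-- Passage to a subgroup containing `S`. -/
theorem TwoOrbits.restrict [Finite G] (h : TwoOrbits c g S ⊤) (hSJ : S ≤ J) :
    ∃ c' g' : G, TwoOrbits c' g' S J := by
  obtain ⟨e, -, he, -⟩ := exists_period J c
  have hpow : ∀ i : ℤ, c ^ i ∈ J → ∃ j : ℤ, c ^ i = (c ^ e) ^ j := by
    intro i hi
    obtain ⟨j, rfl⟩ := (he i).1 hi
    exact ⟨j, zpow_mul ..⟩
  by_cases hg : ∃ i : ℤ, c ^ i * g ∈ J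
  · obtain ⟨k, hk⟩ := hg
    refine ⟨c ^ e, c ^ k * g, (he e).2 dvd_rfl, hk, hSJ, fun x hx => ?_⟩
    obtain ⟨i, s, hs, rfl | rfl⟩ := h.cover x trivial
    · rw [Subgroup.mul_mem_cancel_right J (hSJ hs)] at hx
      obtain ⟨j, hj⟩ := hpow i hx
      exact ⟨j, s, hs, Or.inl (by rw [hj])⟩
    · rw [Subgroup.mul_mem_cancel_right J (hSJ hs)] at hx
      have hik : c ^ (i - k) ∈ J := by
        have := mul_mem hx (inv_mem hk)
        rwa [mul_inv_rev, ← mul_assoc, mul_inv_cancel_right, ← zpow_neg, ← zpow_add,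
          ← sub_eq_add_neg] at this
      obtain ⟨j, hj⟩ := hpow _ hik
      refine ⟨j, s, hs, Or.inr ?_⟩
      rw [← hj]
      simp only [← mul_assoc, ← zpow_add, sub_add_cancel]
  · push Not at hg
    -- J misses the second orbit altogether, so ⟨c^e⟩ is transitive on J/S and 1 can stand in for
    -- the second representative.
    refine ⟨c ^ e, 1, (he e).2 dvd_rfl, one_mem _, hSJ, fun x hx => ?_⟩
    obtain ⟨i, s, hs, rfl | rfl⟩ := h.cover x trivial
    · rw [Subgroup.mul_mem_cancel_right J (hSJ hs)] at hx
      obtain ⟨j, hj⟩ := hpow i hx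
      exact ⟨j, s, hs, Or.inl (by rw [hj])⟩
    · rw [Subgroup.mul_mem_cancel_right J (hSJ hs)] at hx
      exact absurd hx (hg i)

end GroupTheory

/-! ### Composition of rational functions and subfields of ℂ(X) -/

section Composition

open IntermediateField RatFunc

theorem degree_eq_zero_iff {h : RatFunc ℂ} : degree h = 0 ↔ ∃ c, h = C c := by
  rw [RatFunc.eq_C_iff, degree, Nat.max_eq_zero_iff]

theorem transcendental_of_degree {h : RatFunc ℂ} (hh : 0 < degree h) : Transcendental ℂ h :=
  h.transcendental_of_ne_C fun hc => hh.ne' (degree_eq_zero_iff.2 hc)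

theorem finrank_adjoin (h : RatFunc ℂ) : Module.finrank ℂ⟮h⟯ (RatFunc ℂ) = degree h :=
  h.finrank_eq_max_natDegree

theorem degree_X : degree (X : RatFunc ℂ) = 1 := by
  simp [degree]

theorem algHom_ext_X {A : Type*} [Semiring A] [Algebra ℂ A] {φ ψ : RatFunc ℂ →ₐ[ℂ] A}
    (h : φ X = ψ X) : φ = ψ := by
  refine IsLocalization.algHom_ext (nonZeroDivisors (Polynomial ℂ)) (Polynomial.algHom_ext ?_)
  change φ (algebraMap (Polynomial ℂ) _ Polynomial.X) = ψ (algebraMap (Polynomial ℂ) _ Polynomial.X)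
  rwa [RatFunc.algebraMap_X]

/-- Substitution of a nonconstant rational function, as a homomorphism of fields. -/
noncomputable def subst (h : RatFunc ℂ) (hh : 0 < degree h) : RatFunc ℂ →ₐ[ℂ] RatFunc ℂ :=
  ℂ⟮h⟯.val.comp (algEquivOfTranscendental h (transcendental_of_degree hh)).toAlgHom

theorem subst_apply {h : RatFunc ℂ} (hh : 0 < degree h) (f : RatFunc ℂ) :
    subst h hh f = comp f h := by
  exact algEquivOfTranscendental_apply h (transcendental_of_degree hh) f

theorem fieldRange_subst {h : RatFunc ℂ} (hh : 0 < degree h) :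
    (subst h hh).fieldRange = ℂ⟮h⟯ := by
  ext x
  constructor
  · rintro ⟨y, rfl⟩
    exact SetLike.coe_mem (algEquivOfTranscendental h (transcendental_of_degree hh) y)
  · intro hx
    refine ⟨(algEquivOfTranscendental h (transcendental_of_degree hh)).symm ⟨x, hx⟩, ?_⟩
    simp [subst]

theorem mem_adjoin_iff {h : RatFunc ℂ} (hh : 0 < degree h) {F : RatFunc ℂ} :
    F ∈ ℂ⟮h⟯ ↔ ∃ f, F = comp f h := by
  rw [← fieldRange_subst hh]
  simp only [AlgHom.mem_fieldRange, subst_apply, eq_comm]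

theorem comp_left_injective {h : RatFunc ℂ} (hh : 0 < degree h) {f g : RatFunc ℂ}
    (e : comp f h = comp g h) : f = g := by
  rw [← subst_apply hh, ← subst_apply hh] at e
  exact (subst h hh).injective e

@[simp] theorem comp_X (f : RatFunc ℂ) : comp f X = f := by
  have hX : 0 < degree (X : RatFunc ℂ) := by rw [degree_X]; exact one_pos
  have hid : subst X hX = AlgHom.id ℂ _ := by
    refine algHom_ext_X ?_
    simp [subst_apply, comp]
  rw [← subst_apply hX, hid]
  rfl

@[simp] theorem X_comp (f : RatFunc ℂ) : comp X f = f := by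
  simp [comp]

theorem degree_comp_of_degree_eq_zero_right {h : RatFunc ℂ} (hh : degree h = 0) (f : RatFunc ℂ) :
    degree (comp f h) = 0 := by
  obtain ⟨c, rfl⟩ := degree_eq_zero_iff.1 hh
  refine degree_eq_zero_iff.2 ⟨f.eval (RingHom.id ℂ) c, ?_⟩
  simp [comp, RatFunc.eval, Polynomial.eval₂_id]

theorem map_subst_adjoin {h : RatFunc ℂ} (hh : 0 < degree h) (f : RatFunc ℂ) :
    (ℂ⟮f⟯).map (subst h hh) = ℂ⟮comp f h⟯ := by
  rw [IntermediateField.adjoin_map, Set.image_singleton, subst_apply]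

theorem adjoin_comp_le {h : RatFunc ℂ} (hh : 0 < degree h) (f : RatFunc ℂ) :
    ℂ⟮comp f h⟯ ≤ ℂ⟮h⟯ :=
  adjoin_simple_le_iff.2 ((mem_adjoin_iff hh).2 ⟨f, rfl⟩)

/-- Substituting h embeds ℂ(X) onto ℂ(h) and carries ℂ(f) to ℂ(f ∘ h), so the degree is [ℂ(X) :
ℂ(f)]. Multiplicativity of degrees is then the tower law. -/
theorem relfinrank_comp {h : RatFunc ℂ} (hh : 0 < degree h) (f : RatFunc ℂ) :
    relfinrank ℂ⟮comp f h⟯ ℂ⟮h⟯ = degree f := by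
  rw [← map_subst_adjoin hh, ← fieldRange_subst hh, AlgHom.fieldRange_eq_map, relfinrank_map_map,
    relfinrank_top_right, finrank_adjoin]

theorem degree_comp (f h : RatFunc ℂ) : degree (comp f h) = degree f * degree h := by
  rcases Nat.eq_zero_or_pos (degree h) with h0 | hh
  · rw [degree_comp_of_degree_eq_zero_right h0, h0, mul_zero]
  · rw [← relfinrank_comp hh f, ← finrank_adjoin (comp f h), ← finrank_adjoin h,
      relfinrank_mul_finrank_top (adjoin_comp_le hh f)]

theorem comp_assoc (f : RatFunc ℂ) {g h : RatFunc ℂ} (hg : 0 < degree g) (hh : 0 < degree h) :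
    comp (comp f g) h = comp f (comp g h) := by
  have hgh : 0 < degree (comp g h) := by rw [degree_comp]; positivity
  have : (subst h hh).comp (subst g hg) = subst (comp g h) hgh := by
    refine algHom_ext_X ?_
    simp [subst_apply]
  rw [← subst_apply hgh, ← this, AlgHom.comp_apply, subst_apply, subst_apply]

theorem adjoin_eq_iff_of_comp {h : RatFunc ℂ} (hh : 0 < degree h) (f : RatFunc ℂ) :
    ℂ⟮comp f h⟯ = ℂ⟮h⟯ ↔ degree f = 1 := by
  rw [← relfinrank_comp hh, relfinrank_eq_one_iff]
  exact ⟨fun e => e.ge, fun e => le_antisymm (adjoin_comp_le hh f) e⟩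

theorem degree_eq_one_iff {h : RatFunc ℂ} : degree h = 1 ↔ ℂ⟮h⟯ = ⊤ := by
  have := adjoin_eq_iff_of_comp (h := X) (by rw [degree_X]; exact one_pos) h
  rw [← this, comp_X, RatFunc.adjoin_X]

/-- This is Lüroth's theorem; the generator is nonconstant because E contains the nonconstant F. -/
theorem exists_adjoin_eq {E : IntermediateField ℂ (RatFunc ℂ)} {F : RatFunc ℂ}
    (hF : 0 < degree F) (hE : ℂ⟮F⟯ ≤ E) : ∃ h, 0 < degree h ∧ E = ℂ⟮h⟯ := by
  refine ⟨RatFunc.Luroth.generator E, Nat.pos_of_ne_zero fun h0 => ?_,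
    RatFunc.Luroth.eq_adjoin_generator⟩
  refine RatFunc.Luroth.generator_ne_C (E := E) ?_ (degree_eq_zero_iff.1 h0)
  rintro rfl
  obtain ⟨c, hc⟩ := adjoin_simple_le_iff.1 hE
  exact hF.ne' (degree_eq_zero_iff.2 ⟨c, by rw [← hc]; rfl⟩)

/-- Indecomposability means that there is no field strictly between `ℂ(f ∘ h)` and `ℂ(h)`. -/
theorem indecomposable_iff_covBy {h : RatFunc ℂ} (hh : 0 < degree h) {f : RatFunc ℂ} :
    Indecomposable f ∧ 1 < degree f ↔ 0 < degree f ∧ ℂ⟮comp f h⟯ ⋖ ℂ⟮h⟯ := by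
  constructor
  · rintro ⟨hf, hf1⟩
    have hf0 : 0 < degree f := by omega
    refine ⟨hf0, lt_of_le_of_ne (adjoin_comp_le hh f) fun e => ?_, fun E h1 h2 => ?_⟩
    · rw [adjoin_eq_iff_of_comp hh] at e
      omega
    · have hfh : 0 < degree (comp f h) := by rw [degree_comp]; positivity
      obtain ⟨k, hk, rfl⟩ := exists_adjoin_eq hfh h1.le
      obtain ⟨b, rfl⟩ := (mem_adjoin_iff hh).1 (adjoin_simple_le_iff.1 h2.le)
      obtain ⟨a, ha⟩ := (mem_adjoin_iff hk).1 (adjoin_simple_le_iff.1 h1.le)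
      have hb : 0 < degree b := by
        rw [degree_comp] at hk
        exact Nat.pos_of_mul_pos_right hk
      rw [← comp_assoc a hb hh] at ha
      rcases hf a b (comp_left_injective hh ha) with h3 | h3
      · rw [ha, comp_assoc a hb hh] at h1
        exact h1.ne ((adjoin_eq_iff_of_comp hk a).2 h3)
      · exact h2.ne ((adjoin_eq_iff_of_comp hh b).2 h3)
  · rintro ⟨hf0, hcov⟩
    refine ⟨fun a b hab => ?_, ?_⟩
    · have hb : 0 < degree b := by
        rw [hab, degree_comp] at hf0
        exact Nat.pos_of_mul_pos_left hf0
      have hbh : 0 < degree (comp b h) := by rw [degree_comp]; positivity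
      rw [hab, comp_assoc a hb hh] at hcov
      rcases hcov.eq_or_eq (adjoin_comp_le hbh a) (adjoin_comp_le hh b) with e | e
      · exact Or.inl ((adjoin_eq_iff_of_comp hbh a).1 e.symm)
      · exact Or.inr ((adjoin_eq_iff_of_comp hh b).1 e)
    · have := mt (adjoin_eq_iff_of_comp hh f).2 hcov.ne
      omega

theorem indecomposable_iff_covBy_top {f : RatFunc ℂ} :
    Indecomposable f ∧ 1 < degree f ↔ 0 < degree f ∧ ℂ⟮f⟯ ⋖ ⊤ := by
  have := indecomposable_iff_covBy (h := X) (f := f) (by rw [degree_X]; exact one_pos)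
  rwa [comp_X, RatFunc.adjoin_X] at this

end Composition

/-! ### The Jordan–Hölder argument for decompositions -/

section Lists

open IntermediateField RatFunc

/-- All members are indecomposable of degree greater than one. -/
def AllIndecomposable (D : List (RatFunc ℂ)) : Prop :=
  ∀ f ∈ D, Indecomposable f ∧ 1 < degree f

theorem allIndecomposable_cons {f : RatFunc ℂ} {D : List (RatFunc ℂ)} :
    AllIndecomposable (f :: D) ↔ (Indecomposable f ∧ 1 < degree f) ∧ AllIndecomposable D :=
  List.forall_mem_cons

@[simp] theorem compList_nil : compList [] = X := rfl

@[simp] theorem compList_cons (f : RatFunc ℂ) (D : List (RatFunc ℂ)) :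
    compList (f :: D) = comp f (compList D) := rfl

theorem AllIndecomposable.degree_pos {D : List (RatFunc ℂ)} (hD : AllIndecomposable D) :
    0 < degree (compList D) := by
  induction D with
  | nil => rw [compList_nil, degree_X]; exact one_pos
  | cons f D ih =>
    rw [allIndecomposable_cons] at hD
    rw [compList_cons, degree_comp]
    have := ih hD.2
    have := hD.1.2
    positivity

theorem AllIndecomposable.eq_nil_iff {D : List (RatFunc ℂ)} (hD : AllIndecomposable D) :
    D = [] ↔ degree (compList D) = 1 := by
  cases D with
  | nil => simp [degree_X]
  | cons f D =>
    rw [allIndecomposable_cons] at hD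
    have := hD.1.2
    simp only [compList_cons, degree_comp, reduceCtorEq, false_iff]
    intro h1
    have := Nat.eq_one_of_mul_eq_one_right h1
    omega

theorem compList_append {A B : List (RatFunc ℂ)} (hA : AllIndecomposable A)
    (hB : AllIndecomposable B) : compList (A ++ B) = comp (compList A) (compList B) := by
  induction A with
  | nil => simp
  | cons f A ih =>
    rw [allIndecomposable_cons] at hA
    rw [List.cons_append, compList_cons, compList_cons, ih hA.2,
      comp_assoc f hA.2.degree_pos hB.degree_pos]

theorem exists_allIndecomposable_of_one_lt (n : ℕ) :
    ∀ t : RatFunc ℂ, degree t = n → 1 < degree t → ∃ T, AllIndecomposable T ∧ compList T = t := by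
  induction n using Nat.strong_induction_on with
  | _ n ih =>
    intro t htn ht
    by_cases hind : Indecomposable t
    · exact ⟨[t], by simp [AllIndecomposable, hind, ht], by simp⟩
    · simp only [Indecomposable, not_forall, not_or] at hind
      obtain ⟨a, b, rfl, ha, hb⟩ := hind
      rw [degree_comp] at htn ht
      have ha0 : 0 < degree a := Nat.pos_of_mul_pos_right (by omega : 0 < degree a * degree b)
      have hb0 : 0 < degree b := Nat.pos_of_mul_pos_left (by omega : 0 < degree a * degree b)
      obtain ⟨A, hA, rfl⟩ := ih (degree a) (by nlinarith [(by omega : 2 ≤ degree b)]) a rfl (by omega)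
      obtain ⟨B, hB, rfl⟩ := ih (degree b) (by nlinarith [(by omega : 2 ≤ degree (compList A))]) b rfl
        (by omega)
      refine ⟨A ++ B, ?_, compList_append hA hB⟩
      intro f hf
      rcases List.mem_append.1 hf with hf | hf
      · exact hA f hf
      · exact hB f hf

/-- Only the field ℂ(t) is kept: if t has degree one the list is empty and its composition is X, not
t. -/
theorem exists_allIndecomposable {t : RatFunc ℂ} (ht : 0 < degree t) :
    ∃ T, AllIndecomposable T ∧ ℂ⟮compList T⟯ = ℂ⟮t⟯ := by
  by_cases h1 : degree t = 1
  · exact ⟨[], by simp [AllIndecomposable], by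
      rw [compList_nil, RatFunc.adjoin_X, degree_eq_one_iff.1 h1]⟩
  · obtain ⟨T, hT, rfl⟩ := exists_allIndecomposable_of_one_lt _ t rfl (by omega)
    exact ⟨T, hT, rfl⟩

theorem Step.cons {f h : RatFunc ℂ} {D E : List (RatFunc ℂ)} (hf : Indecomposable f ∧ 1 < degree f)
    (hs : Step h D E) : Step (comp f h) (f :: D) (f :: E) := by
  obtain ⟨hD, hE, A, B, a, b, a', b', rfl, rfl, e⟩ := hs
  have key : ∀ D, IsMaximalDecomposition h D → IsMaximalDecomposition (comp f h) (f :: D) :=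
    fun D hD => ⟨⟨by simp, by rw [compList_cons, hD.1.2]⟩, allIndecomposable_cons.2 ⟨hf, hD.2⟩⟩
  exact ⟨key _ hD, key _ hE, f :: A, B, a, b, a', b', rfl, rfl, e⟩

theorem reflTransGen_step_cons {f h : RatFunc ℂ} {D E : List (RatFunc ℂ)}
    (hf : Indecomposable f ∧ 1 < degree f) (hs : Relation.ReflTransGen (Step h) D E) :
    Relation.ReflTransGen (Step (comp f h)) (f :: D) (f :: E) :=
  hs.lift (fun D => f :: D) fun _ _ => Step.cons hf

/-- The exchange property of the fields between `K` and `L`. -/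
def ExchangeProperty {k L : Type*} [Field k] [Field L] [Algebra k L]
    (K : IntermediateField k L) : Prop :=
  ∀ E E₁ E₂ : IntermediateField k L, K ≤ E → E ⋖ E₁ → E ⋖ E₂ → E₁ ≠ E₂ →
    E₁ ⋖ E₁ ⊔ E₂ ∧ E₂ ⋖ E₁ ⊔ E₂ ∧
      ((relfinrank E E₁ = relfinrank E₂ (E₁ ⊔ E₂) ∧ relfinrank E E₂ = relfinrank E₁ (E₁ ⊔ E₂)) ∨
      relfinrank E E₁ = relfinrank E E₂)

/-- The Jordan–Hölder argument. -/
theorem ExchangeProperty.reflTransGen_step {K : IntermediateField ℂ (RatFunc ℂ)}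
    (hK : ExchangeProperty K) (n : ℕ) : ∀ D E : List (RatFunc ℂ), AllIndecomposable D →
      AllIndecomposable E → compList D = compList E → degree (compList D) = n →
      K ≤ ℂ⟮compList D⟯ → Relation.ReflTransGen (Step (compList D)) D E ∧
        (D.map degree : Multiset ℕ) = (E.map degree : Multiset ℕ) := by
  induction n using Nat.strong_induction_on with
  | _ n ih =>
    intro D E hD hE hDE hn hKD
    cases D with
    | nil =>
      rw [compList_nil, eq_comm] at hDE
      rw [(AllIndecomposable.eq_nil_iff hE).2 (by rw [hDE, degree_X])]
      exact ⟨Relation.ReflTransGen.refl, rfl⟩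
    | cons f D' =>
    cases E with
    | nil =>
      have := (AllIndecomposable.eq_nil_iff hD).2 (by rw [hDE, compList_nil, degree_X])
      simp at this
    | cons e E' =>
    rw [allIndecomposable_cons] at hD hE
    obtain ⟨hf, hD'⟩ := hD
    obtain ⟨he, hE'⟩ := hE
    simp only [compList_cons] at hDE hn hKD ⊢
    have hd := hD'.degree_pos
    have hd' := hE'.degree_pos
    have hcovD := ((indecomposable_iff_covBy hd).1 hf).2
    have hcovE := ((indecomposable_iff_covBy hd').1 he).2
    rw [← hDE] at hcovE
    have hltD : degree (compList D') < n := by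
      rw [← hn, degree_comp]
      nlinarith [hf.2]
    have hltE : degree (compList E') < n := by
      rw [← hn, hDE, degree_comp]
      nlinarith [he.2]
    have hKD' := hKD.trans hcovD.le
    have hKE' := hKD.trans hcovE.le
    have hmax : ∀ a b T, (Indecomposable a ∧ 1 < degree a) → (Indecomposable b ∧ 1 < degree b) →
        AllIndecomposable T → comp a (comp b (compList T)) = comp f (compList D') →
        IsMaximalDecomposition (comp f (compList D')) (a :: b :: T) := by
      intro a b T ha hb hT hcomp
      exact ⟨⟨by simp, by rw [compList_cons, compList_cons, hcomp]⟩,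
        allIndecomposable_cons.2 ⟨ha, allIndecomposable_cons.2 ⟨hb, hT⟩⟩⟩
    by_cases heq : ℂ⟮compList D'⟯ = ℂ⟮compList E'⟯
    · -- the first factors differ by a unit
      have hdeg : degree (compList D') = degree (compList E') := by
        rw [← finrank_adjoin, heq, finrank_adjoin]
      obtain ⟨μ, hμ⟩ := (mem_adjoin_iff hd).1 (heq ▸ mem_adjoin_simple_self ℂ (compList E'))
      obtain ⟨ν, hν⟩ := (mem_adjoin_iff hd').1 (heq ▸ mem_adjoin_simple_self ℂ (compList D'))
      have hμ1 : degree μ = 1 := by rw [← adjoin_eq_iff_of_comp hd, ← hμ, heq]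
      have hν1 : degree ν = 1 := by rw [← adjoin_eq_iff_of_comp hd', ← hν, heq]
      have hμν : comp μ ν = X := by
        apply comp_left_injective hd'
        rw [comp_assoc μ (by omega) hd', ← hν, ← hμ, X_comp]
      have hfe : f = comp e μ := by
        apply comp_left_injective hd
        rw [comp_assoc e (by omega) hd, ← hμ, hDE]
      cases E' with
      | nil =>
        have hD0 : D' = [] := (AllIndecomposable.eq_nil_iff hD').2 (by rw [hdeg, compList_nil, degree_X])
        subst hD0
        simp only [compList_nil, comp_X] at hDE
        subst hDE
        exact ⟨Relation.ReflTransGen.refl, rfl⟩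
      | cons e₂ E'' =>
        rw [allIndecomposable_cons] at hE'
        obtain ⟨he₂, hE''⟩ := hE'
        have he₂0 : 0 < degree e₂ := by omega
        -- The unit ν = μ⁻¹ is absorbed into the second factor. The induction hypothesis rewrites D'
        -- as (ν ∘ e₂) :: E'', and one replacement turns the pair f, ν ∘ e₂ into e, e₂.
        have hν2 : Indecomposable (comp ν e₂) ∧ 1 < degree (comp ν e₂) := by
          rw [indecomposable_iff_covBy_top, (adjoin_eq_iff_of_comp he₂0 ν).2 hν1,
            degree_comp, hν1, one_mul]
          exact indecomposable_iff_covBy_top.1 he₂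
        have hall : AllIndecomposable (comp ν e₂ :: E'') := allIndecomposable_cons.2 ⟨hν2, hE''⟩
        have hcompE : compList D' = compList (comp ν e₂ :: E'') := by
          rw [compList_cons, comp_assoc ν he₂0 hE''.degree_pos, ← compList_cons, ← hν]
        obtain ⟨hsteps, hdegs⟩ := ih _ hltD D' _ hD' hall hcompE rfl hKD'
        refine ⟨(reflTransGen_step_cons hf hsteps).tail ⟨?_, ?_, [], E'', f, comp ν e₂, e, e₂, rfl, rfl,
          ?_⟩, ?_⟩
        · refine hmax _ _ _ hf hν2 hE'' ?_
          rw [hcompE, compList_cons]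
        · exact hmax _ _ _ he he₂ hE'' hDE.symm
        · rw [hfe, comp_assoc e (by omega) (by omega), ← comp_assoc μ (by omega) he₂0, hμν, X_comp]
        · have : degree f = degree e := by rw [hfe, degree_comp, hμ1, mul_one]
          simp only [List.map_cons, ← Multiset.cons_coe] at hdegs ⊢
          rw [hdegs, this, degree_comp, hν1, one_mul]
    · obtain ⟨hc₁, hc₂, hidx⟩ := hK _ _ _ hKD hcovD hcovE heq
      -- Decompose a generator of the join as T. The chain runs from f :: D' to f :: u :: T, by one
      -- replacement to e :: v :: T, and on to e :: E'; the outer parts come from the induction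
      -- hypothesis.
      obtain ⟨t₀, ht₀, hsup⟩ := exists_adjoin_eq hd hc₁.le
      obtain ⟨T, hT, hTt⟩ := exists_allIndecomposable ht₀
      rw [hsup, ← hTt] at hc₁ hc₂ hidx
      have ht := hT.degree_pos
      obtain ⟨u, hu⟩ := (mem_adjoin_iff ht).1 (adjoin_simple_le_iff.1 hc₁.le)
      obtain ⟨v, hv⟩ := (mem_adjoin_iff ht).1 (adjoin_simple_le_iff.1 hc₂.le)
      have hu0 : 0 < degree u := by
        rw [hu, degree_comp] at hd
        exact Nat.pos_of_mul_pos_right hd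
      have hv0 : 0 < degree v := by
        rw [hv, degree_comp] at hd'
        exact Nat.pos_of_mul_pos_right hd'
      have hu1 := (indecomposable_iff_covBy ht).2 ⟨hu0, hu ▸ hc₁⟩
      have hv1 := (indecomposable_iff_covBy ht).2 ⟨hv0, hv ▸ hc₂⟩
      have hallu : AllIndecomposable (u :: T) := allIndecomposable_cons.2 ⟨hu1, hT⟩
      have hallv : AllIndecomposable (v :: T) := allIndecomposable_cons.2 ⟨hv1, hT⟩
      obtain ⟨hs₁, hm₁⟩ := ih _ hltD D' (u :: T) hD' hallu hu rfl hKD'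
      obtain ⟨hs₂, hm₂⟩ := ih _ hltE (v :: T) E' hallv hE' hv.symm (by rw [compList_cons, ← hv])
        (by rw [compList_cons, ← hv]; exact hKE')
      rw [compList_cons, ← hv] at hs₂
      have hs₂' := reflTransGen_step_cons he hs₂
      rw [← hDE] at hs₂'
      refine ⟨((reflTransGen_step_cons hf hs₁).tail
        ⟨hmax _ _ _ hf hu1 hT (by rw [← hu]), hmax _ _ _ he hv1 hT (by rw [← hv, hDE]),
          [], T, f, u, e, v, rfl, rfl, ?_⟩).trans hs₂', ?_⟩
      · apply comp_left_injective ht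
        rw [comp_assoc f hu0 ht, comp_assoc e hv0 ht, ← hu, ← hv, hDE]
      · have r₁ : relfinrank ℂ⟮comp f (compList D')⟯ ℂ⟮compList D'⟯ = degree f := relfinrank_comp hd f
        have r₂ : relfinrank ℂ⟮comp f (compList D')⟯ ℂ⟮compList E'⟯ = degree e := by
          rw [hDE]
          exact relfinrank_comp hd' e
        have r₃ : relfinrank ℂ⟮compList D'⟯ ℂ⟮compList T⟯ = degree u := by
          rw [hu]
          exact relfinrank_comp ht u
        have r₄ : relfinrank ℂ⟮compList E'⟯ ℂ⟮compList T⟯ = degree v := by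
          rw [hv]
          exact relfinrank_comp ht v
        rw [r₁, r₂, r₃, r₄] at hidx
        -- Equality of total degrees settles the second alternative of the exchange: once f and e
        -- have equal degree, so do u and v.
        have htot : degree f * degree u = degree e * degree v := by
          have := congrArg degree hDE
          rw [hu, hv] at this
          simp only [degree_comp, ← mul_assoc] at this
          exact Nat.eq_of_mul_eq_mul_right ht this
        simp only [List.map_cons, ← Multiset.cons_coe] at hm₁ hm₂ ⊢
        rw [hm₁, ← hm₂]
        rcases hidx with ⟨h1, h2⟩ | h1
        · rw [h1, h2, Multiset.cons_swap]
        · rw [h1] at htot ⊢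
          rw [Nat.eq_of_mul_eq_mul_left (by omega) htot]

end Lists

/-! ### Galois correspondence for intermediate fields of a smaller extension -/

section Galois

open IntermediateField

variable (K L N : Type*) [Field K] [Field L] [Field N] [Algebra K L] [Algebra K N] [Algebra L N]
  [IsScalarTower K L N]

variable {K L} in
/-- The subgroup of the Galois group of `N / K` fixing the image of a field between `K` and `L`. -/
noncomputable def galSubgroup (S : IntermediateField K L) : Subgroup (N ≃ₐ[K] N) :=
  (S.map (IsScalarTower.toAlgHom K L N)).fixingSubgroup

variable {K L N}

theorem mem_galSubgroup {S : IntermediateField K L} {σ : N ≃ₐ[K] N} :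
    σ ∈ galSubgroup N S ↔ ∀ a ∈ S, σ (algebraMap L N a) = algebraMap L N a := by
  rw [galSubgroup, IntermediateField.mem_fixingSubgroup_iff]
  constructor
  · intro h a ha
    exact h _ ⟨a, ha, rfl⟩
  · rintro h _ ⟨a, ha, rfl⟩
    exact h a ha

theorem galSubgroup_sup (S T : IntermediateField K L) :
    galSubgroup N (S ⊔ T) = galSubgroup N S ⊓ galSubgroup N T := by
  rw [galSubgroup, IntermediateField.map_sup, fixingSubgroup_sup]
  rfl

variable [FiniteDimensional K N] [IsGalois K N]

theorem galSubgroup_le_iff {S T : IntermediateField K L} :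
    galSubgroup N S ≤ galSubgroup N T ↔ T ≤ S := by
  rw [galSubgroup, galSubgroup, ← IntermediateField.le_iff_le, IsGalois.fixedField_fixingSubgroup]
  constructor
  · intro h a ha
    obtain ⟨b, hb, e⟩ := h ⟨a, ha, rfl⟩
    rwa [(IsScalarTower.toAlgHom K L N).injective e] at hb
  · exact fun h => IntermediateField.map_mono _ h

theorem galSubgroup_lt_iff {S T : IntermediateField K L} :
    galSubgroup N S < galSubgroup N T ↔ T < S := by
  rw [lt_iff_le_not_ge, lt_iff_le_not_ge, galSubgroup_le_iff, galSubgroup_le_iff]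

theorem galSubgroup_injective : Function.Injective (galSubgroup (K := K) (L := L) N) :=
  fun _ _ h => le_antisymm (galSubgroup_le_iff.1 h.ge) (galSubgroup_le_iff.1 h.le)

/-- A group containing Gal(N/L) has its fixed field inside the image of L, so that fixed field pulls
back to L. -/
theorem exists_galSubgroup_eq {A : Subgroup (N ≃ₐ[K] N)} (hA : galSubgroup N (⊤ : IntermediateField K L) ≤ A) :
    ∃ S : IntermediateField K L, galSubgroup N S = A := by
  refine ⟨(fixedField A).comap (IsScalarTower.toAlgHom K L N), ?_⟩
  have hle : fixedField A ≤ (IsScalarTower.toAlgHom K L N).fieldRange := by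
    have := fixedField_antitone hA
    rwa [galSubgroup, IsGalois.fixedField_fixingSubgroup, ← AlgHom.fieldRange_eq_map] at this
  rw [galSubgroup, IntermediateField.map_comap_eq, inf_eq_left.2 hle, fixingSubgroup_fixedField]

theorem galSubgroup_covBy_iff {S T : IntermediateField K L} :
    galSubgroup N S ⋖ galSubgroup N T ↔ T ⋖ S := by
  constructor
  · intro h
    refine ⟨galSubgroup_lt_iff.1 h.1, fun U h1 h2 => ?_⟩
    exact h.2 (galSubgroup_lt_iff.2 h2) (galSubgroup_lt_iff.2 h1)
  · intro h
    refine ⟨galSubgroup_lt_iff.2 h.1, fun A h1 h2 => ?_⟩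
    obtain ⟨U, rfl⟩ := exists_galSubgroup_eq ((galSubgroup_le_iff.2 le_top).trans h1.le)
    exact h.2 (galSubgroup_lt_iff.1 h2) (galSubgroup_lt_iff.1 h1)

/-- The order of each group is the degree of N over its fixed field. Compare the tower law for these
degrees with multiplicativity of the index above the trivial subgroup. -/
theorem relIndex_galSubgroup {S T : IntermediateField K L} (h : S ≤ T) :
    (galSubgroup N T).relIndex (galSubgroup N S) = relfinrank S T := by
  rw [← relfinrank_map_map S T (IsScalarTower.toAlgHom K L N)]
  have h1 := Subgroup.relIndex_mul_relIndex ⊥ (galSubgroup N T) (galSubgroup N S) bot_le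
    (galSubgroup_le_iff.2 h)
  rw [Subgroup.relIndex_bot_left, Subgroup.relIndex_bot_left, mul_comm] at h1
  have h2 := relfinrank_mul_finrank_top
    (IntermediateField.map_mono (IsScalarTower.toAlgHom K L N) h)
  rw [← IsGalois.card_fixingSubgroup_eq_finrank, ← IsGalois.card_fixingSubgroup_eq_finrank,
    ← galSubgroup, ← galSubgroup] at h2
  exact Nat.eq_of_mul_eq_mul_right Nat.card_pos (h1.trans h2.symm)

/-- The group theorem is applied with J the group of E and S the group of E₁ ⊔ E₂. The two-orbit
condition passes down to J and up to S. -/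
theorem exchange_of_twoOrbits {c g : N ≃ₐ[K] N}
    (h : TwoOrbits c g (galSubgroup N (⊤ : IntermediateField K L)) ⊤)
    {E E₁ E₂ : IntermediateField K L} (h₁ : E ⋖ E₁) (h₂ : E ⋖ E₂) (hne : E₁ ≠ E₂) :
    E₁ ⋖ E₁ ⊔ E₂ ∧ E₂ ⋖ E₁ ⊔ E₂ ∧
      ((relfinrank E E₁ = relfinrank E₂ (E₁ ⊔ E₂) ∧ relfinrank E E₂ = relfinrank E₁ (E₁ ⊔ E₂)) ∨
      relfinrank E E₁ = relfinrank E E₂) := by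
  obtain ⟨c', g', h'⟩ := h.restrict (J := galSubgroup N E) (galSubgroup_le_iff.2 le_top)
  have h'' := h'.mono (T := galSubgroup N (E₁ ⊔ E₂)) (galSubgroup_le_iff.2 le_top)
    (galSubgroup_le_iff.2 (h₁.le.trans le_sup_left))
  have := h''.exchange (galSubgroup_sup E₁ E₂).symm (galSubgroup_covBy_iff.2 h₁)
    (galSubgroup_covBy_iff.2 h₂) (galSubgroup_injective.ne hne)
  rwa [galSubgroup_covBy_iff, galSubgroup_covBy_iff, relIndex_galSubgroup h₁.le,
    relIndex_galSubgroup h₂.le, relIndex_galSubgroup le_sup_left,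
    relIndex_galSubgroup le_sup_right] at this

end Galois

/-! ### From a Galois closure to the exchange property -/

section Exchange

open IntermediateField

universe u

theorem exists_isGalois {k : Type*} {L : Type u} [Field k] [CharZero k] [Field L] [Algebra k L]
    (K : IntermediateField k L) [FiniteDimensional K L] :
    ∃ (N : Type u) (_ : Field N) (_ : Algebra L N), FiniteDimensional K N ∧ IsGalois K N := by
  let M := AlgebraicClosure L
  have : Algebra.IsAlgebraic K M := Algebra.IsAlgebraic.trans K L M
  have : IsAlgClosure K M := ⟨inferInstance, inferInstance⟩
  have : Normal K M := IsAlgClosure.normal K M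
  let N := IntermediateField.normalClosure K L M
  have h1 : FiniteDimensional K N := inferInstance
  have h2 : IsGalois K N := IsGalois.mk
  exact ⟨N, inferInstance, inferInstance, h1, h2⟩

theorem extendScalars_covBy {k L : Type*} [Field k] [Field L] [Algebra k L]
    {K E₁ E₂ : IntermediateField k L} (h₁ : K ≤ E₁) (h₂ : K ≤ E₂) :
    extendScalars h₁ ⋖ extendScalars h₂ ↔ E₁ ⋖ E₂ := by
  constructor
  · intro h
    refine ⟨h.1, fun U hU₁ hU₂ => ?_⟩
    exact h.2 (c := extendScalars (h₁.trans hU₁.le)) hU₁ hU₂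
  · intro h
    refine ⟨h.1, fun U hU₁ hU₂ => ?_⟩
    exact h.2 (c := U.restrictScalars k) hU₁ hU₂

theorem exchangeProperty_of_twoOrbits {k L : Type*} [Field k] [Field L] [Algebra k L]
    {K : IntermediateField k L} {N : Type*} [Field N]
    [Algebra L N] [FiniteDimensional K N]
    [IsGalois K N] {c g : N ≃ₐ[K] N}
    (h : TwoOrbits c g (galSubgroup N (⊤ : IntermediateField K L)) ⊤) :
    ExchangeProperty K := by
  intro E E₁ E₂ hE h₁ h₂ hne
  have hE₁ := hE.trans h₁.le
  have hE₂ := hE.trans h₂.le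
  have hsup : extendScalars hE₁ ⊔ extendScalars hE₂ = extendScalars (hE₁.trans (le_sup_left (b := E₂))) :=
    (extendScalars_sup ..)
  have := exchange_of_twoOrbits h ((extendScalars_covBy hE hE₁).2 h₁)
    ((extendScalars_covBy hE hE₂).2 h₂) (fun e => hne (congrArg (fun U => U.restrictScalars k) e))
  rw [hsup, extendScalars_covBy, extendScalars_covBy] at this
  exact this

end Exchange

/-! ### Rational functions as open continuous maps of the sphere -/

section Sphere

open Filter Topology Set

/-- The point of the Riemann sphere with homogeneous coordinates `[a : b]`. -/
noncomputable def sphereQuot (a b : ℂ) : OnePoint ℂ :=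
  if b = 0 then OnePoint.infty else OnePoint.some (a / b)

theorem sphereQuot_eq_infty {a b : ℂ} : sphereQuot a b = OnePoint.infty ↔ b = 0 := by
  unfold sphereQuot
  split_ifs with h
  · simp [h]
  · simp [h]

theorem sphereQuot_eq_coe {a b w : ℂ} (h : ¬ (a = 0 ∧ b = 0)) :
    sphereQuot a b = OnePoint.some w ↔ a - w * b = 0 := by
  unfold sphereQuot
  split_ifs with hb
  · simp only [OnePoint.infty_ne_coe, hb, mul_zero, sub_zero, false_iff]
    exact fun ha => h ⟨ha, hb⟩
  · rw [OnePoint.coe_eq_coe, div_eq_iff hb, sub_eq_zero]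

/-- The inversion of the Riemann sphere. -/
noncomputable def sphereInv : OnePoint ℂ → OnePoint ℂ
  | OnePoint.some z => sphereQuot 1 z
  | OnePoint.infty => OnePoint.some 0

theorem sphereInv_coe (z : ℂ) : sphereInv (OnePoint.some z) = sphereQuot 1 z := rfl

theorem sphereInv_infty : sphereInv OnePoint.infty = OnePoint.some 0 := rfl

theorem sphereInv_zero : sphereInv (OnePoint.some 0) = OnePoint.infty := by
  simp [sphereInv_coe, sphereQuot]

theorem sphereInv_coe_of_ne {z : ℂ} (hz : z ≠ 0) :
    sphereInv (OnePoint.some z) = OnePoint.some z⁻¹ := by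
  simp [sphereInv_coe, sphereQuot, hz]

theorem sphereInv_sphereInv (x : OnePoint ℂ) : sphereInv (sphereInv x) = x := by
  induction x using OnePoint.rec with
  | infty => rw [sphereInv_infty, sphereInv_zero]
  | coe z =>
    by_cases hz : z = 0
    · rw [hz]
      rw [sphereInv_zero, sphereInv_infty]
    · rw [sphereInv_coe_of_ne hz, sphereInv_coe_of_ne (inv_ne_zero hz), inv_inv]

theorem sphereInv_sphereQuot {a b : ℂ} (h : ¬ (a = 0 ∧ b = 0)) :
    sphereInv (sphereQuot a b) = sphereQuot b a := by
  by_cases hb : b = 0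
  · have ha : a ≠ 0 := fun ha => h ⟨ha, hb⟩
    rw [sphereQuot_eq_infty.2 hb, sphereInv_infty, hb]
    simp [sphereQuot, ha]
  · by_cases ha : a = 0
    · rw [sphereQuot_eq_infty.2 ha, ha]
      simp [sphereQuot, hb, sphereInv_zero]
    · simp only [sphereQuot, hb, ha, if_false]
      rw [sphereInv_coe_of_ne (div_ne_zero ha hb), inv_div]

theorem continuous_sphereInv : Continuous sphereInv := by
  rw [continuous_iff_continuousAt]
  intro x
  induction x using OnePoint.rec with
  | infty =>
    rw [OnePoint.continuousAt_infty', sphereInv_infty, coclosedCompact_eq_cocompact,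
      ← Metric.cobounded_eq_cocompact]
    have h : ∀ᶠ z : ℂ in Bornology.cobounded ℂ, z ≠ 0 := Bornology.eventually_ne_cobounded 0
    have h1 : Tendsto (fun z : ℂ => ((z⁻¹ : ℂ) : OnePoint ℂ)) (Bornology.cobounded ℂ)
        (𝓝 ((0 : ℂ) : OnePoint ℂ)) :=
      (OnePoint.continuous_coe.tendsto 0).comp tendsto_inv₀_cobounded
    refine h1.congr' ?_
    filter_upwards [h] with z hz
    exact (sphereInv_coe_of_ne hz).symm
  | coe z =>
    rw [OnePoint.continuousAt_coe]
    by_cases hz : z = 0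
    · subst hz
      have h1 : Tendsto (fun z : ℂ => ((z⁻¹ : ℂ) : OnePoint ℂ)) (𝓝[≠] 0)
          (𝓝 OnePoint.infty) := by
        have := OnePoint.tendsto_coe_infty (X := ℂ)
        rw [coclosedCompact_eq_cocompact, ← Metric.cobounded_eq_cocompact] at this
        exact this.comp tendsto_inv₀_nhdsNE_zero
      rw [continuousAt_iff_punctured_nhds]
      change Tendsto _ _ (𝓝 (sphereInv (OnePoint.some 0)))
      rw [sphereInv_zero]
      refine h1.congr' ?_
      filter_upwards [self_mem_nhdsWithin] with z hz
      exact (sphereInv_coe_of_ne hz).symm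
    · have h1 : ContinuousAt (fun z : ℂ => ((z⁻¹ : ℂ) : OnePoint ℂ)) z :=
        OnePoint.continuous_coe.continuousAt.comp (continuousAt_inv₀ hz)
      refine h1.congr ?_
      filter_upwards [eventually_ne_nhds hz] with w hw
      exact (sphereInv_coe_of_ne hw).symm

/-- The inversion as a homeomorphism. -/
noncomputable def sphereInvHomeo : OnePoint ℂ ≃ₜ OnePoint ℂ where
  toFun := sphereInv
  invFun := sphereInv
  left_inv := sphereInv_sphereInv
  right_inv := sphereInv_sphereInv
  continuous_toFun := continuous_sphereInv
  continuous_invFun := continuous_sphereInv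

theorem map_sphereInv_nhds (x : OnePoint ℂ) : map sphereInv (𝓝 x) = 𝓝 (sphereInv x) :=
  sphereInvHomeo.map_nhds_eq x

section Polynomials

open Polynomial

variable {p q : ℂ[X]}

/-- The open mapping theorem for the analytic quotient p/q. If it were locally constant, a
nontrivial combination of p and q would have infinitely many roots, against linear independence. -/
theorem map_sphereQuot_nhds_of_ne (hind : ∀ a b : ℂ, C a * p + C b * q = 0 → a = 0 ∧ b = 0)
    {z : ℂ} (hq : q.eval z ≠ 0) :
    map (fun z => sphereQuot (p.eval z) (q.eval z)) (𝓝 z) =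
      𝓝 (sphereQuot (p.eval z) (q.eval z)) := by
  have hev : ∀ᶠ w in 𝓝 z, q.eval w ≠ 0 := q.continuous.continuousAt.eventually_ne hq
  have hval : ∀ w, q.eval w ≠ 0 →
      sphereQuot (p.eval w) (q.eval w) = OnePoint.some (p.eval w / q.eval w) := by
    intro w hw
    simp [sphereQuot, hw]
  have hcongr : (fun z => sphereQuot (p.eval z) (q.eval z)) =ᶠ[𝓝 z]
      (fun w => ((p.eval w / q.eval w : ℂ) : OnePoint ℂ)) := hev.mono fun w hw => hval w hw
  have han : AnalyticAt ℂ (fun w => p.eval w / q.eval w) z :=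
    (p.differentiable.analyticAt z).div (q.differentiable.analyticAt z) hq
  have hopen : map (fun w => p.eval w / q.eval w) (𝓝 z) = 𝓝 (p.eval z / q.eval z) := by
    refine le_antisymm han.continuousAt (han.eventually_constant_or_nhds_le_map_nhds.resolve_left ?_)
    intro hconst
    have hz : ∀ᶠ w in 𝓝 z, (p - C (p.eval z / q.eval z) * q).IsRoot w := by
      filter_upwards [hconst, hev] with w h1 h2
      rw [IsRoot.def, eval_sub, eval_mul, eval_C, ← h1, div_mul_cancel₀ _ h2, sub_self]
    have hinf : Set.Infinite {w | (p - C (p.eval z / q.eval z) * q).IsRoot w} :=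
      infinite_of_mem_nhds z hz
    have h0 := eq_zero_of_infinite_isRoot _ hinf
    have := (hind 1 (-(p.eval z / q.eval z)) (by rw [← h0, C_neg, C_1]; ring)).1
    exact one_ne_zero this
  rw [map_congr hcongr, hval z hq, OnePoint.nhds_coe_eq, ← hopen, Filter.map_map]
  rfl

/-- At a pole, exchange p and q and compose with the inversion, which is a homeomorphism. -/
theorem map_sphereQuot_nhds (hind : ∀ a b : ℂ, C a * p + C b * q = 0 → a = 0 ∧ b = 0)
    {z : ℂ} (hpq : ¬ (p.eval z = 0 ∧ q.eval z = 0)) :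
    map (fun z => sphereQuot (p.eval z) (q.eval z)) (𝓝 z) =
      𝓝 (sphereQuot (p.eval z) (q.eval z)) := by
  by_cases hq : q.eval z = 0
  · have hp : p.eval z ≠ 0 := fun hp => hpq ⟨hp, hq⟩
    have h := map_sphereQuot_nhds_of_ne (p := q) (q := p)
      (fun a b hab => (hind b a (by rw [← hab]; ring)).symm) hp
    have hev : ∀ᶠ w in 𝓝 z, p.eval w ≠ 0 := p.continuous.continuousAt.eventually_ne hp
    have hcongr : (fun z => sphereQuot (p.eval z) (q.eval z)) =ᶠ[𝓝 z]
        sphereInv ∘ (fun z => sphereQuot (q.eval z) (p.eval z)) := hev.mono fun w hw =>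
      (sphereInv_sphereQuot fun h => hw h.2).symm
    rw [map_congr hcongr, ← Filter.map_map, h, map_sphereInv_nhds,
      sphereInv_sphereQuot fun h => hp h.2]
  · exact map_sphereQuot_nhds_of_ne hind hq

end Polynomials

section SphereMap

open Polynomial

variable {F : RatFunc ℂ}

theorem sphereMap_coe (F : RatFunc ℂ) (z : ℂ) :
    sphereMap F (OnePoint.some z) = sphereQuot (F.num.eval z) (F.denom.eval z) := rfl

theorem sphereMap_infty (F : RatFunc ℂ) :
    sphereMap F OnePoint.infty =
      sphereQuot (F.num.coeff (degree F)) (F.denom.coeff (degree F)) := rfl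

theorem not_num_denom_eval_eq_zero (F : RatFunc ℂ) (z : ℂ) :
    ¬ (F.num.eval z = 0 ∧ F.denom.eval z = 0) := by
  rintro ⟨h1, h2⟩
  obtain ⟨a, b, hab⟩ := F.isCoprime_num_denom
  have := congrArg (Polynomial.eval z) hab
  simp [h1, h2] at this

theorem not_num_denom_coeff_eq_zero (hF : 0 < degree F) :
    ¬ (F.num.coeff (degree F) = 0 ∧ F.denom.coeff (degree F) = 0) := by
  rintro ⟨h1, h2⟩
  rcases max_choice F.num.natDegree F.denom.natDegree with h | h
  · have hd : degree F = F.num.natDegree := h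
    rw [hd, coeff_natDegree, leadingCoeff_eq_zero] at h1
    rw [hd, h1, natDegree_zero] at hF
    exact lt_irrefl _ hF
  · have hd : degree F = F.denom.natDegree := h
    rw [hd, coeff_natDegree, leadingCoeff_eq_zero] at h2
    exact F.denom_ne_zero h2

theorem num_denom_independent (hF : 0 < degree F) {a b : ℂ}
    (h : Polynomial.C a * F.num + Polynomial.C b * F.denom = 0) : a = 0 ∧ b = 0 := by
  have ha : a = 0 := by
    by_contra ha
    refine hF.ne' (degree_eq_zero_iff.2 ⟨-b / a, ?_⟩)
    have hd : (algebraMap ℂ[X] (RatFunc ℂ)) F.denom ≠ 0 := by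
      simpa using F.denom_ne_zero
    have h' := congrArg (algebraMap ℂ[X] (RatFunc ℂ)) h
    simp only [map_add, map_mul, map_zero, RatFunc.algebraMap_C] at h'
    rw [← F.num_div_denom, div_eq_iff hd, map_div₀, map_neg]
    have hCa : RatFunc.C a ≠ 0 := by simpa using ha
    field_simp
    linear_combination h'
  refine ⟨ha, ?_⟩
  rw [ha, C_0, zero_mul, zero_add, mul_eq_zero, C_eq_zero] at h
  exact h.resolve_right F.denom_ne_zero

theorem eval_reflect {p : ℂ[X]} {n : ℕ} (hp : p.natDegree ≤ n) {z : ℂ} (hz : z ≠ 0) :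
    (p.reflect n).eval z = p.eval z⁻¹ * z ^ n := by
  have hi : Invertible z⁻¹ := invertibleOfNonzero (inv_ne_zero hz)
  have := eval₂_reflect_mul_pow (RingHom.id ℂ) z⁻¹ n p hp
  simp only [invOf_eq_inv, inv_inv, eval₂_id] at this
  rw [← this, mul_assoc, ← mul_pow, inv_mul_cancel₀ hz, one_pow, mul_one]

/-- In the coordinate 1/z the numerator and denominator become their reversals of order `degree F`,
so the point at infinity can be treated like a finite point. -/
theorem sphereMap_sphereInv (F : RatFunc ℂ) (z : ℂ) :
    sphereMap F (sphereInv (OnePoint.some z)) =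
      sphereQuot ((F.num.reflect (degree F)).eval z) ((F.denom.reflect (degree F)).eval z) := by
  by_cases hz : z = 0
  · rw [hz, sphereInv_zero, sphereMap_infty, ← coeff_zero_eq_eval_zero, ← coeff_zero_eq_eval_zero,
      coeff_reflect, coeff_reflect]
    simp [revAt_le]
  · rw [sphereInv_coe_of_ne hz, sphereMap_coe, eval_reflect (n := degree F) (le_max_left _ _) hz,
      eval_reflect (n := degree F) (le_max_right _ _) hz]
    unfold sphereQuot
    have : z ^ degree F ≠ 0 := pow_ne_zero _ hz
    simp only [mul_eq_zero, this, or_false, mul_div_mul_right _ _ this]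

/-- A nonconstant rational function is continuous and open on the sphere. -/
theorem map_sphereMap_nhds (hF : 0 < degree F) (x : OnePoint ℂ) :
    map (sphereMap F) (𝓝 x) = 𝓝 (sphereMap F x) := by
  induction x using OnePoint.rec with
  | infty =>
    have h0 : (OnePoint.infty : OnePoint ℂ) = sphereInv (OnePoint.some 0) := sphereInv_zero.symm
    rw [h0, ← map_sphereInv_nhds]
    change map _ (map _ (𝓝 ((0 : ℂ) : OnePoint ℂ))) = _
    rw [OnePoint.nhds_coe_eq, Filter.map_map, Filter.map_map]
    have : (sphereMap F ∘ sphereInv) ∘ ((↑) : ℂ → OnePoint ℂ) =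
        fun z => sphereQuot ((F.num.reflect (degree F)).eval z)
          ((F.denom.reflect (degree F)).eval z) := by
      ext1 z
      exact sphereMap_sphereInv F z
    rw [this, sphereMap_sphereInv]
    refine map_sphereQuot_nhds (fun a b hab => ?_) ?_
    · rw [← reflect_C_mul, ← reflect_C_mul, ← reflect_add, reflect_eq_zero_iff] at hab
      exact num_denom_independent hF hab
    · rw [← coeff_zero_eq_eval_zero, ← coeff_zero_eq_eval_zero, coeff_reflect, coeff_reflect]
      simpa [revAt_le] using not_num_denom_coeff_eq_zero hF
  | coe z =>
    rw [OnePoint.nhds_coe_eq, Filter.map_map]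
    exact map_sphereQuot_nhds (fun a b => num_denom_independent hF) (not_num_denom_eval_eq_zero F z)

theorem continuous_sphereMap (hF : 0 < degree F) : Continuous (sphereMap F) :=
  continuous_iff_continuousAt.2 fun x => (map_sphereMap_nhds hF x).le

/-- The polynomial whose roots are the finite preimages of a point. -/
noncomputable def fiberPoly (F : RatFunc ℂ) : OnePoint ℂ → ℂ[X]
  | OnePoint.some w => F.num - Polynomial.C w * F.denom
  | OnePoint.infty => F.denom

theorem sphereMap_coe_eq_iff (F : RatFunc ℂ) (z : ℂ) (y : OnePoint ℂ) :
    sphereMap F (OnePoint.some z) = y ↔ (fiberPoly F y).eval z = 0 := by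
  rw [sphereMap_coe]
  induction y using OnePoint.rec with
  | infty => exact sphereQuot_eq_infty
  | coe w =>
    refine (sphereQuot_eq_coe (not_num_denom_eval_eq_zero F z)).trans ?_
    simp [fiberPoly]

theorem sphereMap_infty_eq_iff (hF : 0 < degree F) (y : OnePoint ℂ) :
    sphereMap F OnePoint.infty = y ↔ (fiberPoly F y).coeff (degree F) = 0 := by
  rw [sphereMap_infty]
  induction y using OnePoint.rec with
  | infty => exact sphereQuot_eq_infty
  | coe w =>
    refine (sphereQuot_eq_coe (not_num_denom_coeff_eq_zero hF)).trans ?_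
    simp [fiberPoly]

theorem fiberPoly_ne_zero (hF : 0 < degree F) (y : OnePoint ℂ) : fiberPoly F y ≠ 0 := by
  induction y using OnePoint.rec with
  | infty => exact F.denom_ne_zero
  | coe w =>
    intro h
    have := (num_denom_independent hF (a := 1) (b := -w) (by
      rw [← h, C_neg, C_1]
      change _ = F.num - Polynomial.C w * F.denom
      ring)).1
    exact one_ne_zero this

theorem natDegree_fiberPoly_le (F : RatFunc ℂ) (y : OnePoint ℂ) :
    (fiberPoly F y).natDegree ≤ degree F := by
  induction y using OnePoint.rec with
  | infty => exact le_max_right _ _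
  | coe w =>
    refine (natDegree_sub_le _ _).trans (max_le (le_max_left _ _) ?_)
    exact (natDegree_C_mul_le _ _).trans (le_max_right _ _)

/-- Finite preimages are roots of `fiberPoly F y`. If ∞ is a preimage too, the coefficient of order
`degree F` vanishes, and the lost root makes room for it. -/
theorem encard_fiber_le (hF : 0 < degree F) (y : OnePoint ℂ) :
    (sphereMap F ⁻¹' {y}).encard ≤ degree F := by
  have hsub : sphereMap F ⁻¹' {y} ⊆ (OnePoint.some '' ((fiberPoly F y).roots.toFinset : Set ℂ)) ∪
      {x | x = OnePoint.infty ∧ sphereMap F OnePoint.infty = y} := by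
    intro x hx
    induction x using OnePoint.rec with
    | infty => exact Or.inr ⟨rfl, hx⟩
    | coe z =>
      refine Or.inl ⟨z, ?_, rfl⟩
      have := (sphereMap_coe_eq_iff F z y).1 hx
      simpa [fiberPoly_ne_zero hF] using this
  have hroots : (OnePoint.some '' ((fiberPoly F y).roots.toFinset : Set ℂ)).encard ≤
      ((fiberPoly F y).natDegree : ℕ∞) := by
    refine (Set.encard_image_le _ _).trans ?_
    rw [Set.encard_coe_eq_coe_finsetCard]
    exact_mod_cast (Multiset.toFinset_card_le _).trans (card_roots' _)
  refine (Set.encard_le_encard hsub).trans ?_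
  by_cases hy : sphereMap F OnePoint.infty = y
  · have hlt : (fiberPoly F y).natDegree < degree F := by
      refine lt_of_le_of_ne (natDegree_fiberPoly_le F y) fun h => ?_
      have := (sphereMap_infty_eq_iff hF y).1 hy
      rw [← h, coeff_natDegree, leadingCoeff_eq_zero] at this
      exact fiberPoly_ne_zero hF y this
    refine (Set.encard_union_le _ _).trans ?_
    have h1 : {x : OnePoint ℂ | x = OnePoint.infty ∧ sphereMap F OnePoint.infty = y}.encard ≤ 1 := by
      refine (Set.encard_le_encard (t := {OnePoint.infty}) fun x hx => hx.1).trans ?_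
      simp
    refine (add_le_add hroots h1).trans ?_
    exact_mod_cast hlt
  · have : {x : OnePoint ℂ | x = OnePoint.infty ∧ sphereMap F OnePoint.infty = y} = ∅ := by
      ext x
      simp [hy]
    rw [this, Set.union_empty]
    refine hroots.trans ?_
    exact_mod_cast natDegree_fiberPoly_le F y

end SphereMap

theorem isPreconnected_ball_diff_singleton (w : ℂ) (r : ℝ) :
    IsPreconnected (Metric.ball w r \ {w}) := by
  have : Metric.ball w r \ {w} =
      (fun x : ℝ × ℝ => w + x.1 * Complex.exp (x.2 * Complex.I)) '' (Ioo 0 r ×ˢ univ) := by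
    ext z
    constructor
    · rintro ⟨h1, h2⟩
      refine ⟨(‖z - w‖, Complex.arg (z - w)), ⟨⟨?_, ?_⟩, trivial⟩, ?_⟩
      · exact norm_pos_iff.2 (sub_ne_zero.2 h2)
      · simpa [dist_eq_norm] using h1
      · simp [Complex.norm_mul_exp_arg_mul_I]
    · rintro ⟨⟨ρ, θ⟩, ⟨⟨h1, h2⟩, -⟩, rfl⟩
      simp only at h1 h2
      constructor
      · simpa [dist_eq_norm, Complex.norm_exp_ofReal_mul_I, abs_of_pos h1] using h2
      · simp [h1.ne']
  rw [this]
  refine ((convex_Ioo 0 r).isPreconnected.prod isPreconnected_univ).image _ ?_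
  exact (by fun_prop : Continuous fun x : ℝ × ℝ =>
    w + x.1 * Complex.exp (x.2 * Complex.I)).continuousOn

/-- Small punctured neighbourhoods on the sphere are connected. -/
theorem exists_isPreconnected_punctured {y : OnePoint ℂ} {V : Set (OnePoint ℂ)} (hV : V ∈ 𝓝 y) :
    ∃ W ⊆ V, W ∈ 𝓝 y ∧ IsPreconnected (W \ {y}) := by
  have key : ∀ (w : ℂ) (V : Set (OnePoint ℂ)), V ∈ 𝓝 (w : OnePoint ℂ) →
      ∃ W ⊆ V, W ∈ 𝓝 (w : OnePoint ℂ) ∧ IsPreconnected (W \ {(w : OnePoint ℂ)}) := by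
    intro w V hV
    rw [OnePoint.nhds_coe_eq, mem_map, Metric.mem_nhds_iff] at hV
    obtain ⟨r, hr, hrV⟩ := hV
    refine ⟨OnePoint.some '' Metric.ball w r, ?_, ?_, ?_⟩
    · rintro _ ⟨z, hz, rfl⟩
      exact hrV hz
    · rw [OnePoint.nhds_coe_eq]
      exact image_mem_map (Metric.ball_mem_nhds w hr)
    · have : OnePoint.some '' Metric.ball w r \ {(w : OnePoint ℂ)} =
          OnePoint.some '' (Metric.ball w r \ {w}) := by
        rw [image_sdiff OnePoint.coe_injective, image_singleton]
      rw [this]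
      exact (isPreconnected_ball_diff_singleton w r).image _ OnePoint.continuous_coe.continuousOn
  induction y using OnePoint.rec with
  | coe w => exact key w V hV
  | infty =>
    have h0 : sphereInv (OnePoint.some 0) = OnePoint.infty := sphereInv_zero
    have hV' : sphereInv ⁻¹' V ∈ 𝓝 ((0 : ℂ) : OnePoint ℂ) :=
      continuous_sphereInv.continuousAt (h0 ▸ hV)
    obtain ⟨W, hWV, hW, hWc⟩ := key 0 _ hV'
    refine ⟨sphereInv '' W, image_subset_iff.2 hWV, ?_, ?_⟩
    · rw [← h0, ← map_sphereInv_nhds]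
      exact image_mem_map hW
    · have : sphereInv '' W \ {OnePoint.infty} = sphereInv '' (W \ {OnePoint.some 0}) := by
        rw [image_sdiff (f := sphereInv) sphereInvHomeo.injective, image_singleton, h0]
      rw [this]
      exact hWc.image _ continuous_sphereInv.continuousOn

end Sphere

/-! ### Local sections over noncritical values, and a connectedness principle -/

section LocalSections

open Filter Topology Set Function

theorem range_eq_of_encard_le {I X : Type*} [Finite I] {s : Set X} (hs : s.encard ≤ Nat.card I)
    {a : I → X} (ha : Injective a) (has : ∀ i, a i ∈ s) : range a = s := by
  refine (Set.finite_range a).eq_of_subset_of_encard_le (range_subset_iff.2 has) (hs.trans ?_)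
  rw [← image_univ, ha.injOn.encard_image, Set.encard_univ, ENat.card_eq_coe_natCard]

theorem exists_perm_of_range_subset {I X : Type*} [Finite I] {a b : I → X}
    (hb : Injective b) (h : range b ⊆ range a) : ∃ τ : Equiv.Perm I, b = a ∘ τ := by
  choose τ hτ using fun i => h ⟨i, rfl⟩
  have hinj : Injective τ := fun i j hij => hb (by rw [← hτ i, ← hτ j, hij])
  exact ⟨Equiv.ofBijective τ (Finite.injective_iff_bijective.1 hinj), funext fun i => (hτ i).symm⟩

/-- Local sections of an open continuous map over a point with the maximal number of preimages. -/
theorem exists_local_sections {I X Y : Type*} [Finite I] [TopologicalSpace X] [T2Space X]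
    [TopologicalSpace Y] {f : X → Y} (hf : ∀ x, map f (𝓝 x) = 𝓝 (f x))
    (hcard : ∀ y, (f ⁻¹' {y}).encard ≤ Nat.card I) {y₀ : Y} {p : I → X} (hp : Injective p)
    (hpf : ∀ i, f (p i) = y₀) :
    ∃ V ∈ 𝓝 y₀, ∃ s : I → Y → X, (∀ i, ContinuousOn (s i) V) ∧ (∀ i, s i y₀ = p i) ∧
      (∀ y ∈ V, (∀ i, f (s i y) = y) ∧ Injective fun i => s i y) ∧
      ∃ U : I → Set X, (∀ i, U i ∈ 𝓝 (p i)) ∧ ∀ i, ∀ x ∈ U i, f x ∈ V → x = s i (f x) := by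
  obtain ⟨U₀, hU₀, hdisj⟩ := (Set.finite_range p).t2_separation
  let U : I → Set X := fun i => U₀ (p i)
  have hUo : ∀ i, IsOpen (U i) := fun i => (hU₀ _).2
  have hUp : ∀ i, p i ∈ U i := fun i => (hU₀ _).1
  have hUd : ∀ i j x, x ∈ U i → x ∈ U j → i = j := by
    intro i j x hi hj
    by_contra hij
    exact Set.disjoint_left.1 (hdisj ⟨i, rfl⟩ ⟨j, rfl⟩ (hp.ne hij)) hi hj
  have himg : ∀ i, ∀ W : Set X, ∀ x ∈ U i, W ∈ 𝓝 x → f '' W ∈ 𝓝 (f x) := by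
    intro i W x _ hW
    rw [← hf x]
    exact image_mem_map hW
  let V : Set Y := ⋂ i, f '' U i
  have hV : V ∈ 𝓝 y₀ := by
    refine iInter_mem.2 fun i => ?_
    rw [← hpf i]
    exact himg i _ _ (hUp i) ((hUo i).mem_nhds (hUp i))
  have hex : ∀ i, ∀ y ∈ V, ∃ x ∈ U i, f x = y := fun i y hy => mem_iInter.1 hy i
  -- One preimage of y in each of the disjoint sets U j already gives as many points as the fibre
  -- can hold, so U i contains only one.
  have huniq : ∀ i, ∀ y ∈ V, ∀ x ∈ U i, ∀ x' ∈ U i, f x = y → f x' = y → x = x' := by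
    intro i y hy x hx x' hx' e e'
    choose a haU ha using fun j => hex j y hy
    have hinj : Injective a := fun j k hjk => hUd j k _ (haU j) (hjk ▸ haU k)
    have hr := range_eq_of_encard_le (hcard y) hinj ha
    have key : ∀ x ∈ U i, f x = y → x = a i := by
      intro x hx e
      have : x ∈ range a := by rw [hr]; exact e
      obtain ⟨j, rfl⟩ := this
      rw [hUd j i _ (haU j) hx]
    rw [key x hx e, key x' hx' e']
  classical
  let s : I → Y → X := fun i y => if h : y ∈ V then (hex i y h).choose else p i
  have hsU : ∀ i, ∀ y ∈ V, s i y ∈ U i ∧ f (s i y) = y := by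
    intro i y hy
    simp only [s, dif_pos hy]
    exact (hex i y hy).choose_spec
  have hsx : ∀ i, ∀ x ∈ U i, f x ∈ V → x = s i (f x) := fun i x hx hV =>
    huniq i _ hV x hx _ (hsU i _ hV).1 rfl (hsU i _ hV).2
  refine ⟨V, hV, s, fun i y hy => ?_, fun i => ?_, fun y hy => ⟨fun i => (hsU i y hy).2, ?_⟩,
    U, fun i => (hUo i).mem_nhds (hUp i), hsx⟩
  · intro W hW
    have hW' : W ∩ U i ∈ 𝓝 (s i y) := inter_mem hW ((hUo i).mem_nhds (hsU i y hy).1)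
    have h1 := himg i _ _ (hsU i y hy).1 hW'
    rw [(hsU i y hy).2] at h1
    rw [Filter.mem_map]
    filter_upwards [mem_nhdsWithin_of_mem_nhds h1, self_mem_nhdsWithin] with y' h1 h2
    obtain ⟨x, hx, rfl⟩ := h1
    rw [mem_preimage, ← hsx i x hx.2 h2]
    exact hx.1
  · have := hsx i (p i) (hUp i) (by rw [hpf i]; exact mem_of_mem_nhds hV)
    rw [hpf i] at this
    exact this.symm
  · intro i j hij
    exact hUd i j _ (hsU i y hy).1 ((show s i y = s j y from hij) ▸ (hsU j y hy).1)

/-- A covering of a connected set by finitely many relatively closed sets that are disjoint unless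
their indices lie in the same coset. -/
theorem inv_mul_mem_of_isPreconnected {Q X : Type*} [Group Q] [Finite Q] [TopologicalSpace X]
    {Γ : Subgroup Q} {S : Set X} (hS : IsPreconnected S) (Z : Q → Set X)
    (h1 : ∀ τ, ∀ y ∈ S, y ∈ closure (S ∩ Z τ) → y ∈ Z τ)
    (h2 : ∀ y ∈ S, ∃ τ, y ∈ Z τ)
    (h3 : ∀ y ∈ S, ∀ τ τ', y ∈ Z τ → y ∈ Z τ' → τ⁻¹ * τ' ∈ Γ)
    {y₁ y₂ : X} (hy₁ : y₁ ∈ S) (hy₂ : y₂ ∈ S) {τ₁ τ₂ : Q} (hz₁ : y₁ ∈ Z τ₁) (hz₂ : y₂ ∈ Z τ₂) :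
    τ₁⁻¹ * τ₂ ∈ Γ := by
  by_contra hne
  -- Finiteness of Q makes both unions closed. By h1, a common point in S lies in some Z τ and some
  -- Z τ' from different cosets, which h3 forbids.
  let A : Set X := ⋃ τ ∈ {τ | τ₁⁻¹ * τ ∈ Γ}, closure (S ∩ Z τ)
  let B : Set X := ⋃ τ ∈ {τ | τ₁⁻¹ * τ ∉ Γ}, closure (S ∩ Z τ)
  have hA : IsClosed A := (Set.toFinite _).isClosed_biUnion fun _ _ => isClosed_closure
  have hB : IsClosed B := (Set.toFinite _).isClosed_biUnion fun _ _ => isClosed_closure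
  have hsub : S ⊆ A ∪ B := by
    intro y hy
    obtain ⟨τ, hτ⟩ := h2 y hy
    by_cases hm : τ₁⁻¹ * τ ∈ Γ
    · exact Or.inl (mem_biUnion (show τ ∈ {τ | τ₁⁻¹ * τ ∈ Γ} from hm) (subset_closure ⟨hy, hτ⟩))
    · exact Or.inr (mem_biUnion (show τ ∈ {τ | τ₁⁻¹ * τ ∉ Γ} from hm) (subset_closure ⟨hy, hτ⟩))
  obtain ⟨y, hyS, hyA, hyB⟩ := isPreconnected_closed_iff.1 hS A B hA hB hsub
    ⟨y₁, hy₁, mem_biUnion (show τ₁ ∈ {τ | τ₁⁻¹ * τ ∈ Γ} by simp) (subset_closure ⟨hy₁, hz₁⟩)⟩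
    ⟨y₂, hy₂, mem_biUnion (show τ₂ ∈ {τ | τ₁⁻¹ * τ ∉ Γ} from hne) (subset_closure ⟨hy₂, hz₂⟩)⟩
  obtain ⟨τ, hτ, hyτ⟩ := mem_iUnion₂.1 hyA
  obtain ⟨τ', hτ', hyτ'⟩ := mem_iUnion₂.1 hyB
  have := h3 y hyS τ τ' (h1 τ y hyS hyτ) (h1 τ' y hyS hyτ')
  apply hτ'
  have := mul_mem hτ this
  simpa [mul_assoc] using this

/-- For y ≠ b, shrink W to avoid b. Then W lies between the connected set W \ {y} and its closure.
-/
theorem exists_isPreconnected_diff_singleton {y b : OnePoint ℂ} {V : Set (OnePoint ℂ)}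
    (hV : V ∈ 𝓝 y) : ∃ W ⊆ V, W ∈ 𝓝 y ∧ IsPreconnected (W \ {b}) := by
  by_cases hyb : y = b
  · subst hyb
    exact exists_isPreconnected_punctured hV
  · obtain ⟨W, hWV, hW, hc⟩ := exists_isPreconnected_punctured
      (inter_mem hV (isOpen_compl_singleton.mem_nhds hyb))
    refine ⟨W, hWV.trans inter_subset_left, hW, ?_⟩
    have hbW : b ∉ W := fun hb => (hWV hb).2 rfl
    rw [sdiff_singleton_eq_self hbW]
    refine hc.subset_closure sdiff_subset fun x hx => ?_
    by_cases hxy : x = y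
    · subst hxy
      rw [mem_closure_iff_nhdsWithin_neBot, Set.sdiff_eq, inter_comm, nhdsWithin_inter_of_mem']
      · infer_instance
      · exact mem_nhdsWithin_of_mem_nhds hW
    · exact subset_closure ⟨hx, hxy⟩

end LocalSections

/-! ### Continuation of admissible labellings -/

section Labellings

open Filter Topology Set Function

variable {F : RatFunc ℂ} {I : Type}

/-- Labellings of the fibres of `F` by `I`. -/
def labellings (F : RatFunc ℂ) (I : Type) : Set (I → OnePoint ℂ) :=
  {p | Injective p ∧ ∀ i j, sphereMap F (p i) = sphereMap F (p j)}

theorem comp_mem_labellings {p : I → OnePoint ℂ} (hp : p ∈ labellings F I) (τ : Equiv.Perm I) :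
    p ∘ τ ∈ labellings F I :=
  ⟨hp.1.comp τ.injective, fun i j => hp.2 (τ i) (τ j)⟩

theorem continuous_comp_perm {X : Type*} [TopologicalSpace X] (τ : Equiv.Perm I) :
    Continuous fun p : I → X => p ∘ τ :=
  continuous_pi fun i => continuous_apply (τ i)

/-- A set of labellings of finite fibres by complex numbers that is closed among such labellings,
contains a labelling of every fibre not containing `∞`, and in which the labellings of one fibre
differ by elements of `Γ`. -/
structure IsAdmissible (F : RatFunc ℂ) (Γ : Subgroup (Equiv.Perm I)) (Adm : Set (I → ℂ)) : Prop where
  exists_mem : ∀ y, (sphereMap F ⁻¹' {y}).encard = degree F → y ≠ sphereMap F OnePoint.infty →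
    ∃ e ∈ Adm, Injective e ∧ ∀ i, sphereMap F (OnePoint.some (e i)) = y
  mem_of_comp : ∀ (e : I → ℂ) (τ : Equiv.Perm I), (fun i => OnePoint.some (e i)) ∈ labellings F I →
    e ∈ Adm → e ∘ τ ∈ Adm → τ ∈ Γ
  closed : ∀ e, (fun i => OnePoint.some (e i)) ∈ labellings F I →
    e ∈ closure {e' ∈ Adm | (fun i => OnePoint.some (e' i)) ∈ labellings F I} → e ∈ Adm

variable {Γ : Subgroup (Equiv.Perm I)} {Adm : Set (I → ℂ)}

/-- The admissible labellings as families of points of the sphere. -/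
def admissibleSet (F : RatFunc ℂ) (Adm : Set (I → ℂ)) : Set (I → OnePoint ℂ) :=
  {p | p ∈ labellings F I ∧ ∃ e ∈ Adm, p = fun i => OnePoint.some (e i)}

theorem IsAdmissible.mem_of_mem_closure (h : IsAdmissible F Γ Adm) {p : I → OnePoint ℂ}
    (hp : p ∈ labellings F I) (hfin : ∀ i, p i ≠ OnePoint.infty)
    (hcl : p ∈ closure (admissibleSet F Adm)) : p ∈ admissibleSet F Adm := by
  choose e he using fun i => OnePoint.ne_infty_iff_exists.1 (hfin i)
  have hpe : p = fun i => OnePoint.some (e i) := funext fun i => (he i).symm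
  refine ⟨hp, e, h.closed e (hpe ▸ hp) ?_, hpe⟩
  have hemb : IsEmbedding (fun (e : I → ℂ) (i : I) => ((e i : ℂ) : OnePoint ℂ)) :=
    IsEmbedding.piMap (A := fun _ : I => ℂ) (B := fun _ : I => OnePoint ℂ)
      (f := fun _ z => OnePoint.some z) fun _ => OnePoint.isOpenEmbedding_coe.isEmbedding
  rw [hemb.closure_eq_preimage_closure_image, mem_preimage, ← hpe]
  convert hcl using 2
  ext q
  constructor
  · rintro ⟨e', ⟨h1, h2⟩, rfl⟩
    exact ⟨h2, e', h1, rfl⟩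
  · rintro ⟨h1, e', h2, rfl⟩
    exact ⟨e', ⟨h2, h1⟩, rfl⟩

theorem IsAdmissible.inv_mul_mem (h : IsAdmissible F Γ Adm) {p : I → OnePoint ℂ}
    {τ τ' : Equiv.Perm I} (h1 : p ∘ τ ∈ admissibleSet F Adm) (h2 : p ∘ τ' ∈ admissibleSet F Adm) :
    τ⁻¹ * τ' ∈ Γ := by
  obtain ⟨hl, e, he, hpe⟩ := h1
  obtain ⟨-, e', he', hpe'⟩ := h2
  have hee : e' = e ∘ (τ⁻¹ * τ' : Equiv.Perm I) := by
    funext i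
    have h3 := congrFun hpe' i
    have h4 := congrFun hpe ((τ⁻¹ * τ' : Equiv.Perm I) i)
    simp only [comp_apply, Equiv.Perm.mul_apply] at h3 h4 ⊢
    rw [show τ (τ⁻¹ (τ' i)) = τ' i from τ.apply_symm_apply _] at h4
    rw [h3] at h4
    exact OnePoint.coe_injective h4
  exact h.mem_of_comp e _ (hpe ▸ hl) he (hee ▸ he')

variable [Finite I]

theorem IsAdmissible.exists_perm (h : IsAdmissible F Γ Adm) (hcard : Nat.card I = degree F)
    (hF : 0 < degree F) {p : I → OnePoint ℂ} (hp : p ∈ labellings F I) {y : OnePoint ℂ}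
    (hpy : ∀ i, sphereMap F (p i) = y) (hy : y ≠ sphereMap F OnePoint.infty) :
    ∃ τ : Equiv.Perm I, p ∘ τ ∈ admissibleSet F Adm := by
  have hle : (sphereMap F ⁻¹' {y}).encard ≤ Nat.card I := by
    rw [hcard]
    exact encard_fiber_le hF y
  have hr : range p = sphereMap F ⁻¹' {y} := range_eq_of_encard_le hle hp.1 hpy
  have hn : (sphereMap F ⁻¹' {y}).encard = degree F := by
    rw [← hr, ← image_univ, hp.1.injOn.encard_image, Set.encard_univ, ENat.card_eq_coe_natCard,
      hcard]
  obtain ⟨e, he, hinj, hey⟩ := h.exists_mem y hn hy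
  have hinj' : Injective fun i => OnePoint.some (e i) := OnePoint.coe_injective.comp hinj
  obtain ⟨τ, hτ⟩ := exists_perm_of_range_subset (a := p) hinj' (by
    rw [hr]
    exact range_subset_iff.2 hey)
  exact ⟨τ, comp_mem_labellings hp τ, e, he, hτ.symm⟩

/-- Approach the fibre through nearby fibres other than that of F(∞). Each is admissible after some
permutation, and as there are finitely many, one permutation works for fibres arbitrarily close. -/
theorem exists_perm_mem_closure [Nonempty I] (h : IsAdmissible F Γ Adm) (hcard : Nat.card I = degree F)
    (hF : 0 < degree F) {p : I → OnePoint ℂ} (hp : p ∈ labellings F I) :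
    ∃ τ : Equiv.Perm I, p ∘ τ ∈ closure (admissibleSet F Adm) := by
  obtain ⟨i₀⟩ := ‹Nonempty I›
  set y₀ := sphereMap F (p i₀)
  obtain ⟨V, hV, s, hsc, hs₀, hs, -⟩ := exists_local_sections (I := I) (map_sphereMap_nhds hF)
    (fun y => by rw [hcard]; exact encard_fiber_le hF y) hp.1 (fun i => hp.2 i i₀)
  have hev : ∀ᶠ y in 𝓝[≠] y₀, y ∈ V ∧ y ≠ sphereMap F OnePoint.infty := by
    refine (show ∀ᶠ y in 𝓝[≠] y₀, y ∈ V from mem_nhdsWithin_of_mem_nhds hV).and ?_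
    by_cases hb : y₀ = sphereMap F OnePoint.infty
    · rw [← hb]
      exact self_mem_nhdsWithin
    · exact mem_nhdsWithin_of_mem_nhds (isOpen_compl_singleton.mem_nhds hb)
  have hex : ∀ᶠ y in 𝓝[≠] y₀, ∃ τ : Equiv.Perm I, (fun i => s i y) ∘ τ ∈ admissibleSet F Adm := by
    filter_upwards [hev] with y hy
    refine h.exists_perm hcard hF ⟨(hs y hy.1).2, fun i j => ?_⟩ (hs y hy.1).1 hy.2
    rw [(hs y hy.1).1, (hs y hy.1).1]
  have hfreq : ∃ τ : Equiv.Perm I, ∃ᶠ y in 𝓝[≠] y₀, (fun i => s i y) ∘ τ ∈ admissibleSet F Adm := by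
    by_contra hcon
    push Not at hcon
    obtain ⟨y, hy, τ, hτ⟩ := ((eventually_all.2 hcon).and hex).exists
    exact hy τ hτ
  obtain ⟨τ, hτ⟩ := hfreq
  refine ⟨τ, mem_closure_of_frequently_of_tendsto hτ ?_⟩
  have hp' : p = fun i => s i y₀ := funext fun i => (hs₀ i).symm
  rw [hp']
  change Tendsto ((fun p : I → OnePoint ℂ => p ∘ τ) ∘ fun y i => s i y) _ _
  refine ((continuous_comp_perm τ).tendsto (fun i => s i y₀)).comp (tendsto_pi_nhds.2 fun i => ?_)
  exact ((hsc i).continuousAt hV).tendsto.mono_left nhdsWithin_le_nhds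

/-- The fibre may contain ∞, where admissibility is not defined. Nearby fibres over a neighbourhood
with F(∞) removed avoid this, and that set is connected, so the coset of Γ cannot change between the
two approximations. -/
theorem inv_mul_mem_of_mem_closure [Nonempty I] (h : IsAdmissible F Γ Adm)
    (hcard : Nat.card I = degree F) (hF : 0 < degree F) {p : I → OnePoint ℂ}
    (hp : p ∈ labellings F I) {τ τ' : Equiv.Perm I}
    (h1 : p ∘ τ ∈ closure (admissibleSet F Adm)) (h2 : p ∘ τ' ∈ closure (admissibleSet F Adm)) :
    τ⁻¹ * τ' ∈ Γ := by
  obtain ⟨i₀⟩ := ‹Nonempty I›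
  set y₀ := sphereMap F (p i₀)
  set b := sphereMap F OnePoint.infty with hb
  obtain ⟨V, hV, s, hsc, hs₀, hs, U, hU, hUs⟩ := exists_local_sections (I := I)
    (map_sphereMap_nhds hF) (fun y => by rw [hcard]; exact encard_fiber_le hF y) hp.1
    (fun i => hp.2 i i₀)
  obtain ⟨V', hV'V, hV'o, hyV'⟩ := mem_nhds_iff.1 hV
  obtain ⟨W, hWV, hW, hWc⟩ := exists_isPreconnected_diff_singleton (b := b) (hV'o.mem_nhds hyV')
  have hlab : ∀ y ∈ V, (fun i => s i y) ∈ labellings F I := fun y hy =>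
    ⟨(hs y hy).2, fun i j => by rw [(hs y hy).1, (hs y hy).1]⟩
  have hfin : ∀ y ∈ V, y ≠ b → ∀ i, s i y ≠ OnePoint.infty := by
    intro y hy hyb i hi
    apply hyb
    rw [hb, ← hi, (hs y hy).1]
  -- an admissible labelling close to `p ∘ τ`
  have hnear : ∀ τ : Equiv.Perm I, p ∘ τ ∈ closure (admissibleSet F Adm) →
      ∃ y ∈ W \ {b}, (fun i => s i y) ∘ τ ∈ admissibleSet F Adm := by
    intro τ hτ
    have hN : (fun a : I → OnePoint ℂ => a ∘ (τ⁻¹ : Equiv.Perm I)) ⁻¹'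
        (Set.pi univ fun i => U i ∩ sphereMap F ⁻¹' W) ∈ 𝓝 (p ∘ τ) := by
      apply (continuous_comp_perm (τ⁻¹ : Equiv.Perm I)).continuousAt
      have : (p ∘ τ) ∘ (τ⁻¹ : Equiv.Perm I) = p := by
        funext i
        simp
      change _ ∈ 𝓝 ((p ∘ τ) ∘ (τ⁻¹ : Equiv.Perm I))
      rw [this]
      refine set_pi_mem_nhds (Set.toFinite _) fun i _ => inter_mem (hU i) ?_
      apply (continuous_sphereMap hF).continuousAt
      rw [hp.2 i i₀]
      exact hW
    obtain ⟨a, haN, ha⟩ := mem_closure_iff_nhds.1 hτ _ hN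
    have haN' : ∀ i, a ((τ⁻¹ : Equiv.Perm I) i) ∈ U i ∩ sphereMap F ⁻¹' W := fun i => haN i trivial
    obtain ⟨hal, e, he, hae⟩ := ha
    set y := sphereMap F (a i₀)
    have hay : ∀ i, sphereMap F (a i) = y := fun i => hal.2 i i₀
    have hyW : y ∈ W := by
      rw [← hay ((τ⁻¹ : Equiv.Perm I) i₀)]
      exact (haN' i₀).2
    have hyV := hV'V (hWV hyW)
    have has : a = (fun i => s i y) ∘ τ := by
      funext j
      have h3 := hUs (τ j) (a j) (by simpa using (haN' (τ j)).1) (by rw [hay]; exact hyV)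
      rwa [hay] at h3
    refine ⟨y, ⟨hyW, fun hyb => ?_⟩, has ▸ ⟨hal, e, he, hae⟩⟩
    have hle : (sphereMap F ⁻¹' {y}).encard ≤ Nat.card I := by
      rw [hcard]
      exact encard_fiber_le hF y
    have hr := range_eq_of_encard_le hle hal.1 hay
    have hinf : OnePoint.infty ∈ range a := by
      rw [hr]
      exact hyb.symm
    obtain ⟨j, hj⟩ := hinf
    rw [hae] at hj
    exact OnePoint.coe_ne_infty _ hj
  obtain ⟨y₁, hy₁, hz₁⟩ := hnear τ h1
  obtain ⟨y₂, hy₂, hz₂⟩ := hnear τ' h2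
  refine inv_mul_mem_of_isPreconnected hWc
    (fun τ : Equiv.Perm I => {y | (fun i => s i y) ∘ τ ∈ admissibleSet F Adm}) ?_ ?_ ?_ hy₁ hy₂ hz₁ hz₂
  · intro τ y hy hcl
    have hyV := hV'V (hWV hy.1)
    refine h.mem_of_mem_closure (comp_mem_labellings (hlab y hyV) τ)
      (fun i => hfin y hyV hy.2 (τ i)) ?_
    have hca : ContinuousAt (fun y => (fun i => s i y) ∘ τ) y := by
      have h1 : ContinuousAt (fun (y : OnePoint ℂ) (i : I) => s i y) y :=
        continuousAt_pi.2 fun i => (hsc i).continuousAt (mem_of_superset (hV'o.mem_nhds (hWV hy.1)) hV'V)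
      exact (continuous_comp_perm τ).continuousAt.comp h1
    refine mem_closure_of_frequently_of_tendsto ?_ hca.tendsto
    exact (mem_closure_iff_frequently.1 hcl).mono fun z hz => hz.2
  · intro y hy
    have hyV := hV'V (hWV hy.1)
    exact h.exists_perm hcard hF (hlab y hyV) (hs y hyV).1 hy.2
  · intro y _ τ τ' h3 h4
    exact h.inv_mul_mem h3 h4

/-- Continuation of labellings along a path changes them by an element of `Γ`. -/
theorem exists_labelling_of_path [Nonempty I] (h : IsAdmissible F Γ Adm)
    (hcard : Nat.card I = degree F) (hF : 0 < degree F) {p : unitInterval → I → OnePoint ℂ}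
    (hp : Continuous p) (hpl : ∀ t, p t ∈ labellings F I) {σ : Equiv.Perm I}
    (hσ : p 1 = p 0 ∘ σ) : ∃ τ : Equiv.Perm I, τ⁻¹ * σ * τ ∈ Γ := by
  obtain ⟨τ, hτ⟩ := exists_perm_mem_closure h hcard hF (hpl 0)
  refine ⟨τ, ?_⟩
  -- At time 1 the permutation σ⁻¹ * τ gives the labelling that τ gives at time 0. Constancy of the
  -- coset along the interval puts (σ⁻¹τ)⁻¹τ = τ⁻¹στ in Γ.
  have key := inv_mul_mem_of_isPreconnected (Γ := Γ) (S := (univ : Set unitInterval))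
    isPreconnected_univ (fun τ : Equiv.Perm I => {t | p t ∘ τ ∈ closure (admissibleSet F Adm)})
    (fun τ t _ ht => ?_) (fun t _ => exists_perm_mem_closure h hcard hF (hpl t))
    (fun t _ τ τ' h1 h2 => inv_mul_mem_of_mem_closure h hcard hF (hpl t) h1 h2)
    (y₁ := 1) (y₂ := 0) trivial trivial (τ₁ := σ⁻¹ * τ) (τ₂ := τ) ?_ hτ
  · simpa [mul_assoc] using key
  · have hcl : IsClosed {t | p t ∘ τ ∈ closure (admissibleSet F Adm)} :=
      isClosed_closure.preimage ((continuous_comp_perm τ).comp hp)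
    rw [univ_inter] at ht
    rwa [hcl.closure_eq] at ht
  · change p 1 ∘ (σ⁻¹ * τ : Equiv.Perm I) ∈ closure (admissibleSet F Adm)
    have : p 1 ∘ (σ⁻¹ * τ : Equiv.Perm I) = p 0 ∘ τ := by
      funext i
      simp [hσ]
    rw [this]
    exact hτ

end Labellings

/-! ### Extending specializations to integral elements -/

section Specialization

open Polynomial

/-- A homomorphism to an algebraically closed field extends to the elements integral over the
source. -/
theorem exists_ringHom_extension {A R k : Type*} [CommRing A] [CommRing R] [IsDomain R] [Field k]
    [IsAlgClosed k] (f : A →+* R) (hf : Function.Injective f) (φ : A →+* k)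
    (hφ : Function.Surjective φ) :
    ∃ (B : Subring R) (ψ : B →+* k), (∀ x, f.IsIntegralElem x → x ∈ B) ∧
      ∀ a, ∃ h : f a ∈ B, ψ ⟨f a, h⟩ = φ a := by
  let _ : Algebra A R := f.toAlgebra
  let B := integralClosure A R
  have hinj : Function.Injective (algebraMap A B) := fun a b hab =>
    hf (congrArg (algebraMap B R) hab)
  have hmax : (RingHom.ker φ).IsMaximal := RingHom.ker_isMaximal_of_surjective φ hφ
  obtain ⟨M, hM, hMA⟩ := Ideal.exists_ideal_over_maximal_of_isIntegral (S := B) (RingHom.ker φ)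
    (by rw [(RingHom.injective_iff_ker_eq_bot _).1 hinj]; exact bot_le)
  let _ : Field (B ⧸ M) := Ideal.Quotient.field M
  let g : A →+* B ⧸ M := (Ideal.Quotient.mk M).comp (algebraMap A B)
  have hg : ∀ a, φ a = 0 → g a = 0 := by
    intro a ha
    have : a ∈ M.comap (algebraMap A B) := by rw [hMA]; exact ha
    exact Ideal.Quotient.eq_zero_iff_mem.2 this
  let j : k →+* B ⧸ M := RingHom.liftOfSurjective φ hφ ⟨g, fun a ha => hg a ha⟩
  have hj : ∀ a, j (φ a) = g a := fun a => RingHom.liftOfRightInverse_comp_apply ..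
  -- A maximal ideal over the kernel of φ has residue field integral over k. As k is algebraically
  -- closed, the residue field is k itself.
  have hint : j.IsIntegral := by
    have h1 : (j.comp φ).IsIntegral := by
      have : j.comp φ = g := RingHom.ext hj
      rw [this]
      exact RingHom.IsIntegral.trans _ _ (algebraMap_isIntegral_iff.2 inferInstance)
        (RingHom.isIntegral_of_surjective _ Ideal.Quotient.mk_surjective)
    exact h1.tower_top φ j
  have hbij := IsAlgClosed.ringHom_bijective_of_isIntegral j hint
  let e : k ≃+* B ⧸ M := RingEquiv.ofBijective j hbij
  refine ⟨B.toSubring, (e.symm : B ⧸ M →+* k).comp (Ideal.Quotient.mk M), fun x hx => hx,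
    fun a => ⟨(algebraMap A B a).2, ?_⟩⟩
  change e.symm (g a) = φ a
  rw [← hj]
  exact e.symm_apply_apply _

end Specialization

/-! ### Labellings cut out by polynomial relations -/

section Relations

open Polynomial Filter Topology Function

variable {N I : Type*} [Field N] [Algebra ℂ N]

/-- The labellings satisfying all polynomial relations over `ℂ` between `v` and `ξ`, where
`v = P (ξ i₀) / Q (ξ i₀)`. -/
def relationSet (P Q : ℂ[X]) (v : N) (ξ : I → N) (i₀ : I) : Set (I → ℂ) :=
  {e | ∀ Φ : MvPolynomial (Option I) ℂ, MvPolynomial.aeval (fun o => o.elim v ξ) Φ = 0 →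
    MvPolynomial.eval (fun o => o.elim (P.eval (e i₀) / Q.eval (e i₀)) e) Φ = 0}

variable {P Q : ℂ[X]} {v : N} {ξ : I → N} {i₀ : I}

theorem mem_relationSet_of_ringHom {e : I → ℂ} {B : Subring N} (ψ : B →+* ℂ)
    (hC : ∀ c : ℂ, ∃ h : algebraMap ℂ N c ∈ B, ψ ⟨_, h⟩ = c)
    {v₀ : ℂ} (hv : ∃ h : v ∈ B, ψ ⟨_, h⟩ = v₀) (he : ∀ i, ∃ h : ξ i ∈ B, ψ ⟨_, h⟩ = e i)
    (hP : P.eval (e i₀) / Q.eval (e i₀) = v₀) : e ∈ relationSet P Q v ξ i₀ := by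
  intro Φ hΦ
  choose hCB hCψ using hC
  choose heB heψ using he
  obtain ⟨hvB, hvψ⟩ := hv
  let ι : ℂ →+* B := (algebraMap ℂ N).codRestrict B hCB
  let x : Option I → B := fun o => o.elim ⟨v, hvB⟩ fun i => ⟨ξ i, heB i⟩
  have h1 : MvPolynomial.eval₂ ι x Φ = 0 := by
    apply Subtype.ext
    change B.subtype _ = 0
    rw [← MvPolynomial.coe_eval₂Hom, ← RingHom.comp_apply, MvPolynomial.comp_eval₂Hom,
      MvPolynomial.coe_eval₂Hom]
    rw [MvPolynomial.aeval_def] at hΦ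
    convert hΦ using 2
    · rfl
    · funext o
      cases o <;> rfl
  have h2 := congrArg ψ h1
  rw [← MvPolynomial.coe_eval₂Hom, ← RingHom.comp_apply, MvPolynomial.comp_eval₂Hom,
    MvPolynomial.coe_eval₂Hom, map_zero] at h2
  rw [MvPolynomial.eval, MvPolynomial.coe_eval₂Hom]
  convert h2 using 2
  · exact RingHom.ext fun c => (hCψ c).symm
  · funext o
    cases o with
    | none => exact hP.trans hvψ.symm
    | some i => exact (heψ i).symm

theorem mem_relationSet_of_mem_closure {e : I → ℂ} (hQ : Q.eval (e i₀) ≠ 0) {T : Set (I → ℂ)}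
    (hT : T ⊆ relationSet P Q v ξ i₀) (he : e ∈ closure T) : e ∈ relationSet P Q v ξ i₀ := by
  intro Φ hΦ
  have hcont : ContinuousAt (fun e : I → ℂ => MvPolynomial.eval
      (fun o : Option I => o.elim (P.eval (e i₀) / Q.eval (e i₀)) e) Φ) e := by
    refine (MvPolynomial.continuous_eval Φ).continuousAt.comp (continuousAt_pi.2 fun o => ?_)
    cases o with
    | none =>
      have hev : Continuous fun e : I → ℂ => e i₀ := continuous_apply i₀
      exact (P.continuous.comp hev).continuousAt.div (Q.continuous.comp hev).continuousAt hQ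
    | some i => exact (continuous_apply i).continuousAt
  have h1 := mem_closure_of_frequently_of_tendsto (s := {(0 : ℂ)})
    ((mem_closure_iff_frequently.1 he).mono fun e' he' => hT he' Φ hΦ) hcont.tendsto
  rwa [closure_singleton] at h1

/-- Since e is injective, e ∘ τ is none of the points e ∘ γ. Interpolation gives Φ equal to 1 at all
of these and 0 at e ∘ τ; the product of its Γ-translates is invariant and keeps both values. -/
theorem exists_separating_polynomial {I : Type*} [Finite I] {Γ : Subgroup (Equiv.Perm I)}
    {τ : Equiv.Perm I} (hτ : τ ∉ Γ) {e : I → ℂ} (he : Injective e) :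
    ∃ Ψ : MvPolynomial I ℂ, (∀ γ ∈ Γ, MvPolynomial.rename γ Ψ = Ψ) ∧
      MvPolynomial.eval e Ψ = 1 ∧ MvPolynomial.eval (e ∘ τ) Ψ = 0 := by
  classical
  have := Fintype.ofFinite Γ
  have hex : ∀ γ : Γ, ∃ i, e (τ i) ≠ e ((γ : Equiv.Perm I) i) := by
    intro γ
    by_contra hcon
    push Not at hcon
    apply hτ
    have : τ = γ := Equiv.ext fun i => he (hcon i)
    rw [this]
    exact γ.2
  choose k hk using hex
  let Φ : MvPolynomial I ℂ := 1 - ∏ γ : Γ,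
    MvPolynomial.C (e (τ (k γ)) - e ((γ : Equiv.Perm I) (k γ)))⁻¹ *
      (MvPolynomial.X (k γ) - MvPolynomial.C (e ((γ : Equiv.Perm I) (k γ))))
  have hΦτ : MvPolynomial.eval (e ∘ τ) Φ = 0 := by
    simp only [Φ, map_sub, map_one, map_prod, map_mul, MvPolynomial.eval_C, MvPolynomial.eval_X,
      comp_apply]
    rw [Finset.prod_eq_one fun γ _ => inv_mul_cancel₀ (sub_ne_zero.2 (hk γ)), sub_self]
  have hΦγ : ∀ γ : Γ, MvPolynomial.eval (e ∘ (γ : Equiv.Perm I)) Φ = 1 := by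
    intro γ
    simp only [Φ, map_sub, map_one, map_prod, map_mul, MvPolynomial.eval_C, MvPolynomial.eval_X,
      comp_apply]
    rw [Finset.prod_eq_zero (Finset.mem_univ γ) (by rw [sub_self, mul_zero]), sub_zero]
  refine ⟨∏ γ : Γ, MvPolynomial.rename (γ : Equiv.Perm I) Φ, fun γ hγ => ?_, ?_, ?_⟩
  · rw [map_prod]
    refine Fintype.prod_equiv (Equiv.mulLeft (⟨γ, hγ⟩ : Γ)) _ _ fun γ' => ?_
    rw [MvPolynomial.rename_rename]
    rfl
  · rw [map_prod]
    refine Finset.prod_eq_one fun γ _ => ?_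
    rw [MvPolynomial.eval_rename]
    exact hΦγ γ
  · rw [map_prod]
    refine Finset.prod_eq_zero (Finset.mem_univ 1) ?_
    rw [MvPolynomial.eval_rename]
    exact hΦτ

/-- Otherwise take an invariant Ψ separating e from e ∘ τ. The relation Ψ(ξ) q(v) = p(v) holds at
both with the same value of v, so p and q would have a common zero. -/
theorem mem_of_comp_mem_relationSet {I : Type*} [Finite I] {ξ : I → N} {i₀ : I}
    {Γ : Subgroup (Equiv.Perm I)}
    (hΓ : ∀ Ψ : MvPolynomial I ℂ, (∀ γ ∈ Γ, MvPolynomial.rename γ Ψ = Ψ) →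
      ∃ p q : ℂ[X], IsCoprime p q ∧ MvPolynomial.aeval ξ Ψ * aeval v q = aeval v p)
    {e : I → ℂ} {τ : Equiv.Perm I} (he : Injective e)
    (hv : P.eval (e (τ i₀)) / Q.eval (e (τ i₀)) = P.eval (e i₀) / Q.eval (e i₀))
    (h1 : e ∈ relationSet P Q v ξ i₀) (h2 : e ∘ τ ∈ relationSet P Q v ξ i₀) : τ ∈ Γ := by
  by_contra hτ
  obtain ⟨Ψ, hΨΓ, hΨe, hΨτ⟩ := exists_separating_polynomial hτ he
  obtain ⟨p, q, ⟨a, b, hab⟩, hpq⟩ := hΓ Ψ hΨΓ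
  let Θ : MvPolynomial (Option I) ℂ := MvPolynomial.rename some Ψ *
    aeval (MvPolynomial.X none) q - aeval (MvPolynomial.X none) p
  have hΘ : MvPolynomial.aeval (fun o => o.elim v ξ) Θ = 0 := by
    simp only [Θ, map_sub, map_mul, MvPolynomial.aeval_rename, ← Polynomial.aeval_algHom_apply,
      MvPolynomial.aeval_X]
    exact sub_eq_zero.2 hpq
  have hev : ∀ (e : I → ℂ) (w : ℂ), MvPolynomial.eval (fun o : Option I => o.elim w e) Θ =
      MvPolynomial.eval e Ψ * q.eval w - p.eval w := by
    intro e w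
    rw [← MvPolynomial.coe_aeval_eq_eval]
    simp only [Θ, map_sub, map_mul, MvPolynomial.aeval_rename, ← Polynomial.aeval_algHom_apply,
      RingHom.coe_coe, MvPolynomial.aeval_X, Polynomial.coe_aeval_eq_eval]
    rfl
  have h3 := h1 Θ hΘ
  have h4 := h2 Θ hΘ
  rw [hev, hΨe] at h3
  rw [hev, hΨτ, comp_apply, hv] at h4
  have h5 := congrArg (Polynomial.eval (P.eval (e i₀) / Q.eval (e i₀))) hab
  simp only [eval_add, eval_mul, eval_one] at h5
  have hp : p.eval (P.eval (e i₀) / Q.eval (e i₀)) = 0 := by linear_combination -h4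
  have hq : q.eval (P.eval (e i₀) / Q.eval (e i₀)) = 0 := by linear_combination h3 + hp
  rw [hp, hq] at h5
  simp at h5

end Relations

/-! ### The relation set is admissible -/

section Admissible

open Polynomial Filter Topology Function Set

variable {F : RatFunc ℂ} {P Q : ℂ[X]}

theorem ne_sphereMap_infty_of_injective {I : Type*} [Finite I] (hF : 0 < degree F)
    (hcard : Nat.card I = degree F) {e : I → ℂ} (he : Injective e) {y : OnePoint ℂ}
    (hy : ∀ i, sphereMap F (OnePoint.some (e i)) = y) : y ≠ sphereMap F OnePoint.infty := by
  intro h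
  have hr := range_eq_of_encard_le (a := fun i => OnePoint.some (e i))
    (by rw [hcard]; exact encard_fiber_le hF y) (OnePoint.coe_injective.comp he) hy
  have hinf : OnePoint.infty ∈ range fun i => OnePoint.some (e i) := by
    rw [hr]
    exact h.symm
  obtain ⟨i, hi⟩ := hinf
  exact OnePoint.coe_ne_infty _ hi

theorem eval_div_eval_eq (hPQ : IsCoprime P Q) {z v₀ : ℂ} (h : (P - C v₀ * Q).eval z = 0) :
    Q.eval z ≠ 0 ∧ P.eval z / Q.eval z = v₀ := by
  simp only [eval_sub, eval_mul, eval_C] at h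
  have hQ : Q.eval z ≠ 0 := by
    intro hQ
    obtain ⟨a, b, hab⟩ := hPQ
    have := congrArg (Polynomial.eval z) hab
    simp only [eval_add, eval_mul, eval_one, hQ, mul_zero, add_zero] at this
    rw [hQ, mul_zero, sub_zero] at h
    rw [h, mul_zero] at this
    exact zero_ne_one this
  refine ⟨hQ, ?_⟩
  rw [div_eq_iff hQ]
  exact sub_eq_zero.1 h

theorem isAdmissible_relationSet (hF : 0 < degree F) {N : Type*} {I : Type} [Field N] [Algebra ℂ N]
    [Fintype I] (hcard : Nat.card I = degree F) {v : N} (hv : Transcendental ℂ v)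
    (hPQ : IsCoprime P Q)
    (hfib : ∀ y, y ≠ sphereMap F OnePoint.infty →
      ∃ v₀ l : ℂ, l ≠ 0 ∧ fiberPoly F y = C l * (P - C v₀ * Q))
    {ξ : I → N} (hξ : P.map (algebraMap ℂ N) - C v * Q.map (algebraMap ℂ N) = ∏ i, (X - C (ξ i)))
    {Γ : Subgroup (Equiv.Perm I)}
    (hΓ : ∀ Ψ : MvPolynomial I ℂ, (∀ γ ∈ Γ, MvPolynomial.rename γ Ψ = Ψ) →
      ∃ p q : ℂ[X], IsCoprime p q ∧ MvPolynomial.aeval ξ Ψ * aeval v q = aeval v p)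
    (i₀ : I) : IsAdmissible F Γ (relationSet P Q v ξ i₀) := by
  have hlab : ∀ e : I → ℂ, (fun i => OnePoint.some (e i)) ∈ labellings F I →
      ∃ v₀, ∀ i, Q.eval (e i) ≠ 0 ∧ P.eval (e i) / Q.eval (e i) = v₀ := by
    intro e he
    have he' : Injective e := fun i j hij => he.1 (congrArg OnePoint.some hij)
    have hne := ne_sphereMap_infty_of_injective hF hcard he' fun i => he.2 i i₀
    obtain ⟨v₀, l, hl, hf⟩ := hfib _ hne
    refine ⟨v₀, fun i => eval_div_eval_eq hPQ ?_⟩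
    have h1 := (sphereMap_coe_eq_iff F (e i) _).1 (he.2 i i₀)
    rw [hf, eval_mul, eval_C] at h1
    exact (mul_eq_zero.1 h1).resolve_left hl
  refine ⟨fun y hn hy => ?_, fun e τ he h1 h2 => ?_, fun e he hcl => ?_⟩
  · obtain ⟨v₀, l, hl, hf⟩ := hfib y hy
    obtain ⟨B, ψ, hB, hψ⟩ := exists_ringHom_extension (aeval (R := ℂ) v : ℂ[X] →ₐ[ℂ] N).toRingHom
      (transcendental_iff_injective.1 hv) (evalRingHom v₀) fun c => ⟨C c, by simp⟩
    have hC : ∀ c : ℂ, ∃ h : algebraMap ℂ N c ∈ B, ψ ⟨_, h⟩ = c := by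
      intro c
      obtain ⟨h, h'⟩ := hψ (C c)
      simp only [AlgHom.toRingHom_eq_coe, RingHom.coe_coe, aeval_C, coe_evalRingHom, eval_C] at h h'
      exact ⟨h, h'⟩
    have hvB : ∃ h : v ∈ B, ψ ⟨_, h⟩ = v₀ := by
      obtain ⟨h, h'⟩ := hψ X
      simp only [AlgHom.toRingHom_eq_coe, RingHom.coe_coe, aeval_X, coe_evalRingHom, eval_X] at h h'
      exact ⟨h, h'⟩
    choose hCB hCψ using hC
    -- The product form makes P - vQ monic over ℂ[v], so its roots ξ i are integral there and the
    -- specialization v ↦ v₀ extends to them.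
    have hξB : ∀ i, ξ i ∈ B := by
      intro i
      have hmap : (P.map C - C X * Q.map C).map (aeval (R := ℂ) v : ℂ[X] →ₐ[ℂ] N).toRingHom =
          ∏ i, (X - C (ξ i)) := by
        have h3 : (aeval (R := ℂ) v : ℂ[X] →ₐ[ℂ] N).toRingHom.comp C = algebraMap ℂ N :=
          RingHom.ext fun c => aeval_C v c
        rw [← hξ, Polynomial.map_sub, Polynomial.map_mul, Polynomial.map_map, Polynomial.map_map,
          h3, map_C,
          show (aeval (R := ℂ) v : ℂ[X] →ₐ[ℂ] N).toRingHom X = v from aeval_X (R := ℂ) v]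
      refine hB _ ⟨P.map C - C X * Q.map C, ?_, ?_⟩
      · refine monic_of_injective (transcendental_iff_injective.1 hv) ?_
        change (Polynomial.map (aeval (R := ℂ) v : ℂ[X] →ₐ[ℂ] N).toRingHom _).Monic
        rw [hmap]
        exact monic_prod_X_sub_C _ _
      · rw [eval₂_eq_eval_map, hmap, eval_prod]
        exact Finset.prod_eq_zero (Finset.mem_univ i) (by simp)
    let e : I → ℂ := fun i => ψ ⟨ξ i, hξB i⟩
    have hprod : P - C v₀ * Q = ∏ i, (X - C (e i)) := by
      obtain ⟨hvB, hvψ⟩ := hvB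
      let ι : ℂ →+* B := (algebraMap ℂ N).codRestrict B hCB
      have h1 : P.map ι - C (⟨v, hvB⟩ : B) * Q.map ι = ∏ i, (X - C (⟨ξ i, hξB i⟩ : B)) := by
        apply Polynomial.map_injective B.subtype B.subtype_injective
        simp only [Polynomial.map_sub, Polynomial.map_mul, Polynomial.map_prod, map_C, map_X,
          Polynomial.map_map]
        exact hξ
      have h2 := congrArg (Polynomial.map ψ) h1
      simp only [Polynomial.map_sub, Polynomial.map_mul, Polynomial.map_prod, map_C, map_X,
        Polynomial.map_map, hvψ] at h2
      have h3 : ψ.comp ι = RingHom.id ℂ := RingHom.ext hCψ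
      rw [h3, Polynomial.map_id, Polynomial.map_id] at h2
      exact h2
    have hroot : ∀ z, sphereMap F (OnePoint.some z) = y ↔ ∃ i, z = e i := by
      intro z
      rw [sphereMap_coe_eq_iff, hf, hprod, eval_mul, eval_C, mul_eq_zero, or_iff_right hl,
        eval_prod, Finset.prod_eq_zero_iff]
      simp [sub_eq_zero]
    have hey : ∀ i, sphereMap F (OnePoint.some (e i)) = y := fun i => (hroot _).2 ⟨i, rfl⟩
    refine ⟨e, ?_, ?_, hey⟩
    · refine mem_relationSet_of_ringHom ψ (fun c => ⟨hCB c, hCψ c⟩) hvB (fun i => ⟨hξB i, rfl⟩)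
        (eval_div_eval_eq hPQ ?_).2
      rw [hprod, eval_prod]
      exact Finset.prod_eq_zero (Finset.mem_univ i₀) (by simp)
    · have hr : sphereMap F ⁻¹' {y} = (fun i => OnePoint.some (e i)) '' univ := by
        ext x
        rw [image_univ]
        constructor
        · intro hx
          induction x using OnePoint.rec with
          | infty => exact absurd hx.symm hy
          | coe z =>
            obtain ⟨i, rfl⟩ := (hroot z).1 hx
            exact ⟨i, rfl⟩
        · rintro ⟨i, rfl⟩
          exact hey i
      -- The specialized roots fill the fibre; as y is noncritical, the fibre has as many points as
      -- there are indices, so no two roots coincide.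
      have hinj : InjOn (fun i => OnePoint.some (e i)) univ := by
        rw [← Set.ncard_image_iff, ← hr, Set.ncard_univ, hcard, Set.ncard, hn]
        rfl
      exact fun i j hij => hinj trivial trivial (congrArg OnePoint.some hij)
  · obtain ⟨v₀, hv₀⟩ := hlab e he
    exact mem_of_comp_mem_relationSet hΓ (fun i j hij => he.1 (congrArg OnePoint.some hij))
      (by rw [(hv₀ _).2, (hv₀ _).2]) h1 h2
  · obtain ⟨v₀, hv₀⟩ := hlab e he
    exact mem_relationSet_of_mem_closure (hv₀ i₀).1 (fun e' he' => he'.1) hcl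

end Admissible

/-! ### Moving F(∞) to infinity -/

section NormalForm

open Polynomial IntermediateField

variable {F : RatFunc ℂ}

/-- After a change of coordinate in the target that sends `F(∞)` to `∞`, a rational function is a
quotient `P / Q` with `P` monic and `deg Q < deg P`. -/
theorem exists_normal_form (hF : 0 < degree F) :
    ∃ (P Q : ℂ[X]) (v : RatFunc ℂ), P.Monic ∧ P.natDegree = degree F ∧ Q.degree < P.degree ∧
      IsCoprime P Q ∧ ℂ⟮v⟯ = ℂ⟮F⟯ ∧
      algebraMap ℂ[X] (RatFunc ℂ) P = v * algebraMap ℂ[X] (RatFunc ℂ) Q ∧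
      ∀ y, y ≠ sphereMap F OnePoint.infty →
        ∃ v₀ l : ℂ, l ≠ 0 ∧ fiberPoly F y = C l * (P - C v₀ * Q) := by
  set n := degree F with hn
  set a := F.num.coeff n with ha
  set b := F.denom.coeff n with hb
  have hab : ¬ (a = 0 ∧ b = 0) := not_num_denom_coeff_eq_zero hF
  have hnum : F.num.natDegree ≤ n := le_max_left _ _
  have hden : F.denom.natDegree ≤ n := le_max_right _ _
  have hmonic : ∀ (p : ℂ[X]), p.natDegree ≤ n → p.coeff n ≠ 0 →
      (C (p.coeff n)⁻¹ * p).Monic ∧ (C (p.coeff n)⁻¹ * p).natDegree = n := by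
    intro p hp h0
    have h1 : p.natDegree = n := le_antisymm hp (le_natDegree_of_ne_zero h0)
    have h2 : (C (p.coeff n)⁻¹ * p).natDegree = n := by
      rw [natDegree_C_mul (inv_ne_zero h0), h1]
    refine ⟨?_, h2⟩
    rw [Monic, leadingCoeff, h2, coeff_C_mul, inv_mul_cancel₀ h0]
  have hlt : ∀ (p q : ℂ[X]), q.natDegree ≤ n → q.coeff n = 0 → p.Monic → p.natDegree = n →
      q.degree < p.degree := by
    intro p q hq h0 hp hpn
    rw [degree_eq_natDegree hp.ne_zero, hpn]
    refine (degree_lt_iff_coeff_zero _ _).2 fun m hm => ?_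
    rcases hm.lt_or_eq with h | rfl
    · exact coeff_eq_zero_of_natDegree_lt (hq.trans_lt h)
    · exact h0
  have hFd : algebraMap ℂ[X] (RatFunc ℂ) F.num = F * algebraMap ℂ[X] (RatFunc ℂ) F.denom := by
    rw [← div_eq_iff (RatFunc.algebraMap_ne_zero F.denom_ne_zero), RatFunc.num_div_denom]
  by_cases hb0 : b = 0
  · have ha0 : a ≠ 0 := fun h => hab ⟨h, hb0⟩
    obtain ⟨hm, hmn⟩ := hmonic F.num hnum ha0
    refine ⟨C a⁻¹ * F.num, C a⁻¹ * F.denom, F, hm, hmn, hlt _ _ ?_ ?_ hm hmn, ?_, rfl, ?_, ?_⟩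
    · exact (natDegree_C_mul_le _ _).trans hden
    · rw [coeff_C_mul, ← hb, hb0, mul_zero]
    · have hu : IsUnit (C a⁻¹ : ℂ[X]) := isUnit_C.2 (inv_ne_zero ha0).isUnit
      exact (isCoprime_mul_unit_left hu _ _).2 F.isCoprime_num_denom
    · rw [map_mul, map_mul, hFd]
      ring
    · intro y hy
      induction y using OnePoint.rec with
      | infty =>
        exact absurd ((sphereMap_infty_eq_iff hF OnePoint.infty).2 hb0) hy.symm
      | coe w =>
        refine ⟨w, a, ha0, ?_⟩
        change F.num - C w * F.denom = _
        have : (C a * C a⁻¹ : ℂ[X]) = 1 := by rw [← C_mul, mul_inv_cancel₀ ha0, C_1]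
        linear_combination (-F.num + C w * F.denom) * this
  · obtain ⟨hm, hmn⟩ := hmonic F.denom hden hb0
    set q : ℂ[X] := C a * F.denom - C b * F.num with hq
    have hq0 : q ≠ 0 := by
      intro h0
      refine hb0 (neg_eq_zero.1 (num_denom_independent hF (a := -b) (b := a) ?_).1)
      rw [← h0, hq, C_neg]
      ring
    have hbb : (C b * C b⁻¹ : ℂ[X]) = 1 := by rw [← C_mul, mul_inv_cancel₀ hb0, C_1]
    have hFc : RatFunc.C a - RatFunc.C b * F ≠ 0 := by
      intro h0
      apply hq0
      apply RatFunc.algebraMap_injective ℂ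
      rw [hq, map_sub, map_mul, map_mul, hFd, map_zero, RatFunc.algebraMap_C, RatFunc.algebraMap_C]
      linear_combination (algebraMap ℂ[X] (RatFunc ℂ) F.denom) * h0
    -- Here F(∞) = a / b is finite, and v = 1 / (a - bF) sends it to infinity. A finite w ≠ a / b
    -- goes to 1 / (a - wb), and ∞ goes to 0.
    refine ⟨C b⁻¹ * F.denom, C b⁻¹ * q, (RatFunc.C a - RatFunc.C b * F)⁻¹, hm, hmn,
      hlt _ _ ?_ ?_ hm hmn, ?_, ?_, ?_, ?_⟩
    · refine (natDegree_C_mul_le _ _).trans ((natDegree_sub_le _ _).trans (max_le ?_ ?_))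
      · exact (natDegree_C_mul_le _ _).trans hden
      · exact (natDegree_C_mul_le _ _).trans hnum
    · rw [coeff_C_mul, hq, coeff_sub, coeff_C_mul, coeff_C_mul, ← ha, ← hb]
      ring
    · have hu : IsUnit (C b⁻¹ : ℂ[X]) := isUnit_C.2 (inv_ne_zero hb0).isUnit
      rw [isCoprime_mul_unit_left hu]
      obtain ⟨s, t, hst⟩ := F.isCoprime_num_denom
      refine ⟨t + s * C b⁻¹ * C a, - s * C b⁻¹, ?_⟩
      rw [hq]
      linear_combination hst + s * F.num * hbb
    · have hmem : ∀ (K : IntermediateField ℂ (RatFunc ℂ)) (c : ℂ), RatFunc.C c ∈ K := fun K c =>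
        K.algebraMap_mem c
      apply le_antisymm
      · rw [adjoin_simple_le_iff]
        exact inv_mem (sub_mem (hmem _ a) (mul_mem (hmem _ b) (mem_adjoin_simple_self ℂ F)))
      · rw [adjoin_simple_le_iff]
        have h1 := inv_mem (mem_adjoin_simple_self ℂ (RatFunc.C a - RatFunc.C b * F)⁻¹)
        rw [inv_inv] at h1
        have h2 := mul_mem (hmem ℂ⟮(RatFunc.C a - RatFunc.C b * F)⁻¹⟯ b⁻¹)
          (sub_mem (hmem ℂ⟮(RatFunc.C a - RatFunc.C b * F)⁻¹⟯ a) h1)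
        convert h2 using 1
        rw [map_inv₀]
        have : (RatFunc.C b : RatFunc ℂ) ≠ 0 := (_root_.map_ne_zero _).2 hb0
        field_simp
        ring
    · rw [map_mul, map_mul, hq, map_sub, map_mul, map_mul, hFd]
      simp only [RatFunc.algebraMap_C]
      field_simp
    · intro y hy
      induction y using OnePoint.rec with
      | infty =>
        refine ⟨0, b, hb0, ?_⟩
        change F.denom = _
        rw [C_0]
        linear_combination -F.denom * hbb
      | coe w =>
        have hw : a - w * b ≠ 0 := by
          intro h0
          refine hy.symm ((sphereMap_infty_eq_iff hF _).2 ?_)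
          change (F.num - C w * F.denom).coeff n = 0
          rw [coeff_sub, coeff_C_mul]
          exact h0
        refine ⟨(a - w * b)⁻¹, a - w * b, hw, ?_⟩
        change F.num - C w * F.denom = _
        have h3 : C (a - w * b) * C (a - w * b)⁻¹ = 1 := by
          rw [← C_mul, mul_inv_cancel₀ hw, C_1]
        rw [mul_sub, ← mul_assoc (C (a - w * b)) (C (a - w * b)⁻¹), h3, hq]
        simp only [C_sub, C_mul]
        linear_combination (-F.num + C w * F.denom) * hbb

end NormalForm

/-! ### The conjugates of X over ℂ(F) -/

section Conjugates

open Polynomial IntermediateField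

variable {F : RatFunc ℂ}

theorem finiteDimensional_of_degree_pos (hF : 0 < degree F) :
    FiniteDimensional ℂ⟮F⟯ (RatFunc ℂ) :=
  Module.finite_of_finrank_pos (by rw [finrank_adjoin]; exact hF)

theorem natDegree_minpoly_X (hF : 0 < degree F) :
    (minpoly ℂ⟮F⟯ (RatFunc.X : RatFunc ℂ)).natDegree = degree F := by
  have := finiteDimensional_of_degree_pos hF
  rw [← finrank_adjoin F]
  exact (Field.primitive_element_iff_minpoly_natDegree_eq _ _).1
    (RatFunc.IntermediateField.adjoin_X _)

variable (F) in
/-- The conjugates of `X` over `ℂ(F)` in the field `N`. -/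
abbrev Conjugates (N : Type*) [Field N] [Algebra (RatFunc ℂ) N] : Type _ :=
  (minpoly ℂ⟮F⟯ (RatFunc.X : RatFunc ℂ)).rootSet N

variable {N : Type} [Field N] [Algebra (RatFunc ℂ) N] [IsGalois ℂ⟮F⟯ N]

theorem splits_minpoly_X :
    ((minpoly ℂ⟮F⟯ (RatFunc.X : RatFunc ℂ)).map (algebraMap ℂ⟮F⟯ N)).Splits := by
  have := Normal.splits (inferInstance : Normal ℂ⟮F⟯ N) (algebraMap (RatFunc ℂ) N RatFunc.X)
  rwa [minpoly.algebraMap_eq (algebraMap (RatFunc ℂ) N).injective] at this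

theorem isSeparable_X (hF : 0 < degree F) : (minpoly ℂ⟮F⟯ (RatFunc.X : RatFunc ℂ)).Separable := by
  have := finiteDimensional_of_degree_pos hF
  exact (minpoly.irreducible (IsIntegral.of_finite _ _)).separable

theorem card_conjugates (hF : 0 < degree F) : Nat.card (Conjugates F N) = degree F := by
  rw [← natDegree_minpoly_X hF, Nat.card_eq_fintype_card]
  exact card_rootSet_eq_natDegree (isSeparable_X hF) splits_minpoly_X

theorem map_minpoly_X_eq_prod (hF : 0 < degree F) :
    (minpoly ℂ⟮F⟯ (RatFunc.X : RatFunc ℂ)).map (algebraMap ℂ⟮F⟯ N) =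
      ∏ i : Conjugates F N, (X - C (i : N)) := by
  classical
  have := finiteDimensional_of_degree_pos hF
  have hmon := (minpoly.monic (IsIntegral.of_finite ℂ⟮F⟯ (RatFunc.X : RatFunc ℂ))).map
    (algebraMap ℂ⟮F⟯ N)
  rw [splits_minpoly_X.eq_prod_roots, hmon.leadingCoeff, C_1, one_mul]
  have hnd := nodup_roots ((isSeparable_X hF).map (f := algebraMap ℂ⟮F⟯ N))
  have h1 : ∏ i : Conjugates F N, (X - C (i : N)) =
      ∏ x ∈ ((minpoly ℂ⟮F⟯ (RatFunc.X : RatFunc ℂ)).map (algebraMap ℂ⟮F⟯ N)).roots.toFinset,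
        (X - C x) := by
    symm
    apply Finset.prod_subtype
    intro x
    rw [Multiset.mem_toFinset, rootSet_def, Finset.mem_coe, Multiset.mem_toFinset]
  rw [h1, Finset.prod, Multiset.toFinset_val, hnd.dedup]

/-- P - vQ vanishes at X and is monic since deg Q < deg P. Its degree is already [ℂ(X) : ℂ(F)], so
it is the minimal polynomial. -/
theorem minpoly_X_eq (hF : 0 < degree F) {P Q : ℂ[X]} {v : ℂ⟮F⟯} (hP : P.Monic)
    (hPn : P.natDegree = degree F) (hQ : Q.degree < P.degree)
    (h : algebraMap ℂ[X] (RatFunc ℂ) P = v * algebraMap ℂ[X] (RatFunc ℂ) Q) :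
    minpoly ℂ⟮F⟯ (RatFunc.X : RatFunc ℂ) =
      P.map (algebraMap ℂ ℂ⟮F⟯) - C v * Q.map (algebraMap ℂ ℂ⟮F⟯) := by
  have := finiteDimensional_of_degree_pos hF
  have hlt : (C v * Q.map (algebraMap ℂ ℂ⟮F⟯)).degree < (P.map (algebraMap ℂ ℂ⟮F⟯)).degree := by
    rw [hP.degree_map]
    refine (degree_mul_le _ _).trans_lt (lt_of_le_of_lt (add_le_add_left degree_C_le _) ?_)
    rwa [zero_add, degree_map]
  have hmon := (hP.map (algebraMap ℂ ℂ⟮F⟯)).sub_of_left hlt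
  have hX : ∀ p : ℂ[X], aeval (RatFunc.X : RatFunc ℂ) (p.map (algebraMap ℂ ℂ⟮F⟯)) =
      algebraMap ℂ[X] (RatFunc ℂ) p := by
    intro p
    rw [aeval_map_algebraMap, ← RatFunc.algebraMap_X, aeval_algebraMap_apply, aeval_X_left_apply]
  have hdvd : minpoly ℂ⟮F⟯ (RatFunc.X : RatFunc ℂ) ∣
      P.map (algebraMap ℂ ℂ⟮F⟯) - C v * Q.map (algebraMap ℂ ℂ⟮F⟯) := by
    refine minpoly.dvd _ _ ?_
    rw [map_sub, map_mul, aeval_C, hX, hX, h]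
    exact sub_self _
  have hdeg : (P.map (algebraMap ℂ ℂ⟮F⟯) - C v * Q.map (algebraMap ℂ ℂ⟮F⟯)).natDegree ≤
      (minpoly ℂ⟮F⟯ (RatFunc.X : RatFunc ℂ)).natDegree := by
    rw [natDegree_minpoly_X hF, natDegree_eq_of_degree_eq (degree_sub_eq_left_of_degree_lt hlt),
      natDegree_map, hPn]
  exact (eq_of_monic_of_dvd_of_natDegree_le (minpoly.monic (IsIntegral.of_finite _ _)) hmon
    hdvd hdeg).symm

end Conjugates

/-! ### Admissibility with respect to the Galois group -/

section GaloisAdmissible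

open Polynomial IntermediateField

variable {F : RatFunc ℂ}

theorem exists_isCoprime_of_mem_adjoin {v x : RatFunc ℂ} (hv : 0 < degree v) (hx : x ∈ ℂ⟮v⟯) :
    ∃ p q : ℂ[X], IsCoprime p q ∧ x * aeval v q = aeval v p := by
  obtain ⟨f, rfl⟩ := (mem_adjoin_iff hv).1 hx
  refine ⟨f.num, f.denom, f.isCoprime_num_denom, ?_⟩
  have h0 : aeval v f.denom ≠ 0 := fun h =>
    f.denom_ne_zero ((transcendental_iff.1 (transcendental_of_degree hv)) _ h)
  exact div_mul_cancel₀ (aeval v f.num) h0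

theorem degree_eq_of_adjoin_eq {v : RatFunc ℂ} (h : ℂ⟮v⟯ = ℂ⟮F⟯) : degree v = degree F := by
  rw [← finrank_adjoin, ← finrank_adjoin, h]

variable {N : Type} [Field N] [Algebra (RatFunc ℂ) N] [FiniteDimensional ℂ⟮F⟯ N] [IsGalois ℂ⟮F⟯ N]

variable (F N) in
/-- The Galois group of `N` over `ℂ(F)` as a group of permutations of the conjugates of `X`. -/
noncomputable def galoisPerm : Subgroup (Equiv.Perm (Conjugates F N)) :=
  (MulAction.toPermHom (N ≃ₐ[ℂ⟮F⟯] N) (Conjugates F N)).range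

/-- A polynomial invariant under the Galois permutations takes, at the conjugates of X, a value in
the fixed field ℂ(F) = ℂ(v), hence p(v)/q(v) with coprime p and q. -/
theorem exists_isAdmissible (hF : 0 < degree F) : ∃ Adm, IsAdmissible F (galoisPerm F N) Adm := by
  obtain ⟨P, Q, v, hP, hPn, hQ, hPQ, hv, hvPQ, hfib⟩ := exists_normal_form hF
  let _ : Algebra ℂ N := ((algebraMap (RatFunc ℂ) N).comp (algebraMap ℂ (RatFunc ℂ))).toAlgebra
  have : IsScalarTower ℂ (RatFunc ℂ) N := IsScalarTower.of_algebraMap_eq fun _ => rfl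
  have : IsScalarTower ℂ ℂ⟮F⟯ N := IsScalarTower.of_algebraMap_eq fun _ => rfl
  have hvF : v ∈ ℂ⟮F⟯ := hv ▸ mem_adjoin_simple_self ℂ v
  have hvd : 0 < degree v := by rwa [degree_eq_of_adjoin_eq hv]
  have hcard := card_conjugates (N := N) hF
  have hpos : 0 < Nat.card (Conjugates F N) := by rwa [hcard]
  obtain ⟨i₀⟩ := (Nat.card_pos_iff.1 hpos).1
  refine ⟨_, isAdmissible_relationSet hF hcard (v := algebraMap (RatFunc ℂ) N v)
    (P := P) (Q := Q) (ξ := fun i => (i : N)) ?_ hPQ hfib ?_ ?_ i₀⟩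
  · exact (transcendental_algebraMap_iff (algebraMap (RatFunc ℂ) N).injective).2
      (transcendental_of_degree hvd)
  · rw [← map_minpoly_X_eq_prod hF, minpoly_X_eq hF (v := ⟨v, hvF⟩) hP hPn hQ hvPQ,
      Polynomial.map_sub, Polynomial.map_mul, Polynomial.map_map, Polynomial.map_map, map_C,
      ← IsScalarTower.algebraMap_eq]
    rfl
  · intro Ψ hΨ
    have hfix : ∀ g : N ≃ₐ[ℂ⟮F⟯] N, g (MvPolynomial.aeval (fun i : Conjugates F N => (i : N)) Ψ) =
        MvPolynomial.aeval (fun i : Conjugates F N => (i : N)) Ψ := by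
      intro g
      conv_rhs => rw [← hΨ _ ⟨g, rfl⟩, MvPolynomial.aeval_rename]
      have := MvPolynomial.comp_aeval_apply (fun i : Conjugates F N => (i : N))
        ((g : N →ₐ[ℂ⟮F⟯] N).restrictScalars ℂ) Ψ
      exact this
    obtain ⟨k, hk⟩ := (IsGalois.mem_range_algebraMap_iff_fixed _).2 hfix
    obtain ⟨p, q, hpq, e⟩ := exists_isCoprime_of_mem_adjoin (v := v) hvd (x := k)
      (by rw [hv]; exact k.2)
    refine ⟨p, q, hpq, ?_⟩
    rw [← hk, aeval_algebraMap_apply, aeval_algebraMap_apply, ← e, map_mul]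
    rfl

end GaloisAdmissible

/-! ### From orbits on the conjugates to the two-orbit condition -/

section Orbits

open IntermediateField

variable {F : RatFunc ℂ} {N : Type} [Field N] [Algebra (RatFunc ℂ) N]

theorem mem_galSubgroup_top_iff {σ : N ≃ₐ[ℂ⟮F⟯] N} :
    σ ∈ galSubgroup N (⊤ : IntermediateField ℂ⟮F⟯ (RatFunc ℂ)) ↔
      σ (algebraMap (RatFunc ℂ) N RatFunc.X) = algebraMap (RatFunc ℂ) N RatFunc.X := by
  rw [mem_galSubgroup]
  refine ⟨fun h => h _ trivial, fun h a _ => ?_⟩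
  have ha : a ∈ ℂ⟮F⟯⟮(RatFunc.X : RatFunc ℂ)⟯ := by
    rw [RatFunc.IntermediateField.adjoin_X]
    trivial
  obtain ⟨r, s, rfl⟩ := (mem_adjoin_simple_iff _ a).1 ha
  rw [map_div₀, ← Polynomial.aeval_algebraMap_apply, ← Polynomial.aeval_algebraMap_apply, map_div₀,
    ← Polynomial.aeval_algHom_apply, ← Polynomial.aeval_algHom_apply, h]

/-- An automorphism whose powers have at most two orbits on the conjugates of `X`. -/
theorem twoOrbits_of_zpow [IsGalois ℂ⟮F⟯ N] [FiniteDimensional ℂ⟮F⟯ N] (hF : 0 < degree F)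
    {c : N ≃ₐ[ℂ⟮F⟯] N} {a b : Conjugates F N}
    (h : ∀ x : Conjugates F N, ∃ i : ℤ, x = c ^ i • a ∨ x = c ^ i • b) :
    ∃ g, TwoOrbits c g (galSubgroup N (⊤ : IntermediateField ℂ⟮F⟯ (RatFunc ℂ))) ⊤ := by
  have hfin := finiteDimensional_of_degree_pos hF
  have hint : IsIntegral ℂ⟮F⟯ (RatFunc.X : RatFunc ℂ) := IsIntegral.of_finite _ _
  have hmin := minpoly.algebraMap_eq (A := ℂ⟮F⟯) (algebraMap (RatFunc ℂ) N).injective RatFunc.X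
  let θ : Conjugates F N := ⟨algebraMap (RatFunc ℂ) N RatFunc.X,
    Polynomial.mem_rootSet.2 ⟨minpoly.ne_zero hint, by rw [← hmin]; exact minpoly.aeval _ _⟩⟩
  have htrans : ∀ x : Conjugates F N, ∃ g : N ≃ₐ[ℂ⟮F⟯] N, g • θ = x := by
    rintro ⟨x, hx⟩
    replace hx := (Polynomial.mem_rootSet.1 hx).2
    rw [← hmin] at hx
    obtain ⟨g, hg⟩ := minpoly.exists_algEquiv_of_root'
      (Algebra.IsAlgebraic.isAlgebraic (algebraMap (RatFunc ℂ) N RatFunc.X)) hx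
    exact ⟨g, Subtype.ext hg⟩
  have hstab : ∀ x : N ≃ₐ[ℂ⟮F⟯] N, x • θ = θ →
      x ∈ galSubgroup N (⊤ : IntermediateField ℂ⟮F⟯ (RatFunc ℂ)) := fun x hx =>
    mem_galSubgroup_top_iff.2 (congrArg Subtype.val hx)
  have key : ∀ a b : Conjugates F N, (∀ x : Conjugates F N, ∃ i : ℤ, x = c ^ i • a ∨ x = c ^ i • b) →
      (∃ i : ℤ, θ = c ^ i • a) →
      ∃ g, TwoOrbits c g (galSubgroup N (⊤ : IntermediateField ℂ⟮F⟯ (RatFunc ℂ))) ⊤ := by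
    rintro a b h ⟨i, hi⟩
    obtain ⟨g, rfl⟩ := htrans b
    refine ⟨g, trivial, trivial, le_top, fun x _ => ?_⟩
    obtain ⟨j, hj | hj⟩ := h (x • θ)
    · refine ⟨j - i, (c ^ (j - i))⁻¹ * x, hstab _ ?_, Or.inl (by group)⟩
      rw [mul_smul, hj, inv_smul_eq_iff, hi, ← mul_smul, ← zpow_add, sub_add_cancel]
    · refine ⟨j, (c ^ j * g)⁻¹ * x, hstab _ ?_, Or.inr (by group)⟩
      rw [mul_smul, hj, inv_smul_eq_iff, mul_smul]
  -- The base point X lies on one of the two orbits. By symmetry it may be that of a, and g is taken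
  -- to move X to b.
  obtain ⟨i, hi | hi⟩ := h θ
  · exact key a b h ⟨i, hi⟩
  · exact key b a (fun x => (h x).imp fun _ => Or.symm) ⟨i, hi⟩

end Orbits

/-! ### Monodromy permutations are Galois permutations -/

section Lifts

open Filter Topology Function

variable {F : RatFunc ℂ} {I : Type} [Finite I]

theorem nonempty_equiv_fiber (hcard : Nat.card I = degree F) {y : OnePoint ℂ}
    (hy : y ∈ noncriticalValues F) : Nonempty (I ≃ Fiber F y) := by
  have h1 : (sphereMap F ⁻¹' {y}).encard = degree F := hy
  have h2 : Finite (Fiber F y) := Set.finite_of_encard_eq_coe h1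
  have h3 : Nat.card (Fiber F y) = degree F := by
    change Nat.card (sphereMap F ⁻¹' {y} : Set (OnePoint ℂ)) = _
    rw [Nat.card_coe_set_eq, Set.ncard, h1]
    rfl
  rw [← Finite.card_eq, hcard, h3]

/-- The times at which two lifts agree form a closed set. It is also open, by uniqueness of local
sections over noncritical values, so lifts starting apart never meet. -/
theorem lift_ne_lift (hcard : Nat.card I = degree F) (hF : 0 < degree F)
    {δ δ' : unitInterval → OnePoint ℂ} (hδ : Continuous δ) (hδ' : Continuous δ')
    (h : ∀ t, sphereMap F (δ t) = sphereMap F (δ' t))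
    (hnc : ∀ t, sphereMap F (δ t) ∈ noncriticalValues F) (h0 : δ 0 ≠ δ' 0) (t : unitInterval) :
    δ t ≠ δ' t := by
  have hopen : IsOpen {t | δ t = δ' t} := by
    rw [isOpen_iff_mem_nhds]
    intro t ht
    obtain ⟨l⟩ := nonempty_equiv_fiber hcard (hnc t)
    obtain ⟨V, hV, s, -, -, -, U, hU, hUs⟩ := exists_local_sections (I := I)
      (map_sphereMap_nhds hF) (fun y => by rw [hcard]; exact encard_fiber_le hF y)
      (p := fun i => (l i : OnePoint ℂ)) (Subtype.val_injective.comp l.injective)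
      (fun i => (l i).2)
    set i := l.symm ⟨δ t, rfl⟩ with hi
    have hli : (l i : OnePoint ℂ) = δ t := by rw [hi, Equiv.apply_symm_apply]
    have hU' := hU i
    rw [hli] at hU'
    have hUt : δ ⁻¹' U i ∈ 𝓝 t := hδ.continuousAt hU'
    have hUt' : δ' ⁻¹' U i ∈ 𝓝 t := hδ'.continuousAt (by rwa [← show δ t = δ' t from ht])
    have hVt : (fun t => sphereMap F (δ t)) ⁻¹' V ∈ 𝓝 t :=
      ((continuous_sphereMap hF).comp hδ).continuousAt hV
    filter_upwards [hUt, hUt', hVt] with r h1 h2 h3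
    have h4 := hUs i _ h1 h3
    have h5 := hUs i _ h2 (by rw [← h r]; exact h3)
    change δ r = δ' r
    rw [h4, h5, h r]
  have hclopen : IsClopen {t | δ t = δ' t} := ⟨isClosed_eq hδ hδ', hopen⟩
  rcases isClopen_iff.1 hclopen with he | he
  · intro ht
    have : t ∈ {t | δ t = δ' t} := ht
    rw [he] at this
    exact this
  · have : (0 : unitInterval) ∈ {t | δ t = δ' t} := by rw [he]; trivial
    exact absurd this h0

/-- The lifts of the loop form a path of labellings whose end is the start permuted by σ. The
numbering ρ depends on σ, which is harmless because only a generator of the cyclic group is needed.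
-/
theorem exists_equiv_of_mem_monodromyGroup [Nonempty I] {Γ : Subgroup (Equiv.Perm I)}
    {Adm : Set (I → ℂ)} (hA : IsAdmissible F Γ Adm) (hcard : Nat.card I = degree F)
    (hF : 0 < degree F) {z₀ : noncriticalValues F} {σ : Equiv.Perm (Fiber F z₀)}
    (hσ : σ ∈ monodromyGroup F z₀) : ∃ ρ : I ≃ Fiber F z₀, ρ.permCongrHom.symm σ ∈ Γ := by
  obtain ⟨γ, hγ⟩ := hσ
  choose δ hδ using hγ
  obtain ⟨l⟩ := nonempty_equiv_fiber hcard z₀.2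
  have hlab : ∀ t, (fun i => δ (l i) t) ∈ labellings F I := by
    refine fun t => ⟨fun i j hij => ?_, fun i j => by rw [hδ, hδ]⟩
    by_contra hne
    refine lift_ne_lift hcard hF (δ (l i)).continuous (δ (l j)).continuous
      (fun t => by rw [hδ, hδ]) (fun t => by rw [hδ]; exact (γ t).2) ?_ t hij
    rw [Path.source, Path.source]
    exact fun h => hne (l.injective (Subtype.ext h))
  obtain ⟨τ, hτ⟩ := exists_labelling_of_path hA hcard hF (p := fun t i => δ (l i) t)
    (σ := l.permCongrHom.symm σ) (continuous_pi fun i => (δ (l i)).continuous) hlab (by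
      funext i
      simp [Equiv.permCongrHom])
  exact ⟨τ.trans l, hτ⟩

end Lifts

/-! ### A generator with at most two orbits -/

section Cyclic

theorem exists_pair_of_card_le_two {α : Type*} [Finite α] [Nonempty α] (h : Nat.card α ≤ 2) :
    ∃ a b : α, ∀ x, x = a ∨ x = b := by
  classical
  have := Fintype.ofFinite α
  obtain ⟨a⟩ := ‹Nonempty α›
  by_contra! hcon
  obtain ⟨b, hb, -⟩ := hcon a a
  obtain ⟨c, hca, hcb⟩ := hcon a b
  have h3 : ({a, b, c} : Finset α).card = 3 := Finset.card_eq_three.2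
    ⟨a, b, c, hb.symm, hca.symm, hcb.symm, rfl⟩
  have := Finset.card_le_univ ({a, b, c} : Finset α)
  rw [Nat.card_eq_fintype_card] at h
  omega

theorem exists_zpow_of_card_orbits_le_two {α : Type*} [Finite α] [Nonempty α]
    {H : Subgroup (Equiv.Perm α)} [hH : IsCyclic H]
    (horb : Nat.card (MulAction.orbitRel.Quotient H α) ≤ 2) :
    ∃ σ ∈ H, ∃ a b : α, ∀ x, ∃ i : ℤ, x = (σ ^ i) a ∨ x = (σ ^ i) b := by
  obtain ⟨σ, hσ⟩ := hH.exists_generator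
  have : Finite (MulAction.orbitRel.Quotient H α) := Quotient.finite _
  have : Nonempty (MulAction.orbitRel.Quotient H α) := ⟨Quotient.mk'' (Classical.arbitrary α)⟩
  obtain ⟨a, b, hab⟩ := exists_pair_of_card_le_two horb
  induction a using Quotient.inductionOn' with | _ a
  induction b using Quotient.inductionOn' with | _ b
  have key : ∀ x y : α, (Quotient.mk'' x : MulAction.orbitRel.Quotient H α) = Quotient.mk'' y →
      ∃ i : ℤ, x = ((σ : Equiv.Perm α) ^ i) y := by
    intro x y hxy
    obtain ⟨g, hg⟩ := Quotient.exact' hxy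
    obtain ⟨i, rfl⟩ := hσ g
    exact ⟨i, hg.symm⟩
  refine ⟨σ, σ.2, a, b, fun x => ?_⟩
  rcases hab (Quotient.mk'' x) with h | h
  · exact (key _ _ h).imp fun _ => Or.inl
  · exact (key _ _ h).imp fun _ => Or.inr

end Cyclic

/-! ### Assembling the proof -/

section Main

open IntermediateField

theorem exchangeProperty_of_monodromy {F : RatFunc ℂ} (hF : 0 < degree F) {z₀ : noncriticalValues F}
    {H : Subgroup (Equiv.Perm (Fiber F z₀))} (hHF : H ≤ monodromyGroup F z₀) (hH : IsCyclic H)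
    (horb : Nat.card (MulAction.orbitRel.Quotient H (Fiber F z₀)) ≤ 2) :
    ExchangeProperty ℂ⟮F⟯ := by
  have := finiteDimensional_of_degree_pos hF
  obtain ⟨N, _, _, hfin, hgal⟩ := exists_isGalois ℂ⟮F⟯
  obtain ⟨Adm, hA⟩ := exists_isAdmissible (N := N) hF
  have hcard := card_conjugates (N := N) hF
  have hne : Nonempty (Conjugates F N) := (Nat.card_pos_iff.1 (by rwa [hcard])).1
  obtain ⟨l⟩ := nonempty_equiv_fiber hcard z₀.2
  have := Finite.of_equiv _ l
  have := l.nonempty_congr.1 hne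
  obtain ⟨σ, hσ, a, b, hab⟩ := exists_zpow_of_card_orbits_le_two horb
  obtain ⟨ρ, c, hc⟩ := exists_equiv_of_mem_monodromyGroup hA hcard hF (hHF hσ)
  have hpow : ∀ (i : ℤ) (x : Fiber F z₀), ρ.symm ((σ ^ i) x) = c ^ i • ρ.symm x := by
    intro i x
    have h1 : MulAction.toPermHom (N ≃ₐ[ℂ⟮F⟯] N) (Conjugates F N) (c ^ i) =
        ρ.permCongrHom.symm (σ ^ i) := by
      rw [map_zpow, map_zpow]
      exact congrArg (· ^ i) hc
    have h2 := congrArg (fun π : Equiv.Perm (Conjugates F N) => π (ρ.symm x)) h1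
    simp only [MulAction.toPermHom_apply, MulAction.toPerm_apply] at h2
    rw [h2]
    simp [Equiv.permCongrHom]
  obtain ⟨g, hg⟩ := twoOrbits_of_zpow hF (c := c) (a := ρ.symm a) (b := ρ.symm b) (by
    intro x
    obtain ⟨i, hi⟩ := hab (ρ x)
    refine ⟨i, ?_⟩
    rw [← hpow, ← hpow, Equiv.eq_symm_apply, Equiv.eq_symm_apply]
    exact hi)
  exact exchangeProperty_of_twoOrbits hg

/-- The chain of replacements reaches the second decomposition itself, so only this trivial
equivalence is needed at its end. -/
theorem equivalent_refl (D : List (RatFunc ℂ)) : Equivalent D D :=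
  ⟨rfl, fun _ => RatFunc.X, fun _ => degree_X, rfl, rfl, fun i _ _ => by rw [comp_X, X_comp]⟩

end Main

end RatDecomp

theorem corollary3p6 (F : RatFunc ℂ) (z₀ : RatDecomp.noncriticalValues F)
    (H : Subgroup (Equiv.Perm (RatDecomp.Fiber F z₀)))
    (hHF : H ≤ RatDecomp.monodromyGroup F z₀) (hH : IsCyclic H)
    (horb : Nat.card (MulAction.orbitRel.Quotient H (RatDecomp.Fiber F z₀)) ≤ 2)
    (D E : List (RatFunc ℂ))
    (hD : RatDecomp.IsMaximalDecomposition F D) (hE : RatDecomp.IsMaximalDecomposition F E) :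
    RatDecomp.WeaklyEquivalent F D E ∧
      (D.map RatDecomp.degree : Multiset ℕ) = (E.map RatDecomp.degree : Multiset ℕ) := by
  obtain ⟨⟨-, rfl⟩, hD⟩ := hD
  have hF := RatDecomp.AllIndecomposable.degree_pos hD
  obtain ⟨h1, h2⟩ := (RatDecomp.exchangeProperty_of_monodromy hF hHF hH horb).reflTransGen_step
    _ D E hD hE.2 hE.1.2.symm rfl le_rfl
  exact ⟨⟨E, h1, RatDecomp.equivalent_refl E⟩, h2⟩
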